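/- **Setting.** Let $\gamma\in(0,1]$, $N=\lfloor 1/\gamma\rfloor$, and let $\mathcal H=\bigoplus_{n=0}^N\mathcal H_n$ be a commutative $N$-truncated connected graded Hopf algebra over $\mathbb R$: a finite-dimensional graded commutative algebra with $\mathcal H_0=\mathbb R\mathbf 1\neq 0$ and $\mathcal H_n=0$ for $n>N$, together with a graded coassociative coproduct $\Delta$ with counit $\epsilon$, such that $\Delta(xy)-\Delta(x)\Delta(y)\in\bigoplus_{p+q\ge N+1}\mathcal H_p\otimes\mathcal H_q$ for all $x,y$. Let $L_1,\dots,L_d:\mathcal H\to\mathcal H$ be linear maps of degree one such that $\Delta L_i(x)=(\mathrm{Id}\otimes L_i)\Delta(x)+L_i(x)\otimes\mathbf 1$ for all $x$ of degree $<N$ and such that $(L_i(\mathbf 1))_i$ is a basis of $\mathcal H_1$. Let $\pi_j$ be the projection onto $\mathcal H_j$, and let $\star$ be the product on $\mathcal H^*$ dual to $\Delta$. Fix on $\mathcal H$ a graded norm (every finite sum of the $\pi_j$ has norm at most $1$) whose dual norm is submultiplicative for $\star$; give $\mathbb R^e$ and $\mathcal H^e$ the maximum norms over components. Let $T>0$ and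 let $\omega$ be a right-continuous control on $[0,T]$: $\omega(s,t)\ge 0$ for $0\le s\le t\le T$, $\omega(t,t)=0$, $\omega(s,u)+\omega(u,t)\le\omega(s,t)$ for $s\le u\le t$, and $\omega(s,t_+)=\omega(s,t)$ for $s\le t<T$. A rough path on $[0,T']$ is a family $\mathbf X_{st}\in\mathcal H^*$, $0\le s\le t\le T'$, with $\mathbf X_{st}(\mathbf 1)=1$, $\mathbf X_{st}(xy)=\mathbf X_{st}(x)\mathbf X_{st}(y)$ for homogeneous $x,y$ with $|x|+|y|\le N$, $\mathbf X_{st}=\mathbf X_{su}\star\mathbf X_{ut}$ for $s\le u\le t$, and $\|\mathbf X\|_{\omega,\gamma}<\infty$. Here, for a family $\mathbf X_{st}\in\mathcal H^*$ (resp. $R_{st}\in\mathcal H^e$), $\|\mathbf X\|_{\omega,\gamma}$ (resp. $\|R\|_{\omega,\gamma}$) is the least $C\ge0$ such that $\|\mathbf X_{st}\circ\pi_j\|\le C\omega(s,t)^{j\gamma}$ (resp. $\|\pi_jR_{st}\|\le C\omega(s,t)^{(N-j)\gamma}$) for all $0\le j\le N$ and $0\le s\le t\le T'$ (with $0^0=1$).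 For $\mathbf Z:[0,T']\to\mathcal H^e$ put $R_{\mathbf X}(\mathbf Z)_{st}=\mathbf Z_t-T_{st}\mathbf Z_s$, with $T_{st}=(\mathbf X_{st}\otimes\mathrm{Id})\Delta$ applied componentwise. $\mathbf Z$ is $\mathbf X$-controlled if $\|R_{\mathbf X}(\mathbf Z)\|_{\omega,\gamma}<\infty$; its norm is $\|\mathbf Z\|=\|\mathbf Z_0\|+\|R_{\mathbf X}(\mathbf Z)\|_{\omega,\gamma}$, and its underlying path is $Z_t=\epsilon(\mathbf Z_t)\in\mathbb R^e$. For $\varphi:\mathbb R^e\to\mathbb R^e$ put $$\varphi(\mathbf Z)_t=\varphi(Z_t)\mathbf 1+\sum_{n=1}^N\frac1{n!}D^n\varphi(Z_t)\big(\overline{\mathbf Z}_t,\dots,\overline{\mathbf Z}_t\big),\qquad \overline{\mathbf Z}_t=\mathbf Z_t-Z_t\mathbf 1,$$ where $D^n\varphi(Z_t)$ is extended to $\mathcal H^e$ by means of the product of $\mathcal H$. For an $\mathbf X$-controlled path $\mathbf Y$, $\int_0^tY_r\,dX^i_r\in\mathbb R^e$ denotes the limit, under refinement of partitions of $[0,t]$,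 of the sums $\sum_{[u,v]}\langle\mathbf X_{uv},L_i(\mathbf Y_u)\rangle$. An $\mathbf X$-controlled path $\mathbf Z$ on $[0,T']$ is a solution driven by $\mathbf X$ with vector fields $\varphi=(\varphi_1,\dots,\varphi_d)$ and initial condition $Z_0\in\mathbb R^e$ if, for all $t\in[0,T']$, $$\mathbf Z_t=Z_0\mathbf 1+\sum_{i=1}^d\Big(L_i\big(\varphi_i(\mathbf Z)_t\big)+\Big(\int_0^t\varphi_i(Z)_r\,dX^i_r\Big)\mathbf 1\Big),$$ where these integrals are those of the controlled paths $\mathbf Y=\varphi_i(\mathbf Z)$. For two controlled paths put $$d(\mathbf Z,\widetilde{\mathbf Z})=\|\mathbf Z_0-\widetilde{\mathbf Z}_0\|+\|R_{\mathbf X}(\mathbf Z)-R_{\widetilde{\mathbf X}}(\widetilde{\mathbf Z})\|_{\omega,\gamma},$$ let $K=K(Z,\widetilde Z)$ be the convex hull of $Z([0,T'])\cup\widetilde Z([0,T'])$, and put $\|\psi\|^m_K=\sum_{j=0}^m\sup_{z\in K}\|D^j\psi(z)\|$. All these norms and $d$ are taken on $[0,T']$. **Theorem (Universal limit theorem).**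 For every $M$ there are constants $A,B_1,\dots,B_d,E\ge0$ and, for every $M'$, a time $T_0\in(0,T]$ such that the following holds for every $T'\in[0,T_0]$. Let $\mathbf X,\widetilde{\mathbf X}$ be rough paths on $[0,T']$, let $\varphi_i,\widetilde\varphi_i\in C^{N+1}(\mathbb R^e,\mathbb R^e)$ for $1\le i\le d$, and let $\mathbf Z$ and $\widetilde{\mathbf Z}$ be solutions on $[0,T']$ driven by $\mathbf X$ with vector fields $\varphi_i$ and by $\widetilde{\mathbf X}$ with vector fields $\widetilde\varphi_i$, respectively. If $\|\mathbf X\|_{\omega,\gamma}$, $\|\widetilde{\mathbf X}\|_{\omega,\gamma}$, $\|\mathbf Z\|$, $\|\varphi_i\|^{N+1}_{K}$ and $\|\widetilde\varphi_i\|^{N+1}_{K}$ are at most $M$ for all $i$, and $\|\widetilde{\mathbf Z}\|\le M'$, then $$d(\mathbf Z,\widetilde{\mathbf Z})\le A\|Z_0-\widetilde Z_0\|_{\mathbb R^e}+\sum_{i=1}^dB_i\|\varphi_i-\widetilde\varphi_i\|^N_{K}+E\|\mathbf X-\widetilde{\mathbf X}\|_{\omega,\gamma}.$$ Thus the solution depends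 continuously, in fact locally Lipschitz-continuously, on the initial condition, the vector fields and the driving rough path. -/

import Mathlib

open scoped TensorProduct Topology

noncomputable section

namespace RoughControl

/-! ## Truncated connected graded Hopf algebras -/

section Hopf

variable {H : Type*} [CommRing H] [Algebra ℝ H]

/-- The subspace `𝒜 p ⊗ 𝒜 q` of `H ⊗ H`. -/
def tensorPiece (𝒜 : ℕ → Submodule ℝ H) (p q : ℕ) : Submodule ℝ (H ⊗[ℝ] H) :=
  LinearMap.range (TensorProduct.map (𝒜 p).subtype (𝒜 q).subtype)

/-- `H = ⨁ₙ 𝒜 n` is a commutative `N`-truncated connected graded Hopf algebra over `ℝ`.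
The graded commutative algebra structure is `GradedAlgebra 𝒜`, the (coassociative, counital)
coproduct is that of `Coalgebra ℝ H`. Product and coproduct are compatible only up to terms
of total degree at least `N + 1`. -/
structure IsTruncatedHopf [Coalgebra ℝ H] (𝒜 : ℕ → Submodule ℝ H) [GradedAlgebra 𝒜] (N : ℕ) :
    Prop where
  finite : ∀ n, Module.Finite ℝ (𝒜 n)
  truncated : ∀ n, N < n → 𝒜 n = ⊥
  one_ne_zero : (1 : H) ≠ 0
  connected : 𝒜 0 = Submodule.span ℝ {(1 : H)}
  comul_graded : ∀ n, ∀ x ∈ 𝒜 n,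
    Coalgebra.comul (R := ℝ) x ∈ ⨆ (p : ℕ) (q : ℕ) (_ : p + q = n), tensorPiece 𝒜 p q
  comul_mul : ∀ x y : H,
    Coalgebra.comul (R := ℝ) (x * y) - Coalgebra.comul (R := ℝ) x * Coalgebra.comul (R := ℝ) y
      ∈ ⨆ (p : ℕ) (q : ℕ) (_ : N + 1 ≤ p + q), tensorPiece 𝒜 p q

/-- The operators `L i` raise the degree by one, satisfy the cocycle condition
`Δ L i x = (Id ⊗ L i) Δ x + L i x ⊗ 1`, and the `L i 1` form a basis of the degree-one part.
On elements of top degree `N` the operators vanish, so there the cocycle condition of the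
untruncated algebra is lost by truncation; it is imposed in degrees `n < N`. -/
structure IsCocycleFamily [Coalgebra ℝ H] (𝒜 : ℕ → Submodule ℝ H) (N : ℕ) {d : ℕ}
    (L : Fin d → H →ₗ[ℝ] H) : Prop where
  degree : ∀ i n, ∀ x ∈ 𝒜 n, L i x ∈ 𝒜 (n + 1)
  cocycle : ∀ i n, n < N → ∀ x ∈ 𝒜 n,
    Coalgebra.comul (R := ℝ) (L i x)
      = TensorProduct.map LinearMap.id (L i) (Coalgebra.comul (R := ℝ) x) + L i x ⊗ₜ[ℝ] (1 : H)
  linearIndependent : LinearIndependent ℝ fun i => L i 1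
  span_eq : Submodule.span ℝ (Set.range fun i => L i 1) = 𝒜 1

/-- Convolution product `ξ ⋆ η` of functionals, the transpose of the coproduct. -/
def conv [Coalgebra ℝ H] (ξ η : H →ₗ[ℝ] ℝ) : H →ₗ[ℝ] ℝ :=
  LinearMap.mul' ℝ ℝ ∘ₗ TensorProduct.map ξ η ∘ₗ Coalgebra.comul

/-- The transpose of `ξ ⋆ -`, that is `(ξ ⊗ Id) ∘ Δ : H → H`. -/
def convTranspose [Coalgebra ℝ H] (ξ : H →ₗ[ℝ] ℝ) : H →ₗ[ℝ] H :=
  (TensorProduct.lid ℝ H).toLinearMap ∘ₗ LinearMap.rTensor H ξ ∘ₗ Coalgebra.comul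

theorem apply_convTranspose [Coalgebra ℝ H] (ξ h : H →ₗ[ℝ] ℝ) (x : H) :
    h (convTranspose ξ x) = conv ξ h x := by
  have key : h ∘ₗ (TensorProduct.lid ℝ H).toLinearMap ∘ₗ LinearMap.rTensor H ξ
      = LinearMap.mul' ℝ ℝ ∘ₗ TensorProduct.map ξ h := by
    ext a b
    simp
  exact LinearMap.congr_fun key (Coalgebra.comul (R := ℝ) x)

/-- The operator norm on the dual of `H` (best constant), for the norm `p` on `H`. -/
def dualNorm (p : Seminorm ℝ H) (ξ : H →ₗ[ℝ] ℝ) : ℝ :=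
  sInf {C : ℝ | 0 ≤ C ∧ ∀ x, |ξ x| ≤ C * p x}

/-- `p` is a graded norm on `H` for which the convolution product is submultiplicative. -/
structure IsGoodNorm [Coalgebra ℝ H] (𝒜 : ℕ → Submodule ℝ H) [GradedAlgebra 𝒜]
    (p : Seminorm ℝ H) : Prop where
  definite : ∀ x, p x = 0 → x = 0
  graded : ∀ (S : Finset ℕ) (x : H), p (∑ j ∈ S, GradedAlgebra.proj 𝒜 j x) ≤ p x
  conv_le : ∀ ξ η : H →ₗ[ℝ] ℝ, dualNorm p (conv ξ η) ≤ dualNorm p ξ * dualNorm p η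

/-- The norm on `H ^ e`, equal to the operator norm of `h ↦ ⟨h, z⟩` from the dual of `H` to
`ℝ ^ e` with the maximum norm. -/
def vecNorm (p : Seminorm ℝ H) {e : ℕ} (z : Fin e → H) : ℝ :=
  ⨆ a, p (z a)

end Hopf

/-! ## Controls -/

/-- `ω` is a right-continuous control on `{(s, t) : 0 ≤ s ≤ t ≤ T}`
(values outside this set play no role). -/
structure IsRightContControl (ω : ℝ → ℝ → ℝ) (T : ℝ) : Prop where
  nonneg : ∀ s t, 0 ≤ s → s ≤ t → t ≤ T → 0 ≤ ω s t
  diag : ∀ t, 0 ≤ t → t ≤ T → ω t t = 0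
  superadd : ∀ s u t, 0 ≤ s → s ≤ u → u ≤ t → t ≤ T → ω s u + ω u t ≤ ω s t
  rightCont : ∀ s t, 0 ≤ s → s ≤ t → t < T → Filter.Tendsto (ω s) (𝓝[>] t) (𝓝 (ω s t))

/-! ## Rough paths and controlled rough paths -/

section Paths

variable {H : Type*} [CommRing H] [Algebra ℝ H]

/-- `C` bounds `‖π_j^* X_{st}‖ ω(s,t)^{-jγ}` for `0 ≤ j ≤ N`, `0 ≤ s ≤ t ≤ T`. -/
def RoughBound (𝒜 : ℕ → Submodule ℝ H) [GradedAlgebra 𝒜] (p : Seminorm ℝ H) (N : ℕ)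
    (γ : ℝ) (ω : ℝ → ℝ → ℝ) (T : ℝ) (X : ℝ → ℝ → H →ₗ[ℝ] ℝ) (C : ℝ) : Prop :=
  ∀ j ≤ N, ∀ s t, 0 ≤ s → s ≤ t → t ≤ T →
    dualNorm p (X s t ∘ₗ GradedAlgebra.proj 𝒜 j) ≤ C * ω s t ^ ((j : ℝ) * γ)

/-- The norm `‖X‖_{ω,γ}` on `[0, T]` of a two-parameter family of functionals
(best constant in the estimates). -/
def roughNorm (𝒜 : ℕ → Submodule ℝ H) [GradedAlgebra 𝒜] (p : Seminorm ℝ H) (N : ℕ)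
    (γ : ℝ) (ω : ℝ → ℝ → ℝ) (T : ℝ) (X : ℝ → ℝ → H →ₗ[ℝ] ℝ) : ℝ :=
  sInf {C : ℝ | 0 ≤ C ∧ RoughBound 𝒜 p N γ ω T X C}

/-- `X` is an `N`-truncated rough path on `[0, T]`, `γ`-adapted to `ω`. The underlying path is
`t ↦ X 0 t` restricted to the degree-one part: elements of degree one are primitive, so
`X s t = X 0 t - X 0 s` there by Chen's relation. -/
structure IsRoughPath [Coalgebra ℝ H] (𝒜 : ℕ → Submodule ℝ H) [GradedAlgebra 𝒜]
    (p : Seminorm ℝ H) (N : ℕ) (γ : ℝ) (ω : ℝ → ℝ → ℝ) (T : ℝ)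
    (X : ℝ → ℝ → H →ₗ[ℝ] ℝ) : Prop where
  map_one : ∀ s t, 0 ≤ s → s ≤ t → t ≤ T → X s t 1 = 1
  map_mul : ∀ s t, 0 ≤ s → s ≤ t → t ≤ T → ∀ m n, m + n ≤ N →
    ∀ x ∈ 𝒜 m, ∀ y ∈ 𝒜 n, X s t (x * y) = X s t x * X s t y
  chen : ∀ s u t, 0 ≤ s → s ≤ u → u ≤ t → t ≤ T → X s t = conv (X s u) (X u t)
  bound : ∃ C, RoughBound 𝒜 p N γ ω T X C

/-- The remainder `R_X(Z)_{st} = Z_t - T_{st} Z_s`, where `T_{st}` is the transpose of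
`X_{st} ⋆ -` applied componentwise. -/
def remainder [Coalgebra ℝ H] {e : ℕ} (X : ℝ → ℝ → H →ₗ[ℝ] ℝ) (Z : ℝ → Fin e → H) :
    ℝ → ℝ → Fin e → H :=
  fun s t a => Z t a - convTranspose (X s t) (Z s a)

/-- `C` bounds `‖π_j R_{st}‖ ω(s,t)^{-(N-j)γ}` for `0 ≤ j ≤ N`, `0 ≤ s ≤ t ≤ T`. -/
def RemBound (𝒜 : ℕ → Submodule ℝ H) [GradedAlgebra 𝒜] (p : Seminorm ℝ H) (N : ℕ)
    (γ : ℝ) (ω : ℝ → ℝ → ℝ) (T : ℝ) {e : ℕ} (R : ℝ → ℝ → Fin e → H) (C : ℝ) : Prop :=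
  ∀ j ≤ N, ∀ s t, 0 ≤ s → s ≤ t → t ≤ T →
    vecNorm p (fun a => GradedAlgebra.proj 𝒜 j (R s t a))
      ≤ C * ω s t ^ (((N : ℝ) - (j : ℝ)) * γ)

/-- The norm `‖R‖_{ω,γ}` on `[0, T]` of a two-parameter family in `H ^ e` (best constant). -/
def remNorm (𝒜 : ℕ → Submodule ℝ H) [GradedAlgebra 𝒜] (p : Seminorm ℝ H) (N : ℕ)
    (γ : ℝ) (ω : ℝ → ℝ → ℝ) (T : ℝ) {e : ℕ} (R : ℝ → ℝ → Fin e → H) : ℝ :=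
  sInf {C : ℝ | 0 ≤ C ∧ RemBound 𝒜 p N γ ω T R C}

/-- `Z` is an `X`-controlled rough path on `[0, T]`. -/
def IsControlled [Coalgebra ℝ H] (𝒜 : ℕ → Submodule ℝ H) [GradedAlgebra 𝒜]
    (p : Seminorm ℝ H) (N : ℕ) (γ : ℝ) (ω : ℝ → ℝ → ℝ) (T : ℝ) {e : ℕ}
    (X : ℝ → ℝ → H →ₗ[ℝ] ℝ) (Z : ℝ → Fin e → H) : Prop :=
  ∃ C, RemBound 𝒜 p N γ ω T (remainder X Z) C

/-- The controlled rough path norm `‖Z‖ = ‖Z_0‖ + ‖R_X(Z)‖_{ω,γ}` on `[0, T]`. -/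
def controlledNorm [Coalgebra ℝ H] (𝒜 : ℕ → Submodule ℝ H) [GradedAlgebra 𝒜]
    (p : Seminorm ℝ H) (N : ℕ) (γ : ℝ) (ω : ℝ → ℝ → ℝ) (T : ℝ) {e : ℕ}
    (X : ℝ → ℝ → H →ₗ[ℝ] ℝ) (Z : ℝ → Fin e → H) : ℝ :=
  vecNorm p (Z 0) + remNorm 𝒜 p N γ ω T (remainder X Z)

/-- The formal distance on `[0, T]` between `Z`, controlled by `X`, and `Z'`, controlled by
`X'`. -/
def formalDist [Coalgebra ℝ H] (𝒜 : ℕ → Submodule ℝ H) [GradedAlgebra 𝒜]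
    (p : Seminorm ℝ H) (N : ℕ) (γ : ℝ) (ω : ℝ → ℝ → ℝ) (T : ℝ) {e : ℕ}
    (X X' : ℝ → ℝ → H →ₗ[ℝ] ℝ) (Z Z' : ℝ → Fin e → H) : ℝ :=
  vecNorm p (Z 0 - Z' 0) + remNorm 𝒜 p N γ ω T (remainder X Z - remainder X' Z')

/-- The underlying point `ε(z)` of `ℝ ^ e`. -/
def base [Coalgebra ℝ H] {e : ℕ} (z : Fin e → H) : Fin e → ℝ :=
  fun a => Coalgebra.counit (R := ℝ) (z a)

/-- The image `φ(z)` of `z` in `H ^ e` under a map `φ` of `ℝ ^ e`: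
`φ(ε z) 1 + ∑_{n=1}^N (1/n!) D^n φ(ε z) (z̄, …, z̄)` with `z̄ = z - ε(z) 1`, the differential being
extended by the product of `H`. For a functional `h` with `h 1 = 0`, the number
`h (x̄₁ ⋯ x̄ₙ)` is the pairing of `x₁ ⊗ ⋯ ⊗ xₙ` with the iterated reduced coproduct of `h`, for
the coproduct dual to the product of `H`. -/
def smoothImage [Coalgebra ℝ H] (N : ℕ) {e : ℕ} (φ : (Fin e → ℝ) → Fin e → ℝ)
    (z : Fin e → H) : Fin e → H :=
  fun a => algebraMap ℝ H (φ (base z) a)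
    + ∑ n ∈ Finset.Icc 1 N, ((n.factorial : ℝ)⁻¹) • ∑ ι : Fin n → Fin e,
        (iteratedFDeriv ℝ n φ (base z) (fun k => Pi.single (ι k) 1) a) •
          ∏ k, (z (ι k) - algebraMap ℝ H (base z (ι k)))

end Paths

/-! ## Rough integrals and solutions -/

/-- The sum of `Ξ u v` over consecutive points `u < v` of the finite set `P`. -/
def riemannSum {V : Type*} [AddCommMonoid V] (Ξ : ℝ → ℝ → V) (P : Finset ℝ) : V :=
  (List.zipWith Ξ (P.sort (· ≤ ·)) (P.sort (· ≤ ·)).tail).sum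

/-- `P` is a partition of `[s, t]`, given by its division points. -/
def IsPartition (s t : ℝ) (P : Finset ℝ) : Prop :=
  s ∈ P ∧ t ∈ P ∧ ∀ u ∈ P, s ≤ u ∧ u ≤ t

/-- `K` is the limit of the Riemann sums of `Ξ` over partitions of `[s, t]`, in the sense of
refinement of partitions. -/
def IsRRSLimit {V : Type*} [NormedAddCommGroup V] (Ξ : ℝ → ℝ → V) (s t : ℝ) (K : V) : Prop :=
  ∀ ε > 0, ∃ P₀, IsPartition s t P₀ ∧
    ∀ P, IsPartition s t P → P₀ ⊆ P → ‖riemannSum Ξ P - K‖ < ε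

/-- `J` is the rough integral `∫_s^t Y_r dX^i_r` of the controlled rough path `Y`, where
`Li` is the cocycle of index `i`. -/
def IsRoughIntegral {H : Type*} [CommRing H] [Algebra ℝ H] (Li : H →ₗ[ℝ] H) {e : ℕ}
    (X : ℝ → ℝ → H →ₗ[ℝ] ℝ) (Y : ℝ → Fin e → H) (s t : ℝ) (J : Fin e → ℝ) : Prop :=
  IsRRSLimit (fun u v a => X u v (Li (Y u a))) s t J

/-- `Z` is a controlled rough path on `[0, T]` which solves the initial value problem
`Z_t = Z_0 1 + ∑_i ∫_0^t φ_i(Z)_r dX^i_r` lifted to controlled rough paths, the lifted integral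
being `L_i (φ_i(Z)_t) + (∫_0^t φ_i(Z)_r dX^i_r) 1`; the initial condition is the point
`base (Z 0)` of `ℝ ^ e`. -/
structure IsSolution {H : Type*} [CommRing H] [Algebra ℝ H] [Coalgebra ℝ H]
    (𝒜 : ℕ → Submodule ℝ H) [GradedAlgebra 𝒜] (p : Seminorm ℝ H) (N : ℕ) (γ : ℝ)
    (ω : ℝ → ℝ → ℝ) (T : ℝ) {d e : ℕ} (L : Fin d → H →ₗ[ℝ] H) (X : ℝ → ℝ → H →ₗ[ℝ] ℝ)
    (φ : Fin d → (Fin e → ℝ) → Fin e → ℝ) (Z : ℝ → Fin e → H) : Prop where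
  controlled : IsControlled 𝒜 p N γ ω T X Z
  equation : ∀ t, 0 ≤ t → t ≤ T → ∃ J : Fin d → Fin e → ℝ,
    (∀ i, IsRoughIntegral (L i) X (fun r => smoothImage N (φ i) (Z r)) 0 t (J i)) ∧
    ∀ a, Z t a = algebraMap ℝ H (base (Z 0) a)
      + ∑ i, (L i (smoothImage N (φ i) (Z t) a) + algebraMap ℝ H (J i a))

/-- The seminorm `‖φ‖^m_K = ∑_{j=0}^m sup_{z ∈ K} ‖D^j φ(z)‖`. -/
def derivNorm {e : ℕ} (m : ℕ) (K : Set (Fin e → ℝ)) (φ : (Fin e → ℝ) → Fin e → ℝ) : ℝ :=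
  ∑ j ∈ Finset.range (m + 1), ⨆ z : K, ‖iteratedFDeriv ℝ j φ z‖

/-- The convex hull in `ℝ ^ e` of the underlying paths of `Z` and `Z'` on `[0, T]`. -/
def pathHull {H : Type*} [CommRing H] [Algebra ℝ H] [Coalgebra ℝ H] {e : ℕ} (T : ℝ)
    (Z Z' : ℝ → Fin e → H) : Set (Fin e → ℝ) :=
  convexHull ℝ ((fun t => base (Z t)) '' Set.Icc 0 T ∪ (fun t => base (Z' t)) '' Set.Icc 0 T)

end RoughControl

end

/-!
Two solutions are compared by a contraction argument on short intervals. Write `r = ω(s, t) ^ γ`,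
and call a path in `H` of order `n` on `[s, t]` if its component of degree `j` is
`O(r ^ (n - j))`, for `j ≤ n`, and bounded for `j ≥ n`. The remainder of a controlled path is of
order `N`.

If `Z` solves the equation, its remainder is
`∑ i, L_i (φ_i(Z)_t - T_{st} (φ_i(Z)_s - π_N φ_i(Z)_s))` plus a scalar, because the cocycle
condition moves `T_{st}` through `L_i`. The argument of `L_i` is essentially the remainder of the
controlled path `φ_i(Z)`, hence of order `N`, and `L_i` raises degrees by one, so that its image is
of order `N + 1`. The scalar is the difference between the increment of the rough integral and its
local approximation `⟨X_{st}, L_i(φ_i(Z)_s)⟩`; it is `O(r ^ (N + 1))` by sewing, since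
`(N + 1) γ > 1` and since, by Chen's relation and again the cocycle condition, the local
approximations are additive up to that order. So each component of the remainder is smaller by the
factor `r` than its norm requires (`Segment.exists_remainder_sub_bound`).

All of these estimates are needed both for the sizes of the two solutions and for their
difference. `PairBound`, `ScalarBound` and `FunctionalBound` therefore record size and distance at
once: two families have the same order, and their difference has this order with an additional
factor `δ`, the distance of all the data, including `d(Z, Z')` itself. These bounds are stable under
products, under `T_{st}` and under `L_i`. The one nonlinear step is
`PairBound.smoothImage_sub`, the remainder of `φ(Z)`. Since `T_{st}` is multiplicative up to order
`N`, it compares Taylor polynomials of `φ` at two base points; moving the base point along a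
segment, the derivative of the Taylor polynomial of degree `N - 1` telescopes to a single term of
order `N` (`hasDerivAt_taylor`), and the terms of degree `N` are of order `N` anyway. In this way
only derivatives up to order `N` are evaluated, and their distance is controlled by derivatives of
order `N + 1` on the convex hull of the two paths.

Altogether `‖R_X(Z) - R_{X'}(Z')‖ ≤ C ω(0, T') ^ γ δ`, where `C` depends on `M` and `M'`
(`exists_remNorm_sub_bound`). The initial values satisfy
`‖Z_0 - Z'_0‖ ≤ C₀ (‖ε(Z_0) - ε(Z'_0)‖ + ∑ i, ‖φ_i - φ'_i‖)` with `C₀` depending on `M` only, since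
at time zero the equation determines the component of degree `m + 1` from those of lower degree
(`exists_initial_bound`). Choosing `T₀` with `C ω(0, T₀) ^ γ ≤ 1 / 2`, which is possible as the
control is right-continuous, the distance on the right is absorbed; thus `M'` enters `T₀` but not
the constants of the estimate.
-/

noncomputable section

namespace RoughControl

/-! ### Directional derivatives and Taylor polynomials -/

section Calculus

variable {E F : Type*} [NormedAddCommGroup E] [NormedSpace ℝ E] [NormedAddCommGroup F]
  [NormedSpace ℝ F]

theorem differentiable_iteratedFDeriv_apply {n : ℕ} {f : E → F}
    (hf : ContDiff ℝ (n + 1 : ℕ) f) (v : Fin n → E) :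
    Differentiable ℝ fun y => iteratedFDeriv ℝ n f y v := by
  have h : Differentiable ℝ (iteratedFDeriv ℝ n f) :=
    hf.differentiable_iteratedFDeriv (by exact_mod_cast Nat.lt_succ_self n)
  intro y
  exact ((ContinuousMultilinearMap.apply ℝ (fun _ : Fin n => E) F v).differentiableAt).comp y (h y)

theorem iteratedFDeriv_cons {n : ℕ} {f : E → F} (hf : ContDiff ℝ (n + 1 : ℕ) f)
    (x u : E) (v : Fin n → E) :
    iteratedFDeriv ℝ (n + 1) f x (Fin.cons u v)
      = fderiv ℝ (fun y => iteratedFDeriv ℝ n f y v) x u := by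
  have h : Differentiable ℝ (iteratedFDeriv ℝ n f) :=
    hf.differentiable_iteratedFDeriv (by exact_mod_cast Nat.lt_succ_self n)
  have := (h x).iteratedFDeriv_succ_apply_left' (m := (Fin.cons u v : Fin (n + 1) → E))
  simpa using this

theorem iteratedFDeriv_cons_cons_comm {n : ℕ} {f : E → F} (hf : ContDiff ℝ (n + 2 : ℕ) f)
    (x u w : E) (v : Fin n → E) :
    iteratedFDeriv ℝ (n + 2) f x (Fin.cons u (Fin.cons w v : Fin (n + 1) → E))
      = iteratedFDeriv ℝ (n + 2) f x (Fin.cons w (Fin.cons u v : Fin (n + 1) → E)) := by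
  have hf1 : ContDiff ℝ (n + 1 : ℕ) f := hf.of_le (by exact_mod_cast Nat.le_succ _)
  set G : E → F := fun y => iteratedFDeriv ℝ n f y v with hG
  have hC : ContDiff ℝ 2 G := by
    have h : ContDiff ℝ 2 (iteratedFDeriv ℝ n f) :=
      hf.iteratedFDeriv_right (by push_cast; rw [add_comm])
    exact (ContinuousMultilinearMap.apply ℝ (fun _ : Fin n => E) F v).contDiff.comp h
  have hC1 : Differentiable ℝ (fderiv ℝ G) :=
    (hC.fderiv_right (m := 1) (by norm_num)).differentiable (by norm_num)
  have key : ∀ u w : E, iteratedFDeriv ℝ (n + 2) f x (Fin.cons u (Fin.cons w v : Fin (n + 1) → E))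
      = fderiv ℝ (fderiv ℝ G) x u w := by
    intro u w
    rw [iteratedFDeriv_cons hf]
    have : (fun y => iteratedFDeriv ℝ (n + 1) f y (Fin.cons w v : Fin (n + 1) → E))
        = fun y => fderiv ℝ G y w := by
      funext y
      rw [iteratedFDeriv_cons hf1]
    rw [this, fderiv_clm_apply (hC1 x) (differentiableAt_const w)]
    simp
  rw [key, key]
  exact (hC.contDiffAt.isSymmSndFDerivAt (by simp)) u w

/-- Symmetry of the iterated derivative of a `C^{n+1}` function, in the form needed below: a
direction may be moved from any slot to the first one. -/
theorem iteratedFDeriv_insertNth {f : E → F} : ∀ {n : ℕ}, ContDiff ℝ (n + 1 : ℕ) f →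
    ∀ (k : Fin (n + 1)) (x u : E) (v : Fin n → E),
      iteratedFDeriv ℝ (n + 1) f x (Fin.insertNth k u v)
        = iteratedFDeriv ℝ (n + 1) f x (Fin.cons u v) := by
  intro n
  induction n with
  | zero =>
    intro _ k x u v
    obtain rfl : k = 0 := Fin.fin_one_eq_zero k
    rw [Fin.insertNth_zero']
  | succ n ih =>
    intro hf k x u v
    have hf1 : ContDiff ℝ (n + 1 : ℕ) f := hf.of_le (by exact_mod_cast Nat.le_succ _)
    refine Fin.cases ?_ (fun k => ?_) k
    · rw [Fin.insertNth_zero']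
    · have e1 : (Fin.insertNth k.succ u v : Fin (n + 2) → E)
          = Fin.cons (v 0) (Fin.insertNth k u (Fin.tail v) : Fin (n + 1) → E) := by
        conv_lhs => rw [← Fin.cons_self_tail v]
        exact Fin.insertNth_succ_cons k u (v 0) (Fin.tail v)
      rw [e1, iteratedFDeriv_cons hf]
      have e2 : (fun y => iteratedFDeriv ℝ (n + 1) f y (Fin.insertNth k u (Fin.tail v)))
          = fun y => iteratedFDeriv ℝ (n + 1) f y (Fin.cons u (Fin.tail v) : Fin (n + 1) → E) := by
        funext y
        exact ih hf1 k y u (Fin.tail v)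
      rw [e2, ← iteratedFDeriv_cons hf, iteratedFDeriv_cons_cons_comm hf, Fin.cons_self_tail]

theorem hasDerivAt_iteratedFDeriv_line {n : ℕ} {f : E → F} (hf : ContDiff ℝ (n + 1 : ℕ) f)
    (b h : E) (v : Fin n → E) (θ : ℝ) :
    HasDerivAt (fun θ : ℝ => iteratedFDeriv ℝ n f (b + θ • h) v)
      (iteratedFDeriv ℝ (n + 1) f (b + θ • h) (Fin.cons h v)) θ := by
  rw [iteratedFDeriv_cons hf]
  have h1 : HasDerivAt (fun θ : ℝ => b + θ • h) h θ := by
    simpa using ((hasDerivAt_id θ).smul_const h).const_add b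
  exact ((differentiable_iteratedFDeriv_apply hf v (b + θ • h)).hasFDerivAt).comp_hasDerivAt θ h1

end Calculus

section Taylor

variable {A : Type*} [CommRing A] [Algebra ℝ A] {e : ℕ}

/-- The partial derivative `∂_{ι 0} ⋯ ∂_{ι (n-1)} φ` of the component `a` of `φ` at `b`. -/
def partialDeriv {n : ℕ} (φ : (Fin e → ℝ) → Fin e → ℝ) (b : Fin e → ℝ) (ι : Fin n → Fin e)
    (a : Fin e) : ℝ :=
  iteratedFDeriv ℝ n φ b (fun k => Pi.single (ι k) 1) a

/-- The term `(1/n!) D^n φ_a(b)(w, …, w)`, the differential being extended to `A ^ e` by the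
product of the algebra `A`. -/
def taylorTerm (n : ℕ) (φ : (Fin e → ℝ) → Fin e → ℝ) (b : Fin e → ℝ) (w : Fin e → A)
    (a : Fin e) : A :=
  ((n.factorial : ℝ)⁻¹) • ∑ ι : Fin n → Fin e, partialDeriv φ b ι a • ∏ k, w (ι k)

/-- The term `(1/n!) D^{n+1} φ_a(b)(h, w, …, w)` with `h` in `ℝ ^ e` and `w` in `A ^ e`. -/
def taylorDerivTerm (n : ℕ) (φ : (Fin e → ℝ) → Fin e → ℝ) (b h : Fin e → ℝ) (w : Fin e → A)
    (a : Fin e) : A :=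
  ((n.factorial : ℝ)⁻¹) • ∑ ι : Fin n → Fin e, ∑ c,
    (h c * partialDeriv φ b (Fin.cons c ι : Fin (n + 1) → Fin e) a) • ∏ k, w (ι k)

theorem hasDerivAt_partialDeriv {n : ℕ} {φ : (Fin e → ℝ) → Fin e → ℝ}
    (hφ : ContDiff ℝ (n + 1 : ℕ) φ) (b h : Fin e → ℝ) (ι : Fin n → Fin e) (a : Fin e) (θ : ℝ) :
    HasDerivAt (fun θ : ℝ => partialDeriv φ (b + θ • h) ι a)
      (∑ c, h c * partialDeriv φ (b + θ • h) (Fin.cons c ι : Fin (n + 1) → Fin e) a) θ := by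
  have h1 := hasDerivAt_pi.1
    (hasDerivAt_iteratedFDeriv_line hφ b h (fun k => Pi.single (ι k) (1 : ℝ)) θ) a
  refine h1.congr_deriv (Eq.symm ?_)
  have hh : h = ∑ c, h c • (Pi.single c (1 : ℝ) : Fin e → ℝ) := by
    ext i
    simp [Finset.sum_apply, Pi.single_apply]
  have h2 : iteratedFDeriv ℝ (n + 1) φ (b + θ • h)
        (Fin.cons h (fun k => Pi.single (ι k) (1 : ℝ)) : Fin (n + 1) → Fin e → ℝ)
      = ∑ c, h c • iteratedFDeriv ℝ (n + 1) φ (b + θ • h)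
        (Fin.cons (Pi.single c (1 : ℝ)) (fun k => Pi.single (ι k) (1 : ℝ))) := by
    rw [iteratedFDeriv_cons hφ]
    simp only [iteratedFDeriv_cons hφ]
    conv_lhs => rw [hh, map_sum]
    simp only [← hh, map_smul]
  rw [h2, Finset.sum_apply]
  refine Finset.sum_congr rfl fun c _ => ?_
  rw [Pi.smul_apply, smul_eq_mul, partialDeriv]
  congr 3

theorem partialDeriv_insertNth {n : ℕ} {φ : (Fin e → ℝ) → Fin e → ℝ}
    (hφ : ContDiff ℝ (n + 1 : ℕ) φ) (b : Fin e → ℝ) (k : Fin (n + 1)) (c : Fin e)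
    (ι : Fin n → Fin e) (a : Fin e) :
    partialDeriv φ b (Fin.insertNth k c ι : Fin (n + 1) → Fin e) a
      = partialDeriv φ b (Fin.cons c ι : Fin (n + 1) → Fin e) a := by
  have h := congrFun (iteratedFDeriv_insertNth hφ k b (Pi.single c (1 : ℝ))
    (fun k => Pi.single (ι k) (1 : ℝ))) a
  rw [partialDeriv, partialDeriv]
  have e1 : (fun l => Pi.single ((Fin.insertNth k c ι : Fin (n + 1) → Fin e) l) (1 : ℝ))
      = (Fin.insertNth k (Pi.single c (1 : ℝ)) (fun k => Pi.single (ι k) (1 : ℝ)) :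
        Fin (n + 1) → Fin e → ℝ) := by
    funext l
    refine Fin.succAboveCases k ?_ (fun j => ?_) l <;> simp
  have e2 : (fun l => Pi.single ((Fin.cons c ι : Fin (n + 1) → Fin e) l) (1 : ℝ))
      = (Fin.cons (Pi.single c (1 : ℝ)) (fun k => Pi.single (ι k) (1 : ℝ)) :
        Fin (n + 1) → Fin e → ℝ) := by
    funext l
    refine Fin.cases ?_ (fun j => ?_) l <;> simp
  rw [e1, e2, h]

/-- Leibniz rule for a product of factors `x k - (b k + θ h k)`. Derivatives of curves in `A` are
tested against functionals, as `A` carries no topology. -/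
theorem hasDerivAt_prod_sub_line {κ : Type*} [DecidableEq κ] (x : κ → A) (b h : κ → ℝ) (θ : ℝ)
    (s : Finset κ) : ∀ ℓ : A →ₗ[ℝ] ℝ,
    HasDerivAt (fun θ : ℝ => ℓ (∏ k ∈ s, (x k - algebraMap ℝ A (b k + θ * h k))))
      (-∑ k ∈ s, h k * ℓ (∏ l ∈ s.erase k, (x l - algebraMap ℝ A (b l + θ * h l)))) θ := by
  induction s using Finset.induction_on with
  | empty => intro ℓ; simpa using hasDerivAt_const θ (ℓ 1)
  | insert i s hi ih =>
    intro ℓ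
    have hsplit : ∀ (c : ℝ) (y : A), ℓ ((x i - algebraMap ℝ A c) * y)
        = (ℓ ∘ₗ LinearMap.mulLeft ℝ (x i)) y - c * ℓ y := by
      intro c y
      rw [sub_mul, map_sub, ← Algebra.smul_def, map_smul, smul_eq_mul]
      rfl
    have hlin : HasDerivAt (fun θ : ℝ => b i + θ * h i) (h i) θ := by
      simpa using ((hasDerivAt_id θ).mul_const (h i)).const_add (b i)
    have h1 := (ih (ℓ ∘ₗ LinearMap.mulLeft ℝ (x i))).sub (hlin.mul (ih ℓ))
    have hfun : (fun θ : ℝ => ℓ (∏ k ∈ insert i s, (x k - algebraMap ℝ A (b k + θ * h k))))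
        = fun θ : ℝ => (ℓ ∘ₗ LinearMap.mulLeft ℝ (x i))
            (∏ k ∈ s, (x k - algebraMap ℝ A (b k + θ * h k)))
          - (b i + θ * h i) * ℓ (∏ k ∈ s, (x k - algebraMap ℝ A (b k + θ * h k))) := by
      funext θ
      rw [Finset.prod_insert hi, hsplit]
    rw [hfun]
    refine h1.congr_deriv (Eq.symm ?_)
    rw [Finset.sum_insert hi, Finset.erase_insert hi]
    have h2 : ∀ k ∈ s, h k * ℓ (∏ l ∈ (insert i s).erase k,
          (x l - algebraMap ℝ A (b l + θ * h l)))
        = h k * (ℓ ∘ₗ LinearMap.mulLeft ℝ (x i))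
            (∏ l ∈ s.erase k, (x l - algebraMap ℝ A (b l + θ * h l)))
          - (b i + θ * h i) * (h k * ℓ (∏ l ∈ s.erase k,
            (x l - algebraMap ℝ A (b l + θ * h l)))) := by
      intro k hk
      have hki : i ≠ k := fun h => hi (h ▸ hk)
      rw [Finset.erase_insert_of_ne hki, Finset.prod_insert (by simp [hi]), hsplit]
      ring
    rw [Finset.sum_congr rfl h2, Finset.sum_sub_distrib, ← Finset.mul_sum]
    ring

/-- Differentiating the arguments in the Taylor term of degree `n + 1` gives, by symmetry of the
derivative, the same as differentiating the base point in the term of degree `n`. -/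
theorem sum_partialDeriv_erase {n : ℕ} {φ : (Fin e → ℝ) → Fin e → ℝ}
    (hφ : ContDiff ℝ (n + 1 : ℕ) φ) (b h : Fin e → ℝ) (w : Fin e → A) (a : Fin e) :
    (((n + 1).factorial : ℝ)⁻¹) • ∑ ι : Fin (n + 1) → Fin e, partialDeriv φ b ι a •
        ∑ k, h (ι k) • ∏ l ∈ Finset.univ.erase k, w (ι l)
      = taylorDerivTerm n φ b h w a := by
  have h1 : ∀ k : Fin (n + 1), ∑ ι : Fin (n + 1) → Fin e, partialDeriv φ b ι a •
        (h (ι k) • ∏ l ∈ Finset.univ.erase k, w (ι l))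
      = ∑ ι : Fin n → Fin e, ∑ c,
        (h c * partialDeriv φ b (Fin.cons c ι : Fin (n + 1) → Fin e) a) • ∏ k, w (ι k) := by
    intro k
    rw [← (Fin.insertNthEquiv (fun _ => Fin e) k).sum_comp, Fintype.sum_prod_type,
      Finset.sum_comm]
    refine Finset.sum_congr rfl fun ι _ => Finset.sum_congr rfl fun c _ => ?_
    have h2 : ∏ l ∈ Finset.univ.erase k, w ((Fin.insertNthEquiv (fun _ => Fin e) k) (c, ι) l)
        = ∏ l, w (ι l) := by
      have h3 := Fin.prod_univ_succAbove
        (fun l => if l = k then 1 else w ((Fin.insertNthEquiv (fun _ => Fin e) k) (c, ι) l)) k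
      rw [if_pos rfl, one_mul] at h3
      have h4 : ∏ l, (if l = k then (1 : A)
            else w ((Fin.insertNthEquiv (fun _ => Fin e) k) (c, ι) l))
          = ∏ l ∈ Finset.univ.erase k,
            w ((Fin.insertNthEquiv (fun _ => Fin e) k) (c, ι) l) := by
        rw [← Finset.mul_prod_erase Finset.univ _ (Finset.mem_univ k), if_pos rfl, one_mul]
        refine Finset.prod_congr rfl fun l hl => ?_
        rw [if_neg (Finset.ne_of_mem_erase hl)]
      rw [← h4, h3]
      refine Finset.prod_congr rfl fun l _ => ?_
      rw [if_neg (Fin.succAbove_ne k l)]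
      simp [Fin.insertNthEquiv]
    rw [h2, smul_smul]
    have h5 : (Fin.insertNthEquiv (fun _ => Fin e) k) (c, ι) = Fin.insertNth k c ι := rfl
    rw [h5, partialDeriv_insertNth hφ, Fin.insertNth_apply_same, mul_comm]
  simp only [Finset.smul_sum (r := partialDeriv φ b _ a)]
  rw [Finset.sum_comm, Finset.sum_congr rfl fun k _ => h1 k, Finset.sum_const, Finset.card_univ,
    Fintype.card_fin, ← Nat.cast_smul_eq_nsmul ℝ, smul_smul, taylorDerivTerm]
  congr 1
  rw [Nat.factorial_succ]
  push_cast
  have : ((n : ℝ) + 1) ≠ 0 := by positivity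
  field_simp

/-- Moving the base point in the direction `h` while keeping the argument `ζ` fixed, the
derivative of the Taylor polynomial of degree `n` telescopes to one term. -/
theorem hasDerivAt_taylor {φ : (Fin e → ℝ) → Fin e → ℝ} (b h : Fin e → ℝ)
    (ζ : Fin e → A) (a : Fin e) (θ : ℝ) (ℓ : A →ₗ[ℝ] ℝ) {n : ℕ}
    (hφ : ContDiff ℝ (n + 1 : ℕ) φ) :
    HasDerivAt (fun θ : ℝ => ℓ (∑ m ∈ Finset.range (n + 1), taylorTerm m φ (b + θ • h)
        (fun c => ζ c - algebraMap ℝ A (b c + θ * h c)) a))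
      (ℓ (taylorDerivTerm n φ (b + θ • h) h
        (fun c => ζ c - algebraMap ℝ A (b c + θ * h c)) a)) θ := by
  -- the derivative of one term
  have term : ∀ m, ContDiff ℝ (m + 1 : ℕ) φ →
      HasDerivAt (fun θ : ℝ => ℓ (taylorTerm m φ (b + θ • h)
        (fun c => ζ c - algebraMap ℝ A (b c + θ * h c)) a))
      (ℓ (taylorDerivTerm m φ (b + θ • h) h
          (fun c => ζ c - algebraMap ℝ A (b c + θ * h c)) a)
        - ℓ (((m.factorial : ℝ)⁻¹) • ∑ ι : Fin m → Fin e, partialDeriv φ (b + θ • h) ι a •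
          ∑ k, h (ι k) • ∏ l ∈ Finset.univ.erase k,
            (ζ (ι l) - algebraMap ℝ A (b (ι l) + θ * h (ι l))))) θ := by
    intro m hm
    simp only [taylorTerm, taylorDerivTerm, map_smul, map_sum, smul_eq_mul]
    rw [← mul_sub, ← Finset.sum_sub_distrib]
    refine HasDerivAt.const_mul _ (HasDerivAt.fun_sum fun ι _ => ?_)
    have := (hasDerivAt_partialDeriv hm b h ι a θ).mul
      (hasDerivAt_prod_sub_line (fun k => ζ (ι k)) (fun k => b (ι k)) (fun k => h (ι k)) θ
        Finset.univ ℓ)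
    refine this.congr_deriv ?_
    rw [Finset.sum_mul]
    ring
  induction n with
  | zero =>
    have h0 := term 0 hφ
    simpa using h0
  | succ n ih =>
    have hn : ContDiff ℝ (n + 1 : ℕ) φ := hφ.of_le (by exact_mod_cast Nat.le_succ _)
    have h1 := (ih hn).add (term (n + 1) hφ)
    rw [sum_partialDeriv_erase hn (b + θ • h) h
      (fun c => ζ c - algebraMap ℝ A (b c + θ * h c)) a] at h1
    have hfun : (fun θ : ℝ => ℓ (∑ m ∈ Finset.range (n + 1 + 1), taylorTerm m φ (b + θ • h)
        (fun c => ζ c - algebraMap ℝ A (b c + θ * h c)) a))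
        = (fun θ : ℝ => ℓ (∑ m ∈ Finset.range (n + 1), taylorTerm m φ (b + θ • h)
            (fun c => ζ c - algebraMap ℝ A (b c + θ * h c)) a))
          + fun θ : ℝ => ℓ (taylorTerm (n + 1) φ (b + θ • h)
            (fun c => ζ c - algebraMap ℝ A (b c + θ * h c)) a) := by
      funext θ
      rw [Finset.sum_range_succ, map_add]
      rfl
    rw [hfun]
    refine h1.congr_deriv ?_
    ring

theorem smoothImage_eq_sum_taylorTerm [Coalgebra ℝ A] (N : ℕ) (φ : (Fin e → ℝ) → Fin e → ℝ)
    (z : Fin e → A) (a : Fin e) :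
    smoothImage N φ z a = ∑ n ∈ Finset.range (N + 1), taylorTerm n φ (base z)
      (fun c => z c - algebraMap ℝ A (base z c)) a := by
  rw [Finset.sum_range_succ', add_comm, smoothImage]
  congr 1
  · simp [taylorTerm, partialDeriv, Algebra.algebraMap_eq_smul_one]
  · rw [← Finset.sum_image (f := fun n => taylorTerm n φ (base z)
      (fun c => z c - algebraMap ℝ A (base z c)) a) (g := fun n => n + 1) (by simp)]
    refine Finset.sum_congr ?_ fun n _ => rfl
    ext n
    simp only [Finset.mem_Icc, Finset.mem_image, Finset.mem_range]
    constructor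
    · rintro ⟨h1, h2⟩
      exact ⟨n - 1, by omega, by omega⟩
    · rintro ⟨m, h1, rfl⟩
      omega

end Taylor

/-! ### Norms, grading and coproduct of a truncated Hopf algebra -/

section Norm

variable {H : Type*} [CommRing H] [Algebra ℝ H]

theorem seminorm_sum_le (p : Seminorm ℝ H) {κ : Type*} (s : Finset κ) (f : κ → H) :
    p (∑ k ∈ s, f k) ≤ ∑ k ∈ s, p (f k) :=
  Finset.le_sum_of_subadditive p (map_zero p).le (map_add_le_add p) s f

theorem exists_bound_functional [Module.Finite ℝ H] {p : Seminorm ℝ H}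
    (hp : ∀ x, p x = 0 → x = 0) (ξ : H →ₗ[ℝ] ℝ) : ∃ C, 0 ≤ C ∧ ∀ x, |ξ x| ≤ C * p x := by
  let _ : NormedAddCommGroup H := AddGroupNorm.toNormedAddCommGroup
    { p.toAddGroupSeminorm with eq_zero_of_map_eq_zero' := hp }
  let _ : NormedSpace ℝ H := { norm_smul_le := fun c x => (map_smul_eq_mul p c x).le }
  exact ⟨‖ξ.toContinuousLinearMap‖, norm_nonneg _, fun x => ξ.toContinuousLinearMap.le_opNorm x⟩

/-- Coordinates on `H` which are bounded by the norm `p`. -/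
theorem exists_bounded_coordinates [Module.Finite ℝ H] {p : Seminorm ℝ H}
    (hp : ∀ x, p x = 0 → x = 0) :
    ∃ (n : ℕ) (ℓ : Fin n → H →ₗ[ℝ] ℝ) (v : Fin n → H) (C : ℝ), 0 ≤ C ∧
      (∀ x, x = ∑ k, ℓ k x • v k) ∧ ∀ k x, |ℓ k x| ≤ C * p x := by
  set b := Module.finBasis ℝ H
  choose C hC0 hC using fun k => exists_bound_functional hp (b.coord k)
  refine ⟨_, b.coord, b, ∑ k, C k, Finset.sum_nonneg fun k _ => hC0 k, fun x => ?_, fun k x => ?_⟩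
  · exact (b.sum_repr x).symm
  · exact (hC k x).trans (mul_le_mul_of_nonneg_right
      (Finset.single_le_sum (fun k _ => hC0 k) (Finset.mem_univ k)) (apply_nonneg p x))

theorem exists_bound_linearMap [Module.Finite ℝ H] {p : Seminorm ℝ H}
    (hp : ∀ x, p x = 0 → x = 0) (f : H →ₗ[ℝ] H) : ∃ C, 0 ≤ C ∧ ∀ x, p (f x) ≤ C * p x := by
  obtain ⟨n, ℓ, v, C, hC, h1, h2⟩ := exists_bounded_coordinates hp
  refine ⟨∑ k, C * p (f (v k)), Finset.sum_nonneg fun k _ => by positivity, fun x => ?_⟩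
  calc p (f x) = p (∑ k, ℓ k x • f (v k)) := by
        conv_lhs => rw [h1 x, map_sum]
        simp only [map_smul]
    _ ≤ ∑ k, p (ℓ k x • f (v k)) := seminorm_sum_le p _ _
    _ ≤ ∑ k, C * p (f (v k)) * p x := by
        refine Finset.sum_le_sum fun k _ => ?_
        rw [map_smul_eq_mul, Real.norm_eq_abs]
        nlinarith [mul_le_mul_of_nonneg_right (h2 k x) (apply_nonneg p (f (v k)))]
    _ = _ := by rw [Finset.sum_mul]

theorem exists_bound_mul [Module.Finite ℝ H] {p : Seminorm ℝ H}
    (hp : ∀ x, p x = 0 → x = 0) : ∃ C, 0 ≤ C ∧ ∀ x y : H, p (x * y) ≤ C * p x * p y := by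
  obtain ⟨n, ℓ, v, C, hC, h1, h2⟩ := exists_bounded_coordinates hp
  choose D hD0 hD using fun k => exists_bound_linearMap hp (LinearMap.mulLeft ℝ (v k))
  refine ⟨∑ k, C * D k, Finset.sum_nonneg fun k _ => mul_nonneg hC (hD0 k), fun x y => ?_⟩
  calc p (x * y) = p (∑ k, ℓ k x • LinearMap.mulLeft ℝ (v k) y) := by
        conv_lhs => rw [h1 x, Finset.sum_mul]
        simp
    _ ≤ ∑ k, p (ℓ k x • LinearMap.mulLeft ℝ (v k) y) := seminorm_sum_le p _ _
    _ ≤ ∑ k, C * D k * p x * p y := by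
        refine Finset.sum_le_sum fun k _ => ?_
        rw [map_smul_eq_mul, Real.norm_eq_abs]
        calc _ ≤ (C * p x) * (D k * p y) :=
              mul_le_mul (h2 k x) (hD k y) (apply_nonneg _ _) (by positivity)
          _ = _ := by ring
    _ = _ := by rw [Finset.sum_mul, Finset.sum_mul]

theorem dualNorm_nonneg (p : Seminorm ℝ H) (ξ : H →ₗ[ℝ] ℝ) : 0 ≤ dualNorm p ξ :=
  Real.sInf_nonneg fun _ h => h.1

theorem abs_le_dualNorm_mul [Module.Finite ℝ H] {p : Seminorm ℝ H}
    (hp : ∀ x, p x = 0 → x = 0) (ξ : H →ₗ[ℝ] ℝ) (x : H) : |ξ x| ≤ dualNorm p ξ * p x := by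
  by_cases hx : p x = 0
  · rw [hp x hx]; simp
  · have hx' : 0 < p x := lt_of_le_of_ne (apply_nonneg p x) (Ne.symm hx)
    rw [← div_le_iff₀ hx']
    obtain ⟨C, hC0, hC⟩ := exists_bound_functional hp ξ
    refine le_csInf ⟨C, hC0, hC⟩ fun D hD => ?_
    rw [div_le_iff₀ hx']
    exact hD.2 x

theorem dualNorm_le {p : Seminorm ℝ H} {ξ : H →ₗ[ℝ] ℝ} {C : ℝ} (hC : 0 ≤ C)
    (h : ∀ x, |ξ x| ≤ C * p x) : dualNorm p ξ ≤ C :=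
  csInf_le ⟨0, fun _ h => h.1⟩ ⟨hC, h⟩

theorem dualNorm_sub_le [Module.Finite ℝ H] {p : Seminorm ℝ H} (hp : ∀ x, p x = 0 → x = 0)
    (ξ η : H →ₗ[ℝ] ℝ) : dualNorm p (ξ - η) ≤ dualNorm p ξ + dualNorm p η := by
  refine dualNorm_le (add_nonneg (dualNorm_nonneg p ξ) (dualNorm_nonneg p η)) fun x => ?_
  rw [LinearMap.sub_apply, add_mul]
  exact (abs_sub _ _).trans
    (add_le_add (abs_le_dualNorm_mul hp ξ x) (abs_le_dualNorm_mul hp η x))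

theorem le_vecNorm (p : Seminorm ℝ H) {e : ℕ} (z : Fin e → H) (a : Fin e) :
    p (z a) ≤ vecNorm p z :=
  le_ciSup (f := fun a => p (z a)) (Set.finite_range _).bddAbove a

theorem vecNorm_le {p : Seminorm ℝ H} {e : ℕ} {z : Fin e → H} {C : ℝ} (hC : 0 ≤ C)
    (h : ∀ a, p (z a) ≤ C) : vecNorm p z ≤ C :=
  Real.iSup_le h hC

theorem vecNorm_nonneg (p : Seminorm ℝ H) {e : ℕ} (z : Fin e → H) : 0 ≤ vecNorm p z :=
  Real.iSup_nonneg fun _ => apply_nonneg p _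

end Norm

section Grading

variable {H : Type*} [CommRing H] [Algebra ℝ H] {𝒜 : ℕ → Submodule ℝ H} [GradedAlgebra 𝒜]

theorem proj_mem (j : ℕ) (x : H) : GradedAlgebra.proj 𝒜 j x ∈ 𝒜 j := by
  rw [GradedAlgebra.proj_apply]
  exact SetLike.coe_mem _

theorem proj_of_mem {j : ℕ} {x : H} (hx : x ∈ 𝒜 j) : GradedAlgebra.proj 𝒜 j x = x := by
  rw [GradedAlgebra.proj_apply, DirectSum.decompose_of_mem_same 𝒜 hx]

theorem proj_of_mem_ne {j k : ℕ} {x : H} (hx : x ∈ 𝒜 k) (h : k ≠ j) :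
    GradedAlgebra.proj 𝒜 j x = 0 := by
  rw [GradedAlgebra.proj_apply, DirectSum.decompose_of_mem_ne 𝒜 hx h]

theorem proj_proj_ne {j k : ℕ} (h : k ≠ j) (x : H) :
    GradedAlgebra.proj 𝒜 j (GradedAlgebra.proj 𝒜 k x) = 0 :=
  proj_of_mem_ne (proj_mem k x) h

theorem algebraMap_mem_zero (c : ℝ) : algebraMap ℝ H c ∈ 𝒜 0 :=
  SetLike.algebraMap_mem_graded 𝒜 c

theorem sum_proj [Coalgebra ℝ H] {N : ℕ} (hH : IsTruncatedHopf 𝒜 N) (x : H) :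
    ∑ j ∈ Finset.range (N + 1), GradedAlgebra.proj 𝒜 j x = x := by
  classical
  conv_rhs => rw [← DirectSum.sum_support_decompose 𝒜 x]
  simp only [GradedAlgebra.proj_apply]
  symm
  refine Finset.sum_subset (fun j hj => ?_) fun j _ hj => ?_
  · rw [Finset.mem_range]
    by_contra h
    have h0 : 𝒜 j = ⊥ := hH.truncated j (by omega)
    rw [DFinsupp.mem_support_iff] at hj
    apply hj
    exact Subtype.ext ((Submodule.mem_bot ℝ).1 (h0.le (DirectSum.decompose 𝒜 x j).2))
  · rw [DFinsupp.notMem_support_iff] at hj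
    rw [hj]
    rfl

theorem proj_mul [Coalgebra ℝ H] {N : ℕ} (hH : IsTruncatedHopf 𝒜 N) (j : ℕ) (x y : H) :
    GradedAlgebra.proj 𝒜 j (x * y) = ∑ a ∈ Finset.range (N + 1),
      if a ≤ j then GradedAlgebra.proj 𝒜 a x * GradedAlgebra.proj 𝒜 (j - a) y else 0 := by
  conv_lhs => rw [← sum_proj hH x, Finset.sum_mul, map_sum]
  refine Finset.sum_congr rfl fun a _ => ?_
  rw [GradedAlgebra.proj_apply, DirectSum.coe_decompose_mul_of_left_mem 𝒜 j (proj_mem a x)]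
  rfl

theorem finite_of_isTruncatedHopf [Coalgebra ℝ H] {N : ℕ} (hH : IsTruncatedHopf 𝒜 N) :
    Module.Finite ℝ H := by
  have := hH.finite
  let f : ((j : Fin (N + 1)) → 𝒜 j) →ₗ[ℝ] H :=
    ∑ j : Fin (N + 1), (𝒜 j).subtype ∘ₗ LinearMap.proj j
  refine Module.Finite.of_surjective f fun x => ?_
  refine ⟨fun j => ⟨GradedAlgebra.proj 𝒜 j x, proj_mem _ x⟩, ?_⟩
  conv_rhs => rw [← sum_proj hH x]
  rw [← Fin.sum_univ_eq_sum_range (fun j => GradedAlgebra.proj 𝒜 j x)]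
  simp [f, LinearMap.sum_apply]

theorem proj_le {p : Seminorm ℝ H} [Coalgebra ℝ H] (hp : IsGoodNorm 𝒜 p) (j : ℕ) (x : H) :
    p (GradedAlgebra.proj 𝒜 j x) ≤ p x := by
  simpa using hp.graded {j} x

end Grading

section Coproduct

variable {H : Type*} [CommRing H] [Algebra ℝ H]

/-- The span of the tensors `u ⊗ v` with `u`, `v` homogeneous of degrees `a`, `b` such that
`P a b`. -/
def tensorSpan (𝒜 : ℕ → Submodule ℝ H) (P : ℕ → ℕ → Prop) : Submodule ℝ (H ⊗[ℝ] H) :=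
  Submodule.span ℝ {t | ∃ a b, P a b ∧ ∃ u ∈ 𝒜 a, ∃ v ∈ 𝒜 b, t = u ⊗ₜ[ℝ] v}

theorem iSup_tensorPiece_le (𝒜 : ℕ → Submodule ℝ H) (P : ℕ → ℕ → Prop) :
    (⨆ (a : ℕ) (b : ℕ) (_ : P a b), tensorPiece 𝒜 a b) ≤ tensorSpan 𝒜 P := by
  refine iSup_le fun a => iSup_le fun b => iSup_le fun hab => ?_
  rintro _ ⟨t, rfl⟩
  induction t using TensorProduct.induction_on with
  | zero => rw [map_zero]; exact zero_mem _
  | tmul u v => exact Submodule.subset_span ⟨a, b, hab, u, u.2, v, v.2, rfl⟩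
  | add s t hs ht => rw [map_add]; exact add_mem hs ht

/-- Two linear maps that agree on the tensors of the admitted degrees agree on their span. -/
theorem eqOn_tensorSpan {𝒜 : ℕ → Submodule ℝ H} {P : ℕ → ℕ → Prop} {V : Type*}
    [AddCommGroup V] [Module ℝ V] {f g : H ⊗[ℝ] H →ₗ[ℝ] V}
    (h : ∀ a b, P a b → ∀ u ∈ 𝒜 a, ∀ v ∈ 𝒜 b, f (u ⊗ₜ[ℝ] v) = g (u ⊗ₜ[ℝ] v))
    {t : H ⊗[ℝ] H} (ht : t ∈ tensorSpan 𝒜 P) : f t = g t := by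
  refine LinearMap.eqOn_span (f := f) (g := g) ?_ ht
  rintro _ ⟨a, b, hab, u, hu, v, hv, rfl⟩
  exact h a b hab u hu v hv

/-- The map `u ⊗ v ↦ ξ(u) f(v)`. -/
def contract (ξ : H →ₗ[ℝ] ℝ) (f : H →ₗ[ℝ] H) : H ⊗[ℝ] H →ₗ[ℝ] H :=
  (TensorProduct.lid ℝ H).toLinearMap ∘ₗ TensorProduct.map ξ f

@[simp]
theorem contract_tmul (ξ : H →ₗ[ℝ] ℝ) (f : H →ₗ[ℝ] H) (u v : H) :
    contract ξ f (u ⊗ₜ[ℝ] v) = ξ u • f v := by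
  simp [contract]

theorem comp_contract (ξ : H →ₗ[ℝ] ℝ) (f g : H →ₗ[ℝ] H) :
    g ∘ₗ contract ξ f = contract ξ (g ∘ₗ f) := by
  ext u v
  simp

variable [Coalgebra ℝ H]

theorem convTranspose_apply (ξ : H →ₗ[ℝ] ℝ) (x : H) :
    convTranspose ξ x = contract ξ LinearMap.id (Coalgebra.comul (R := ℝ) x) := rfl

theorem apply_convTranspose_eq (ξ : H →ₗ[ℝ] ℝ) (f : H →ₗ[ℝ] H) (x : H) :
    f (convTranspose ξ x) = contract ξ f (Coalgebra.comul (R := ℝ) x) := by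
  rw [convTranspose_apply, ← LinearMap.comp_apply, comp_contract, LinearMap.comp_id]

theorem convTranspose_counit (x : H) : convTranspose (Coalgebra.counit (R := ℝ)) x = x := by
  have := Coalgebra.rTensor_counit_comul (R := ℝ) x
  rw [convTranspose, LinearMap.comp_apply, LinearMap.comp_apply, this]
  simp

theorem counit_convTranspose (ξ : H →ₗ[ℝ] ℝ) (x : H) :
    Coalgebra.counit (R := ℝ) (convTranspose ξ x) = ξ x := by
  rw [apply_convTranspose, conv]
  have h := Coalgebra.lTensor_counit_comul (R := ℝ) x
  have h2 : LinearMap.mul' ℝ ℝ ∘ₗ TensorProduct.map ξ (Coalgebra.counit (R := ℝ) (A := H))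
      = ξ ∘ₗ (TensorProduct.rid ℝ H).toLinearMap ∘ₗ LinearMap.lTensor H Coalgebra.counit := by
    ext u v
    simp [mul_comm]
  rw [← LinearMap.comp_assoc, LinearMap.comp_apply, h2, LinearMap.comp_apply,
    LinearMap.comp_apply, h]
  simp

/-- The transpose depends continuously on the functional and on the argument. -/
theorem exists_bound_convTranspose [Module.Finite ℝ H] {p : Seminorm ℝ H}
    (hp : ∀ x, p x = 0 → x = 0) :
    ∃ C, 0 ≤ C ∧ ∀ (ξ : H →ₗ[ℝ] ℝ) (x : H), p (convTranspose ξ x) ≤ C * dualNorm p ξ * p x := by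
  obtain ⟨n, ℓ, v, C, hC, h1, h2⟩ := exists_bounded_coordinates hp
  -- the coefficients `c k x` of `Δ x = ∑ k, c k x ⊗ v k`
  let c : Fin n → H →ₗ[ℝ] H := fun k =>
    (TensorProduct.rid ℝ H).toLinearMap ∘ₗ LinearMap.lTensor H (ℓ k) ∘ₗ Coalgebra.comul
  choose D hD0 hD using fun k => exists_bound_linearMap hp (c k)
  refine ⟨∑ k, D k * p (v k), Finset.sum_nonneg fun k _ => mul_nonneg (hD0 k) (apply_nonneg _ _),
    fun ξ x => ?_⟩
  have key : convTranspose ξ x = ∑ k, ξ (c k x) • v k := by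
    have h3 : contract ξ LinearMap.id = ∑ k, LinearMap.toSpanSingleton ℝ H (v k) ∘ₗ ξ ∘ₗ
        (TensorProduct.rid ℝ H).toLinearMap ∘ₗ LinearMap.lTensor H (ℓ k) := by
      refine TensorProduct.ext' fun x y => ?_
      rw [contract_tmul, LinearMap.sum_apply, LinearMap.id_apply]
      conv_lhs => rw [h1 y, Finset.smul_sum]
      refine Finset.sum_congr rfl fun k _ => ?_
      simp [smul_smul, mul_comm]
    rw [convTranspose_apply, h3, LinearMap.sum_apply]
    rfl
  rw [key]
  calc p (∑ k, ξ (c k x) • v k) ≤ ∑ k, p (ξ (c k x) • v k) := seminorm_sum_le p _ _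
    _ ≤ ∑ k, D k * p (v k) * dualNorm p ξ * p x := by
        refine Finset.sum_le_sum fun k _ => ?_
        rw [map_smul_eq_mul, Real.norm_eq_abs]
        have h4 : |ξ (c k x)| ≤ dualNorm p ξ * (D k * p x) :=
          (abs_le_dualNorm_mul hp ξ _).trans
            (mul_le_mul_of_nonneg_left (hD k x) (dualNorm_nonneg p ξ))
        nlinarith [mul_le_mul_of_nonneg_right h4 (apply_nonneg p (v k))]
    _ = _ := by rw [Finset.sum_mul, Finset.sum_mul]

theorem convTranspose_cocycle {𝒜 : ℕ → Submodule ℝ H} {N d : ℕ} {L : Fin d → H →ₗ[ℝ] H}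
    (hL : IsCocycleFamily 𝒜 N L) (ξ : H →ₗ[ℝ] ℝ) (i : Fin d) {n : ℕ} (hn : n < N) {x : H}
    (hx : x ∈ 𝒜 n) :
    convTranspose ξ (L i x) = L i (convTranspose ξ x) + algebraMap ℝ H (ξ (L i x)) := by
  rw [apply_convTranspose_eq, convTranspose_apply, hL.cocycle i n hn x hx, map_add, contract_tmul,
    LinearMap.id_apply, Algebra.algebraMap_eq_smul_one]
  congr 1
  have : contract ξ LinearMap.id ∘ₗ TensorProduct.map LinearMap.id (L i) = contract ξ (L i) := by
    refine TensorProduct.ext' fun u v => ?_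
    simp
  rw [← LinearMap.comp_apply, this]

variable {𝒜 : ℕ → Submodule ℝ H} [GradedAlgebra 𝒜] {N : ℕ}

theorem comul_mem_tensorSpan (hH : IsTruncatedHopf 𝒜 N) {n : ℕ} {x : H} (hx : x ∈ 𝒜 n) :
    Coalgebra.comul (R := ℝ) x ∈ tensorSpan 𝒜 fun a b => a + b = n :=
  iSup_tensorPiece_le 𝒜 _ (hH.comul_graded n x hx)

/-- The unit is group-like. This is not assumed: connectedness gives `Δ 1 = c 1 ⊗ 1`, and
multiplicativity of `Δ` in degree `(0, 0)` together with the counit axiom force `c = 1`. -/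
theorem comul_one_and_counit_one (hH : IsTruncatedHopf 𝒜 N) :
    Coalgebra.comul (R := ℝ) (1 : H) = 1 ⊗ₜ[ℝ] 1 ∧ Coalgebra.counit (R := ℝ) (1 : H) = 1 := by
  have h1 := comul_mem_tensorSpan hH (SetLike.one_mem_graded 𝒜)
  obtain ⟨c, hc⟩ : ∃ c : ℝ, Coalgebra.comul (R := ℝ) (1 : H) = c • (1 ⊗ₜ[ℝ] 1) := by
    rw [tensorSpan] at h1
    refine Submodule.span_induction (p := fun t _ => ∃ c : ℝ, t = c • ((1 : H) ⊗ₜ[ℝ] (1 : H)))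
      ?_ ⟨0, by simp⟩ ?_ ?_ h1
    · rintro _ ⟨a, b, hab, u, hu, v, hv, rfl⟩
      obtain ⟨rfl, rfl⟩ : a = 0 ∧ b = 0 := by omega
      rw [hH.connected, Submodule.mem_span_singleton] at hu hv
      obtain ⟨s, rfl⟩ := hu
      obtain ⟨t, rfl⟩ := hv
      exact ⟨s * t, by rw [TensorProduct.smul_tmul_smul]⟩
    · rintro s t _ _ ⟨a, rfl⟩ ⟨b, rfl⟩
      exact ⟨a + b, by rw [add_smul]⟩
    · rintro a t _ ⟨b, rfl⟩
      exact ⟨a * b, by rw [mul_smul]⟩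
  have e1 : c * Coalgebra.counit (R := ℝ) (1 : H) = 1 := by
    have h := convTranspose_counit (1 : H)
    rw [convTranspose_apply, hc, map_smul, contract_tmul, LinearMap.id_apply, smul_smul] at h
    have h' : (c * Coalgebra.counit (R := ℝ) (1 : H) - 1) • (1 : H) = 0 := by
      rw [sub_smul, h, one_smul, sub_self]
    rcases smul_eq_zero.1 h' with h' | h'
    · linarith
    · exact absurd h' hH.one_ne_zero
  have h2 := iSup_tensorPiece_le 𝒜 _ (hH.comul_mul 1 1)
  rw [mul_one, hc, smul_mul_smul_comm, Algebra.TensorProduct.tmul_mul_tmul, mul_one,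
    ← sub_smul] at h2
  -- the component of degree `(0, 0)` of the defect of multiplicativity vanishes
  have h3 : contract (Coalgebra.counit (R := ℝ) ∘ₗ GradedAlgebra.proj 𝒜 0)
      (GradedAlgebra.proj 𝒜 0) ((c - c * c) • ((1 : H) ⊗ₜ[ℝ] (1 : H)))
      = (0 : H ⊗[ℝ] H →ₗ[ℝ] H) ((c - c * c) • ((1 : H) ⊗ₜ[ℝ] (1 : H))) := by
    refine eqOn_tensorSpan (fun a b hab u hu v hv => ?_) h2
    rw [contract_tmul, LinearMap.zero_apply]
    by_cases ha : a = 0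
    · rw [proj_of_mem_ne hv (by omega), smul_zero]
    · rw [LinearMap.comp_apply, proj_of_mem_ne hu ha, map_zero, zero_smul]
  rw [map_smul, contract_tmul, LinearMap.comp_apply, LinearMap.zero_apply,
    proj_of_mem (SetLike.one_mem_graded 𝒜), smul_smul] at h3
  rcases smul_eq_zero.1 h3 with h3 | h3
  · have hc1 : c = 1 := by
      have : (c - c * c) * Coalgebra.counit (R := ℝ) (1 : H) = 1 - c := by
        linear_combination (1 - c) * e1
      linarith
    subst hc1
    exact ⟨by rw [hc, one_smul], by linarith⟩
  · exact absurd h3 hH.one_ne_zero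

/-- The counit vanishes in positive degree: applying the counit to both factors of the part of `Δ x`
in `H_n ⊗ H_0` gives `ε x` by the right counit axiom, and zero by the left one, since
`π_0 x = 0`. -/
theorem counit_of_mem (hH : IsTruncatedHopf 𝒜 N) {n : ℕ} (hn : n ≠ 0) {x : H} (hx : x ∈ 𝒜 n) :
    Coalgebra.counit (R := ℝ) x = 0 := by
  have h1 : contract Coalgebra.counit (GradedAlgebra.proj 𝒜 0) (Coalgebra.comul (R := ℝ) x)
      = 0 := by
    rw [← apply_convTranspose_eq, convTranspose_counit, proj_of_mem_ne hx hn]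
  have h2 : (Coalgebra.counit (R := ℝ) ∘ₗ GradedAlgebra.proj 𝒜 n ∘ₗ
        (TensorProduct.rid ℝ H).toLinearMap ∘ₗ LinearMap.lTensor H Coalgebra.counit)
          (Coalgebra.comul (R := ℝ) x)
      = (Coalgebra.counit (R := ℝ) ∘ₗ contract Coalgebra.counit (GradedAlgebra.proj 𝒜 0))
          (Coalgebra.comul (R := ℝ) x) := by
    refine eqOn_tensorSpan (fun a b hab u hu v hv => ?_) (comul_mem_tensorSpan hH hx)
    by_cases hb : b = 0
    · obtain rfl : a = n := by omega
      subst hb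
      simp [proj_of_mem hu, proj_of_mem hv, mul_comm]
    · simp [proj_of_mem_ne hv hb, proj_of_mem_ne hu (show a ≠ n by omega)]
  rw [LinearMap.comp_apply, LinearMap.comp_apply, LinearMap.comp_apply,
    Coalgebra.lTensor_counit_comul, LinearMap.comp_apply, h1] at h2
  simpa [proj_of_mem hx] using h2

theorem algebraMap_counit (hH : IsTruncatedHopf 𝒜 N) (x : H) :
    algebraMap ℝ H (Coalgebra.counit (R := ℝ) x) = GradedAlgebra.proj 𝒜 0 x := by
  have h0 := proj_mem (𝒜 := 𝒜) 0 x
  rw [hH.connected, Submodule.mem_span_singleton] at h0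
  obtain ⟨c, hc⟩ := h0
  have h1 : Coalgebra.counit (R := ℝ) x = c := by
    conv_lhs => rw [← sum_proj hH x, Finset.sum_range_succ', map_add, map_sum]
    rw [Finset.sum_eq_zero fun j _ => counit_of_mem hH (Nat.succ_ne_zero j) (proj_mem _ x),
      zero_add, ← hc, map_smul, (comul_one_and_counit_one hH).2, smul_eq_mul, mul_one]
  rw [h1, ← hc, Algebra.algebraMap_eq_smul_one]

theorem convTranspose_algebraMap (hH : IsTruncatedHopf 𝒜 N) {ξ : H →ₗ[ℝ] ℝ} (hξ : ξ 1 = 1)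
    (c : ℝ) : convTranspose ξ (algebraMap ℝ H c) = algebraMap ℝ H c := by
  rw [Algebra.algebraMap_eq_smul_one, map_smul, convTranspose_apply,
    (comul_one_and_counit_one hH).1, contract_tmul, hξ, one_smul, LinearMap.id_apply]

/-- Only the component of degree `k - j` of `ξ` contributes to the component of degree `j` of the
transpose at an element of degree `k`. -/
theorem proj_convTranspose (hH : IsTruncatedHopf 𝒜 N) (ξ : H →ₗ[ℝ] ℝ) {j k : ℕ} {x : H}
    (hx : x ∈ 𝒜 k) (hjk : j ≤ k) :
    GradedAlgebra.proj 𝒜 j (convTranspose ξ x)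
      = GradedAlgebra.proj 𝒜 j (convTranspose (ξ ∘ₗ GradedAlgebra.proj 𝒜 (k - j)) x) := by
  rw [apply_convTranspose_eq, apply_convTranspose_eq]
  refine eqOn_tensorSpan (fun a b hab u hu v hv => ?_) (comul_mem_tensorSpan hH hx)
  rw [contract_tmul, contract_tmul]
  by_cases hb : b = j
  · rw [LinearMap.comp_apply, show k - j = a by omega, proj_of_mem hu]
  · rw [proj_of_mem_ne hv hb, smul_zero, smul_zero]

theorem proj_convTranspose_of_lt (hH : IsTruncatedHopf 𝒜 N) (ξ : H →ₗ[ℝ] ℝ) {j k : ℕ} {x : H}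
    (hx : x ∈ 𝒜 k) (hjk : k < j) : GradedAlgebra.proj 𝒜 j (convTranspose ξ x) = 0 := by
  rw [apply_convTranspose_eq]
  refine eqOn_tensorSpan (g := 0) (fun a b hab u hu v hv => ?_) (comul_mem_tensorSpan hH hx)
  rw [contract_tmul, proj_of_mem_ne hv (by omega), smul_zero, LinearMap.zero_apply]

/-- The transpose of a character of the truncated algebra is multiplicative below the truncation
degree. -/
theorem convTranspose_mul (hH : IsTruncatedHopf 𝒜 N) {ξ : H →ₗ[ℝ] ℝ}
    (hξ : ∀ m n, m + n ≤ N → ∀ x ∈ 𝒜 m, ∀ y ∈ 𝒜 n, ξ (x * y) = ξ x * ξ y)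
    {k l : ℕ} (hkl : k + l ≤ N) {x y : H} (hx : x ∈ 𝒜 k) (hy : y ∈ 𝒜 l) :
    convTranspose ξ (x * y) = convTranspose ξ x * convTranspose ξ y := by
  have hproj : ∀ j, GradedAlgebra.proj 𝒜 j (convTranspose ξ (x * y))
      = GradedAlgebra.proj 𝒜 j (convTranspose ξ x * convTranspose ξ y) := by
    intro j
    set n := k + l with hn
    have hxy : x * y ∈ 𝒜 n := SetLike.mul_mem_graded hx hy
    set Δx := Coalgebra.comul (R := ℝ) x
    set Δy := Coalgebra.comul (R := ℝ) y
    set η : H →ₗ[ℝ] ℝ := if j ≤ n then ξ ∘ₗ GradedAlgebra.proj 𝒜 (n - j) else 0 with hη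
    -- only total degree `n` contributes, so that the truncation error is invisible
    have e1 : GradedAlgebra.proj 𝒜 j (convTranspose ξ (x * y))
        = contract η (GradedAlgebra.proj 𝒜 j) (Coalgebra.comul (R := ℝ) (x * y)) := by
      by_cases hj : j ≤ n
      · rw [hη, if_pos hj, proj_convTranspose hH ξ hxy hj, apply_convTranspose_eq]
      · rw [hη, if_neg hj, proj_convTranspose_of_lt hH ξ hxy (by omega)]
        simp [contract]
    have e2 : contract η (GradedAlgebra.proj 𝒜 j) (Coalgebra.comul (R := ℝ) (x * y) - Δx * Δy)
        = 0 := by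
      refine eqOn_tensorSpan (g := 0) (fun a b hab u hu v hv => ?_)
        (iSup_tensorPiece_le 𝒜 _ (hH.comul_mul x y))
      rw [contract_tmul, LinearMap.zero_apply]
      by_cases hb : b = j
      · rw [hη]
        split_ifs with hj
        · rw [LinearMap.comp_apply, proj_of_mem_ne hu (by omega), map_zero, zero_smul]
        · rw [LinearMap.zero_apply, zero_smul]
      · rw [proj_of_mem_ne hv hb, smul_zero]
    rw [map_sub, sub_eq_zero] at e2
    rw [e1, e2, convTranspose_apply, convTranspose_apply]
    have e3 : ∀ t ∈ tensorSpan 𝒜 (fun a b => a + b = l), ∀ s ∈ tensorSpan 𝒜 (fun a b => a + b = k),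
        (contract η (GradedAlgebra.proj 𝒜 j) ∘ₗ LinearMap.mulRight ℝ t) s
          = (GradedAlgebra.proj 𝒜 j ∘ₗ LinearMap.mulRight ℝ (contract ξ LinearMap.id t) ∘ₗ
              contract ξ LinearMap.id) s := by
      intro t ht s hs
      refine eqOn_tensorSpan (fun a b hab u hu v hv => ?_) hs
      have := eqOn_tensorSpan (f := contract η (GradedAlgebra.proj 𝒜 j) ∘ₗ
          LinearMap.mulLeft ℝ (u ⊗ₜ[ℝ] v))
        (g := GradedAlgebra.proj 𝒜 j ∘ₗ LinearMap.mulLeft ℝ (ξ u • v) ∘ₗ contract ξ LinearMap.id)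
        (fun a' b' hab' u' hu' v' hv' => ?_) ht
      · simpa using this
      · have huu : u * u' ∈ 𝒜 (a + a') := SetLike.mul_mem_graded hu hu'
        have hvv : v * v' ∈ 𝒜 (b + b') := SetLike.mul_mem_graded hv hv'
        simp only [LinearMap.comp_apply, LinearMap.mulLeft_apply,
          Algebra.TensorProduct.tmul_mul_tmul, contract_tmul, LinearMap.id_apply,
          smul_mul_assoc, map_smul]
        by_cases hb : b + b' = j
        · subst hb
          rw [hη, if_pos (by omega), LinearMap.comp_apply,
            show n - (b + b') = a + a' by omega, proj_of_mem huu,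
            hξ a a' (by omega) u hu u' hu', mul_smul, smul_comm]
        · rw [proj_of_mem_ne hvv hb, smul_zero, smul_zero, smul_zero]
    have := e3 Δy (comul_mem_tensorSpan hH hy) Δx (comul_mem_tensorSpan hH hx)
    simpa using this
  rw [← sum_proj hH (convTranspose ξ (x * y)), ← sum_proj hH (convTranspose ξ x * _)]
  exact Finset.sum_congr rfl fun j _ => hproj j

theorem proj_cocycle (hH : IsTruncatedHopf 𝒜 N) {d : ℕ} {L : Fin d → H →ₗ[ℝ] H}
    (hL : IsCocycleFamily 𝒜 N L) (i : Fin d) (j : ℕ) (x : H) :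
    GradedAlgebra.proj 𝒜 (j + 1) (L i x) = L i (GradedAlgebra.proj 𝒜 j x) := by
  conv_lhs => rw [← sum_proj hH x, map_sum, map_sum]
  by_cases hj : j ≤ N
  · rw [Finset.sum_eq_single j]
    · rw [proj_of_mem (hL.degree i j _ (proj_mem j x))]
    · intro k _ hk
      exact proj_of_mem_ne (hL.degree i k _ (proj_mem k x)) (by omega)
    · intro h
      exact absurd (Finset.mem_range.2 (by omega)) h
  · have h0 : GradedAlgebra.proj 𝒜 j x = 0 := by
      have := proj_mem (𝒜 := 𝒜) j x
      rw [hH.truncated j (by omega)] at this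
      simpa using this
    rw [h0, map_zero]
    refine Finset.sum_eq_zero fun k hk => ?_
    rw [Finset.mem_range] at hk
    exact proj_of_mem_ne (hL.degree i k _ (proj_mem k x)) (by omega)

theorem cocycle_top (hH : IsTruncatedHopf 𝒜 N) {d : ℕ} {L : Fin d → H →ₗ[ℝ] H}
    (hL : IsCocycleFamily 𝒜 N L) (i : Fin d) {x : H} (hx : x ∈ 𝒜 N) : L i x = 0 := by
  have := hL.degree i N x hx
  rw [hH.truncated (N + 1) (by omega)] at this
  simpa using this

/-- The cocycle condition holds below degree `N` only; the operators `L i` vanish in degree `N`, but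
`L i` of the transpose need not, so the top component has to be removed. -/
theorem convTranspose_cocycle_sub (hH : IsTruncatedHopf 𝒜 N) {d : ℕ} {L : Fin d → H →ₗ[ℝ] H}
    (hL : IsCocycleFamily 𝒜 N L) (ξ : H →ₗ[ℝ] ℝ) (i : Fin d) (x : H) :
    convTranspose ξ (L i x) = L i (convTranspose ξ (x - GradedAlgebra.proj 𝒜 N x))
      + algebraMap ℝ H (ξ (L i x)) := by
  have h1 : x - GradedAlgebra.proj 𝒜 N x = ∑ j ∈ Finset.range N, GradedAlgebra.proj 𝒜 j x := by
    rw [sub_eq_iff_eq_add, ← Finset.sum_range_succ, sum_proj hH]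
  have h2 : L i x = L i (∑ j ∈ Finset.range N, GradedAlgebra.proj 𝒜 j x) := by
    rw [← h1, map_sub, cocycle_top hH hL i (proj_mem N x), sub_zero]
  rw [h1, h2]
  simp only [map_sum]
  rw [← Finset.sum_add_distrib]
  exact Finset.sum_congr rfl fun j hj =>
    convTranspose_cocycle hL ξ i (Finset.mem_range.1 hj) (proj_mem j x)

theorem proj_zero_cocycle (hH : IsTruncatedHopf 𝒜 N) {d : ℕ} {L : Fin d → H →ₗ[ℝ] H}
    (hL : IsCocycleFamily 𝒜 N L) (i : Fin d) (x : H) :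
    GradedAlgebra.proj 𝒜 0 (L i x) = 0 := by
  conv_lhs => rw [← sum_proj hH x, map_sum, map_sum]
  exact Finset.sum_eq_zero fun k _ =>
    proj_of_mem_ne (hL.degree i k _ (proj_mem k x)) (Nat.succ_ne_zero k)

end Coproduct

/-! ### Sewing: Riemann sums of almost additive functions -/

section Sewing

variable {V : Type*} [NormedAddCommGroup V]

/-- The sum of `Ξ u v` over consecutive points `u`, `v` of the list `a :: l`. -/
def chainSum (Ξ : ℝ → ℝ → V) : ℝ → List ℝ → V
  | _, [] => 0
  | a, b :: l => Ξ a b + chainSum Ξ b l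

theorem sum_zipWith_tail (Ξ : ℝ → ℝ → V) (a : ℝ) (l : List ℝ) :
    (List.zipWith Ξ (a :: l) (a :: l).tail).sum = chainSum Ξ a l := by
  induction l generalizing a with
  | nil => simp [chainSum]
  | cons b l ih =>
    have := ih b
    simp only [List.tail_cons] at this ⊢
    rw [List.zipWith_cons_cons, List.sum_cons, this, chainSum]

theorem chainSum_append (Ξ : ℝ → ℝ → V) (a x : ℝ) (l₁ l₂ : List ℝ) :
    chainSum Ξ a (l₁ ++ x :: l₂)
      = chainSum Ξ a l₁ + Ξ (l₁.getLastD a) x + chainSum Ξ x l₂ := by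
  induction l₁ generalizing a with
  | nil => simp [chainSum]
  | cons b l ih =>
    rw [List.cons_append, chainSum, ih b, chainSum, List.getLastD_cons]
    abel

theorem getLastD_mem_cons (a : ℝ) (l : List ℝ) : l.getLastD a ∈ a :: l := by
  induction l generalizing a with
  | nil => simp
  | cons b l ih =>
    rw [List.getLastD_cons]
    exact List.mem_cons_of_mem _ (ih b)

theorem le_getLastD {a : ℝ} {l : List ℝ} (h : (a :: l).Pairwise (· ≤ ·)) :
    ∀ x ∈ a :: l, x ≤ l.getLastD a := by
  induction l generalizing a with
  | nil => simp
  | cons b l ih =>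
    intro x hx
    rw [List.getLastD_cons]
    have hb := ih (List.Pairwise.of_cons h)
    rcases List.mem_cons.1 hx with rfl | hx
    · exact (List.rel_of_pairwise_cons h List.mem_cons_self).trans (hb b List.mem_cons_self)
    · exact hb x hx

variable {ω : ℝ → ℝ → ℝ} {T : ℝ}

/-- A chain of points from `y` to `b` has two consecutive points such that `ω` is at most `c / 2`
from `a` to the first and from the second to `b`. -/
theorem exists_balanced_split (hω : IsRightContControl ω T) {a b c : ℝ} (ha : 0 ≤ a) (hb : b ≤ T)
    (hab : ω a b ≤ c) (hc : 0 ≤ c) (l : List ℝ) : ∀ y, a ≤ y → (y :: l).Pairwise (· ≤ ·) →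
      l.getLastD y = b → ω a y ≤ c / 2 → l ≠ [] → ∃ l₁ x l₂, l = l₁ ++ x :: l₂ ∧
        ω a (l₁.getLastD y) ≤ c / 2 ∧ ω x b ≤ c / 2 := by
  induction l with
  | nil => intro y _ _ _ _ h; exact absurd rfl h
  | cons x l ih =>
    intro y hay hs hl hy _
    have hs' := List.Pairwise.of_cons hs
    have hyx : y ≤ x := List.rel_of_pairwise_cons hs List.mem_cons_self
    rw [List.getLastD_cons] at hl
    have hxb : x ≤ b := hl ▸ le_getLastD hs' x List.mem_cons_self
    rcases le_or_gt (ω a x) (c / 2) with hx | hx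
    · by_cases hnil : l = []
      · subst hnil
        refine ⟨[], x, [], by simp, by simpa using hy, ?_⟩
        have : x = b := by simpa using hl
        subst this
        rw [hω.diag x (by linarith) hb]
        linarith
      · obtain ⟨l₁, x', l₂, h1, h2, h3⟩ := ih x (hay.trans hyx) hs' hl hx hnil
        exact ⟨x :: l₁, x', l₂, by rw [h1]; rfl, by rwa [List.getLastD_cons], h3⟩
    · refine ⟨[], x, l, by simp, by simpa using hy, ?_⟩
      have := hω.superadd a x b ha (hay.trans hyx) hxb hb
      linarith

/-- The constant in the sewing estimate. -/
def sewingConst (θ : ℝ) : ℝ := 2 / (1 - (2 : ℝ) ^ (1 - θ))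

theorem two_rpow_lt_one {θ : ℝ} (hθ : 1 < θ) : (2 : ℝ) ^ (1 - θ) < 1 :=
  Real.rpow_lt_one_of_one_lt_of_neg (by norm_num) (by linarith)

theorem sewingConst_nonneg {θ : ℝ} (hθ : 1 < θ) : 0 ≤ sewingConst θ :=
  div_nonneg (by norm_num) (by linarith [two_rpow_lt_one hθ])

variable {Ξ : ℝ → ℝ → V} {Λ θ T' : ℝ}

/-- The sums of an almost additive function along a chain differ from its value on the whole
interval by at most a constant times `ω ^ θ`, whatever the number of points: cutting the chain at a
balanced place bounds the error `E` by `2 E(ω / 2) + 2 Λ ω ^ θ`. -/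
theorem norm_chainSum_sub_le (hω : IsRightContControl ω T) (hT' : T' ≤ T) (hΛ : 0 ≤ Λ)
    (hθ : 1 < θ)
    (hΞ : ∀ s u t, 0 ≤ s → s ≤ u → u ≤ t → t ≤ T' →
      ‖Ξ s t - Ξ s u - Ξ u t‖ ≤ Λ * ω s t ^ θ) (n : ℕ) :
    ∀ (l : List ℝ) (a : ℝ), l.length ≤ n → 0 ≤ a → (a :: l).Pairwise (· ≤ ·) →
      l.getLastD a ≤ T' →
      ‖chainSum Ξ a l - Ξ a (l.getLastD a)‖ ≤ sewingConst θ * Λ * ω a (l.getLastD a) ^ θ := by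
  have hθ0 : θ ≠ 0 := by linarith
  have hdiag : ∀ a, 0 ≤ a → a ≤ T' → ‖(0 : V) - Ξ a a‖ ≤ sewingConst θ * Λ * ω a a ^ θ := by
    intro a ha haT
    have := hΞ a a a ha le_rfl le_rfl haT
    rw [hω.diag a ha (haT.trans hT'), Real.zero_rpow hθ0, mul_zero] at this ⊢
    simpa using this
  induction n with
  | zero =>
    intro l a hl ha _ hT
    obtain rfl : l = [] := List.length_eq_zero_iff.1 (Nat.le_zero.1 hl)
    exact hdiag a ha hT
  | succ n ih =>
    intro l a hl ha hs hT
    by_cases hnil : l = []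
    · subst hnil
      exact hdiag a ha hT
    set b := l.getLastD a with hb
    set c := ω a b with hc
    have hmem : ∀ x ∈ a :: l, a ≤ x ∧ x ≤ b := fun x hx => by
      refine ⟨?_, le_getLastD hs x hx⟩
      rcases List.mem_cons.1 hx with rfl | hx
      · exact le_rfl
      · exact List.rel_of_pairwise_cons hs hx
    have hab : a ≤ b := (hmem a List.mem_cons_self).2
    have hc0 : 0 ≤ c := hω.nonneg a b ha hab (hT.trans hT')
    obtain ⟨l₁, x, l₂, h1, h2, h3⟩ := exists_balanced_split hω ha (hT.trans hT') le_rfl hc0 l a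
      le_rfl hs rfl (by rw [hω.diag a ha ((hab.trans hT).trans hT')]; linarith) hnil
    set y := l₁.getLastD a with hy
    have hymem : y ∈ a :: l := by
      have := getLastD_mem_cons a l₁
      rw [h1]
      rcases List.mem_cons.1 this with h | h
      · rw [hy, h]; exact List.mem_cons_self
      · exact List.mem_cons_of_mem _ (List.mem_append_left _ h)
    have hxmem : x ∈ a :: l := by rw [h1]; simp
    have hs1 : (a :: l₁).Pairwise (· ≤ ·) := by
      rw [h1, ← List.cons_append] at hs
      exact (List.pairwise_append.1 hs).1
    have hs2 : (x :: l₂).Pairwise (· ≤ ·) := by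
      rw [h1, ← List.cons_append] at hs
      exact (List.pairwise_append.1 hs).2.1
    have hyx : y ≤ x := by
      rw [h1, ← List.cons_append] at hs
      exact (List.pairwise_append.1 hs).2.2 y (getLastD_mem_cons a l₁) x List.mem_cons_self
    have hb2 : l₂.getLastD x = b := by
      rw [hb, h1, List.getLastD_eq_getLast?, List.getLastD_eq_getLast?]
      simp [List.getLast?_append, List.getLast?_cons]
    have hlen : l₁.length ≤ n ∧ l₂.length ≤ n := by
      rw [h1] at hl
      simp only [List.length_append, List.length_cons] at hl
      omega
    have hya := hmem y hymem
    have hxa := hmem x hxmem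
    have E1 := ih l₁ a hlen.1 ha hs1 (hya.2.trans hT)
    have E2 := ih l₂ x hlen.2 (ha.trans hxa.1) hs2 (by rw [hb2]; exact hT)
    rw [hb2] at E2
    have E3 := hΞ a y b ha hya.1 hya.2 hT
    have E4 := hΞ y x b (ha.trans hya.1) hyx hxa.2 hT
    have hyb : ω y b ≤ c := by
      have := hω.superadd a y b ha hya.1 hya.2 (hT.trans hT')
      have := hω.nonneg a y ha hya.1 ((hya.2.trans hT).trans hT')
      linarith
    have E4' : ‖Ξ y b - Ξ y x - Ξ x b‖ ≤ Λ * c ^ θ := E4.trans (mul_le_mul_of_nonneg_left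
      (Real.rpow_le_rpow (hω.nonneg y b (ha.trans hya.1) hya.2 (hT.trans hT')) hyb
        (by linarith)) hΛ)
    have hhalf : (c / 2) ^ θ = (2 : ℝ) ^ (1 - θ) / 2 * c ^ θ := by
      rw [Real.div_rpow hc0 (by norm_num), Real.rpow_sub (by norm_num), Real.rpow_one]
      field_simp
    have hK := sewingConst_nonneg hθ
    have F1 : ω a y ^ θ ≤ (2 : ℝ) ^ (1 - θ) / 2 * c ^ θ := by
      rw [← hhalf]
      exact Real.rpow_le_rpow (hω.nonneg a y ha hya.1 ((hya.2.trans hT).trans hT')) h2 (by linarith)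
    have F2 : ω x b ^ θ ≤ (2 : ℝ) ^ (1 - θ) / 2 * c ^ θ := by
      rw [← hhalf]
      exact Real.rpow_le_rpow (hω.nonneg x b (ha.trans hxa.1) hxa.2 (hT.trans hT')) h3 (by linarith)
    have hdec : chainSum Ξ a l - Ξ a b = (chainSum Ξ a l₁ - Ξ a y) + (chainSum Ξ x l₂ - Ξ x b)
        - (Ξ a b - Ξ a y - Ξ y b) - (Ξ y b - Ξ y x - Ξ x b) := by
      rw [h1, chainSum_append]
      abel
    have hconst : sewingConst θ * (2 : ℝ) ^ (1 - θ) + 2 = sewingConst θ := by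
      have := two_rpow_lt_one hθ
      rw [sewingConst]
      have h0 : (1 - (2 : ℝ) ^ (1 - θ)) ≠ 0 := by linarith
      field_simp
      ring
    calc ‖chainSum Ξ a l - Ξ a b‖
        ≤ ‖chainSum Ξ a l₁ - Ξ a y‖ + ‖chainSum Ξ x l₂ - Ξ x b‖
          + ‖Ξ a b - Ξ a y - Ξ y b‖ + ‖Ξ y b - Ξ y x - Ξ x b‖ := by
          rw [hdec]
          refine (norm_sub_le _ _).trans (add_le_add ((norm_sub_le _ _).trans
            (add_le_add (norm_add_le _ _) le_rfl)) le_rfl)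
      _ ≤ sewingConst θ * Λ * ((2 : ℝ) ^ (1 - θ) / 2 * c ^ θ)
          + sewingConst θ * Λ * ((2 : ℝ) ^ (1 - θ) / 2 * c ^ θ) + Λ * c ^ θ + Λ * c ^ θ := by
          refine add_le_add (add_le_add (add_le_add (E1.trans ?_) (E2.trans ?_)) E3) E4'
          · exact mul_le_mul_of_nonneg_left F1 (by positivity)
          · exact mul_le_mul_of_nonneg_left F2 (by positivity)
      _ = (sewingConst θ * (2 : ℝ) ^ (1 - θ) + 2) * (Λ * c ^ θ) := by ring
      _ = _ := by rw [hconst]; ring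

theorem exists_sort_eq_cons {s t : ℝ} {P : Finset ℝ} (hP : IsPartition s t P) :
    ∃ l, P.sort (· ≤ ·) = s :: l ∧ l.getLastD s = t := by
  have hmem : ∀ x, x ∈ P.sort (· ≤ ·) ↔ x ∈ P := fun x => Finset.mem_sort _
  have hsorted : (P.sort (· ≤ ·)).Pairwise (· ≤ ·) := Finset.pairwise_sort P _
  cases hl : P.sort (· ≤ ·) with
  | nil =>
    have := (hmem s).2 hP.1
    rw [hl] at this
    simp at this
  | cons a l =>
    rw [hl] at hmem hsorted
    obtain rfl : a = s := by
      refine le_antisymm ?_ (hP.2.2 a ((hmem a).1 List.mem_cons_self)).1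
      rcases List.mem_cons.1 ((hmem s).2 hP.1) with h | h
      · exact h.ge
      · exact List.rel_of_pairwise_cons hsorted h
    refine ⟨l, rfl, le_antisymm ?_ (le_getLastD hsorted t ((hmem t).2 hP.2.1))⟩
    exact (hP.2.2 _ ((hmem _).1 (getLastD_mem_cons _ l))).2

theorem norm_riemannSum_sub_le (hω : IsRightContControl ω T) (hT' : T' ≤ T) (hΛ : 0 ≤ Λ)
    (hθ : 1 < θ)
    (hΞ : ∀ s u t, 0 ≤ s → s ≤ u → u ≤ t → t ≤ T' →
      ‖Ξ s t - Ξ s u - Ξ u t‖ ≤ Λ * ω s t ^ θ)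
    {s t : ℝ} (hs : 0 ≤ s) (ht : t ≤ T') {P : Finset ℝ} (hP : IsPartition s t P) :
    ‖riemannSum Ξ P - Ξ s t‖ ≤ sewingConst θ * Λ * ω s t ^ θ := by
  obtain ⟨l, h1, h2⟩ := exists_sort_eq_cons hP
  have hsorted : (P.sort (· ≤ ·)).Pairwise (· ≤ ·) := Finset.pairwise_sort P _
  rw [riemannSum, h1, sum_zipWith_tail]
  rw [h1] at hsorted
  have := norm_chainSum_sub_le hω hT' hΛ hθ hΞ l.length l s le_rfl hs hsorted (by rw [h2]; exact ht)
  rwa [h2] at this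

/-- A Riemann sum splits at each division point of the partition. -/
theorem riemannSum_split (Ξ : ℝ → ℝ → V) {P : Finset ℝ} {u : ℝ} (hu : u ∈ P) :
    riemannSum Ξ P = riemannSum Ξ (P.filter (· ≤ u)) + riemannSum Ξ (P.filter (u ≤ ·)) := by
  obtain ⟨l₁, l₂, hl⟩ := List.append_of_mem ((Finset.mem_sort (r := (· ≤ ·))).2 hu)
  have hsorted : (P.sort (· ≤ ·)).Pairwise (· ≤ ·) := Finset.pairwise_sort P _
  have hnodup : (P.sort (· ≤ ·)).Nodup := Finset.sort_nodup P _
  have hmem : ∀ x, x ∈ P ↔ x ∈ l₁ ++ u :: l₂ := fun x => by rw [← hl, Finset.mem_sort]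
  rw [hl] at hsorted hnodup
  obtain ⟨s1, s2, s3⟩ := List.pairwise_append.1 hsorted
  obtain ⟨n1, n2, n3⟩ := List.nodup_append.1 hnodup
  have hlt : ∀ x ∈ l₂, u < x := fun x hx => lt_of_le_of_ne (List.rel_of_pairwise_cons s2 hx)
    fun h => (List.nodup_cons.1 n2).1 (h ▸ hx)
  have hlt' : ∀ x ∈ l₁, x < u := fun x hx => lt_of_le_of_ne (s3 x hx u List.mem_cons_self)
    (n3 x hx u List.mem_cons_self)
  have e1 : (P.filter (· ≤ u)).sort (· ≤ ·) = l₁ ++ [u] := by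
    have hnd : (l₁ ++ [u]).Nodup := by
      refine List.nodup_append.2 ⟨n1, List.nodup_singleton u, fun a ha b hb => ?_⟩
      rw [List.mem_singleton.1 hb]
      exact (hlt' a ha).ne
    have hsd : (l₁ ++ [u]).Pairwise (· ≤ ·) := by
      refine List.pairwise_append.2 ⟨s1, List.pairwise_singleton _ _, fun a ha b hb => ?_⟩
      rw [List.mem_singleton.1 hb]
      exact (hlt' a ha).le
    rw [← (List.toFinset_sort (· ≤ ·) hnd).2 hsd]
    congr 1
    ext x
    simp only [Finset.mem_filter, hmem, List.mem_toFinset, List.mem_append, List.mem_cons,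
      List.not_mem_nil, or_false]
    constructor
    · rintro ⟨h | h | h, hx⟩
      · exact Or.inl h
      · exact Or.inr h
      · exact absurd (hlt x h) (not_lt.2 hx)
    · rintro (h | h)
      · exact ⟨Or.inl h, (hlt' x h).le⟩
      · exact ⟨Or.inr (Or.inl h), h.le⟩
  have e2 : (P.filter (u ≤ ·)).sort (· ≤ ·) = u :: l₂ := by
    rw [← (List.toFinset_sort (· ≤ ·) n2).2 s2]
    congr 1
    ext x
    simp only [Finset.mem_filter, hmem, List.mem_toFinset, List.mem_append, List.mem_cons]
    constructor
    · rintro ⟨h | h | h, hx⟩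
      · exact absurd (hlt' x h) (not_lt.2 hx)
      · exact Or.inl h
      · exact Or.inr h
    · rintro (h | h)
      · exact ⟨Or.inr (Or.inl h), h.ge⟩
      · exact ⟨Or.inr (Or.inr h), (hlt x h).le⟩
  rw [riemannSum, riemannSum, riemannSum, hl, e1, e2]
  cases l₁ with
  | nil => simp
  | cons a l =>
    simp only [List.cons_append]
    rw [sum_zipWith_tail, sum_zipWith_tail, sum_zipWith_tail, chainSum_append, chainSum_append]
    simp [chainSum]

theorem chainSum_sub (Ξ Ξ' : ℝ → ℝ → V) (a : ℝ) (l : List ℝ) :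
    chainSum (Ξ - Ξ') a l = chainSum Ξ a l - chainSum Ξ' a l := by
  induction l generalizing a with
  | nil => simp [chainSum]
  | cons b l ih =>
    rw [chainSum, chainSum, chainSum, ih b]
    simp only [Pi.sub_apply]
    abel

theorem IsPartition.union {s t : ℝ} {P Q : Finset ℝ} (hP : IsPartition s t P)
    (hQ : IsPartition s t Q) : IsPartition s t (P ∪ Q) :=
  ⟨Finset.mem_union_left _ hP.1, Finset.mem_union_left _ hP.2.1, fun u hu =>
    (Finset.mem_union.1 hu).elim (hP.2.2 u) (hQ.2.2 u)⟩

theorem IsRRSLimit.sub {Ξ Ξ' : ℝ → ℝ → V} {s t : ℝ} {J J' : V} (h : IsRRSLimit Ξ s t J)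
    (h' : IsRRSLimit Ξ' s t J') : IsRRSLimit (Ξ - Ξ') s t (J - J') := by
  intro ε hε
  obtain ⟨P, hP, h1⟩ := h (ε / 2) (half_pos hε)
  obtain ⟨P', hP', h2⟩ := h' (ε / 2) (half_pos hε)
  refine ⟨P ∪ P', hP.union hP', fun Q hQ hsub => ?_⟩
  have e1 := h1 Q hQ (Finset.union_subset_left hsub)
  have e2 := h2 Q hQ (Finset.union_subset_right hsub)
  have e3 : riemannSum (Ξ - Ξ') Q = riemannSum Ξ Q - riemannSum Ξ' Q := by
    obtain ⟨l, hl, _⟩ := exists_sort_eq_cons hQ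
    rw [riemannSum, riemannSum, riemannSum, hl, sum_zipWith_tail, sum_zipWith_tail,
      sum_zipWith_tail, chainSum_sub]
  rw [e3, show riemannSum Ξ Q - riemannSum Ξ' Q - (J - J')
    = (riemannSum Ξ Q - J) - (riemannSum Ξ' Q - J') by abel]
  linarith [norm_sub_le (riemannSum Ξ Q - J) (riemannSum Ξ' Q - J')]

/-- If the Riemann sums of an almost additive function converge on `[0, s]` and on `[0, t]`, the
increment of the limits is approximated by the function. -/
theorem norm_limit_sub_le (hω : IsRightContControl ω T) (hT' : T' ≤ T) (hΛ : 0 ≤ Λ)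
    (hθ : 1 < θ)
    (hΞ : ∀ s u t, 0 ≤ s → s ≤ u → u ≤ t → t ≤ T' →
      ‖Ξ s t - Ξ s u - Ξ u t‖ ≤ Λ * ω s t ^ θ)
    {s t : ℝ} (hs : 0 ≤ s) (hst : s ≤ t) (ht : t ≤ T') {Js Jt : V}
    (hJs : IsRRSLimit Ξ 0 s Js) (hJt : IsRRSLimit Ξ 0 t Jt) :
    ‖Jt - Js - Ξ s t‖ ≤ sewingConst θ * Λ * ω s t ^ θ := by
  refine le_of_forall_pos_le_add fun ε hε => ?_
  obtain ⟨P, hP, h1⟩ := hJs (ε / 2) (half_pos hε)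
  obtain ⟨P', hP', h2⟩ := hJt (ε / 2) (half_pos hε)
  have hQ : IsPartition 0 t (P ∪ P') := by
    refine ⟨Finset.mem_union_left _ hP.1, Finset.mem_union_right _ hP'.2.1, fun u hu => ?_⟩
    rcases Finset.mem_union.1 hu with h | h
    · exact ⟨(hP.2.2 u h).1, (hP.2.2 u h).2.trans hst⟩
    · exact hP'.2.2 u h
  have hsQ : s ∈ P ∪ P' := Finset.mem_union_left _ hP.2.1
  have hQ1 : IsPartition 0 s ((P ∪ P').filter (· ≤ s)) := by
    refine ⟨Finset.mem_filter.2 ⟨hQ.1, hs⟩, Finset.mem_filter.2 ⟨hsQ, le_rfl⟩, fun u hu => ?_⟩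
    exact ⟨(hQ.2.2 u (Finset.mem_filter.1 hu).1).1, (Finset.mem_filter.1 hu).2⟩
  have hQ2 : IsPartition s t ((P ∪ P').filter (s ≤ ·)) := by
    refine ⟨Finset.mem_filter.2 ⟨hsQ, le_rfl⟩, Finset.mem_filter.2 ⟨hQ.2.1, hst⟩, fun u hu => ?_⟩
    exact ⟨(Finset.mem_filter.1 hu).2, (hQ.2.2 u (Finset.mem_filter.1 hu).1).2⟩
  have e1 := h1 _ hQ1 fun u hu =>
    Finset.mem_filter.2 ⟨Finset.mem_union_left _ hu, (hP.2.2 u hu).2⟩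
  have e2 := h2 _ hQ Finset.subset_union_right
  have e3 := norm_riemannSum_sub_le hω hT' hΛ hθ hΞ hs ht hQ2
  rw [riemannSum_split Ξ hsQ] at e2
  set A := riemannSum Ξ ((P ∪ P').filter (· ≤ s))
  set B := riemannSum Ξ ((P ∪ P').filter (s ≤ ·))
  calc ‖Jt - Js - Ξ s t‖ = ‖(B - Ξ s t) + ((A - Js) - (A + B - Jt))‖ := by congr 1; abel
    _ ≤ ‖B - Ξ s t‖ + (‖A - Js‖ + ‖A + B - Jt‖) :=
        (norm_add_le _ _).trans (add_le_add le_rfl (norm_sub_le _ _))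
    _ ≤ _ := by linarith

end Sewing

/-! ### Bounds for pairs: size and distance at once -/

section Near

/-- Both `x` and `x'` have size at most `C * ρ`, and their difference has size at most
`C * (δ * ρ)`; sizes are measured by `q`. -/
def Near {E : Type*} [Sub E] (q : E → ℝ) (C ρ δ : ℝ) (x x' : E) : Prop :=
  q x ≤ C * ρ ∧ q x' ≤ C * ρ ∧ q (x - x') ≤ C * (δ * ρ)

variable {E F G : Type*} [AddCommGroup E] [AddCommGroup F] [AddCommGroup G]
  {q : E → ℝ} {q₁ : F → ℝ} {q₂ : G → ℝ} {C D ρ σ δ : ℝ} {x x' : E}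

theorem Near.mono (h : Near q C ρ δ x x') (hC : 0 ≤ C) (hCD : C ≤ D) (hρ : ρ ≤ σ) (hσ : 0 ≤ σ)
    (hδ : 0 ≤ δ) : Near q D σ δ x x' := by
  have h1 : C * ρ ≤ D * σ :=
    (mul_le_mul_of_nonneg_left hρ hC).trans (mul_le_mul_of_nonneg_right hCD hσ)
  have h2 : C * (δ * ρ) ≤ D * (δ * σ) :=
    (mul_le_mul_of_nonneg_left (mul_le_mul_of_nonneg_left hρ hδ) hC).trans
      (mul_le_mul_of_nonneg_right hCD (mul_nonneg hδ hσ))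
  exact ⟨h.1.trans h1, h.2.1.trans h1, h.2.2.trans h2⟩

theorem Near.add (hq : ∀ x y, q (x + y) ≤ q x + q y) {y y' : E} (h : Near q C ρ δ x x')
    (h' : Near q D ρ δ y y') : Near q (C + D) ρ δ (x + y) (x' + y') := by
  refine ⟨(hq _ _).trans ?_, (hq _ _).trans ?_, ?_⟩
  · linarith [h.1, h'.1]
  · linarith [h.2.1, h'.2.1]
  · rw [add_sub_add_comm]
    refine (hq _ _).trans ?_
    linarith [h.2.2, h'.2.2]

theorem Near.sum (hq : ∀ x y, q (x + y) ≤ q x + q y) (h0 : q 0 = 0) {κ : Type*} (s : Finset κ)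
    {f f' : κ → E} {C : κ → ℝ} (h : ∀ k ∈ s, Near q (C k) ρ δ (f k) (f' k)) :
    Near q (∑ k ∈ s, C k) ρ δ (∑ k ∈ s, f k) (∑ k ∈ s, f' k) := by
  classical
  induction s using Finset.induction_on with
  | empty => simp [Near, h0]
  | insert a s ha ih =>
    rw [Finset.sum_insert ha, Finset.sum_insert ha, Finset.sum_insert ha]
    exact (h a (Finset.mem_insert_self a s)).add hq
      (ih fun k hk => h k (Finset.mem_insert_of_mem hk))

theorem Near.zero (h0 : q 0 = 0) (hC : 0 ≤ C) (hρ : 0 ≤ ρ) (hδ : 0 ≤ δ) :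
    Near q C ρ δ (0 : E) 0 := by
  have h1 := mul_nonneg hC hρ
  have h2 := mul_nonneg hC (mul_nonneg hδ hρ)
  refine ⟨?_, ?_, ?_⟩
  · rwa [h0]
  · rwa [h0]
  · rwa [sub_zero, h0]

/-- A bounded biadditive operation multiplies scales. -/
theorem Near.bilin (f : E → F → G) {κ : ℝ} (hκ : 0 ≤ κ) (hf : ∀ x y, q₂ (f x y) ≤ κ * q x * q₁ y)
    (hq0 : ∀ x, 0 ≤ q x) (hq1 : ∀ x, 0 ≤ q₁ x) (hq2 : ∀ x y, q₂ (x + y) ≤ q₂ x + q₂ y)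
    (hsub : ∀ x x' y y', f x y - f x' y' = f (x - x') y + f x' (y - y'))
    {y y' : F} (h : Near q C ρ δ x x') (h' : Near q₁ D σ δ y y') :
    Near q₂ (2 * κ * C * D) (ρ * σ) δ (f x y) (f x' y') := by
  have key : ∀ {a b : ℝ} {x : E} {y : F}, q x ≤ a → q₁ y ≤ b → q₂ (f x y) ≤ κ * a * b := by
    intro a b x y ha hb
    refine (hf x y).trans ?_
    rw [mul_assoc, mul_assoc]
    exact mul_le_mul_of_nonneg_left (mul_le_mul ha hb (hq1 y) ((hq0 x).trans ha)) hκ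
  have hpos : ∀ {x : E} {y : F}, q x ≤ C * ρ → q₁ y ≤ D * σ →
      q₂ (f x y) ≤ 2 * κ * C * D * (ρ * σ) := by
    intro x y ha hb
    have h1 := key ha hb
    have h2 : 0 ≤ κ * (C * ρ) * (D * σ) :=
      mul_nonneg (mul_nonneg hκ ((hq0 x).trans ha)) ((hq1 y).trans hb)
    nlinarith
  refine ⟨hpos h.1 h'.1, hpos h.2.1 h'.2.1, ?_⟩
  rw [hsub]
  have h1 := key h.2.2 h'.1
  have h2 := key h.2.1 h'.2.2
  have := hq2 (f (x - x') y) (f x' (y - y'))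
  nlinarith

end Near

section PairBound

variable {H : Type*} [CommRing H] [Algebra ℝ H] {I : Type*}

/-- The pair of families `w`, `w'` in `H` is of order `n` in degrees below `m`, uniformly in the
index: the component of degree `j` is `O(r ^ (n - j))`, where the natural subtraction makes the
bound `O(1)` for `j ≥ n`, and the difference of the two families has the same order with an
additional factor `δ`. -/
def PairBound (𝒜 : ℕ → Submodule ℝ H) [GradedAlgebra 𝒜] (p : Seminorm ℝ H) (m n : ℕ)
    (r δ : I → ℝ) (w w' : I → H) : Prop :=
  ∃ C, 0 ≤ C ∧ ∀ i, ∀ j < m, Near p C (r i ^ (n - j)) (δ i)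
    (GradedAlgebra.proj 𝒜 j (w i)) (GradedAlgebra.proj 𝒜 j (w' i))

/-- The analogue of `PairBound` for families of numbers. -/
def ScalarBound (n : ℕ) (r δ : I → ℝ) (f f' : I → ℝ) : Prop :=
  ∃ C, 0 ≤ C ∧ ∀ i, Near (fun c : ℝ => |c|) C (r i ^ n) (δ i) (f i) (f' i)

/-- The scales `r` lie in `[0, 1]` and the distances `δ` are nonnegative. -/
structure IsScale (r δ : I → ℝ) : Prop where
  nonneg : ∀ i, 0 ≤ r i
  le_one : ∀ i, r i ≤ 1
  dist_nonneg : ∀ i, 0 ≤ δ i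

theorem IsScale.pow_le {r δ : I → ℝ} (hr : IsScale r δ) (i : I) {a b : ℕ} (h : b ≤ a) :
    r i ^ a ≤ r i ^ b :=
  pow_le_pow_of_le_one (hr.nonneg i) (hr.le_one i) h

theorem IsScale.comp {r δ : I → ℝ} (hr : IsScale r δ) {I' : Type*} (g : I' → I) :
    IsScale (fun i => r (g i)) fun i => δ (g i) :=
  ⟨fun _ => hr.nonneg _, fun _ => hr.le_one _, fun _ => hr.dist_nonneg _⟩

variable {𝒜 : ℕ → Submodule ℝ H} [GradedAlgebra 𝒜] {p : Seminorm ℝ H} {m n n' : ℕ}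
  {r δ : I → ℝ} {w w' v v' : I → H} {f f' g g' : I → ℝ}

theorem PairBound.comp (h : PairBound 𝒜 p m n r δ w w') {I' : Type*} (g : I' → I) :
    PairBound 𝒜 p m n (fun i => r (g i)) (fun i => δ (g i)) (fun i => w (g i))
      fun i => w' (g i) := by
  obtain ⟨C, hC, h⟩ := h
  exact ⟨C, hC, fun i => h (g i)⟩

theorem ScalarBound.comp (h : ScalarBound n r δ f f') {I' : Type*} (g : I' → I) :
    ScalarBound n (fun i => r (g i)) (fun i => δ (g i)) (fun i => f (g i))
      fun i => f' (g i) := by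
  obtain ⟨C, hC, h⟩ := h
  exact ⟨C, hC, fun i => h (g i)⟩

theorem PairBound.mono (hr : IsScale r δ) (h : PairBound 𝒜 p m n r δ w w') (hn : n' ≤ n) :
    PairBound 𝒜 p m n' r δ w w' := by
  obtain ⟨C, hC, h⟩ := h
  exact ⟨C, hC, fun i j hj => (h i j hj).mono hC le_rfl (hr.pow_le i (by omega))
    (pow_nonneg (hr.nonneg i) _) (hr.dist_nonneg i)⟩

theorem PairBound.mono_scale (hr : IsScale r δ) {r₁ : I → ℝ} (hle : ∀ i, r i ≤ r₁ i)
    (h : PairBound 𝒜 p m n r δ w w') : PairBound 𝒜 p m n r₁ δ w w' := by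
  obtain ⟨C, hC, h⟩ := h
  exact ⟨C, hC, fun i j hj => (h i j hj).mono hC le_rfl
    (pow_le_pow_left₀ (hr.nonneg i) (hle i) _)
    (pow_nonneg ((hr.nonneg i).trans (hle i)) _) (hr.dist_nonneg i)⟩

theorem PairBound.mono_degree {m' : ℕ} (h : PairBound 𝒜 p m n r δ w w') (hm : m' ≤ m) :
    PairBound 𝒜 p m' n r δ w w' := by
  obtain ⟨C, hC, h⟩ := h
  exact ⟨C, hC, fun i j hj => h i j (hj.trans_le hm)⟩

/-- For order zero the scale does not matter. -/
theorem PairBound.order_zero_congr (h : PairBound 𝒜 p m 0 r δ w w') (r₁ : I → ℝ) :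
    PairBound 𝒜 p m 0 r₁ δ w w' := by
  obtain ⟨C, hC, h⟩ := h
  refine ⟨C, hC, fun i j hj => ?_⟩
  simpa using h i j hj

theorem ScalarBound.mono (hr : IsScale r δ) (h : ScalarBound n r δ f f') (hn : n' ≤ n) :
    ScalarBound n' r δ f f' := by
  obtain ⟨C, hC, h⟩ := h
  exact ⟨C, hC, fun i => (h i).mono hC le_rfl (hr.pow_le i hn)
    (pow_nonneg (hr.nonneg i) _) (hr.dist_nonneg i)⟩

theorem PairBound.add (h : PairBound 𝒜 p m n r δ w w') (h' : PairBound 𝒜 p m n r δ v v') :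
    PairBound 𝒜 p m n r δ (fun i => w i + v i) fun i => w' i + v' i := by
  obtain ⟨C, hC, h⟩ := h
  obtain ⟨D, hD, h'⟩ := h'
  refine ⟨C + D, add_nonneg hC hD, fun i j hj => ?_⟩
  simp only [map_add]
  exact (h i j hj).add (map_add_le_add p) (h' i j hj)

theorem ScalarBound.add (h : ScalarBound n r δ f f') (h' : ScalarBound n r δ g g') :
    ScalarBound n r δ (fun i => f i + g i) fun i => f' i + g' i := by
  obtain ⟨C, hC, h⟩ := h
  obtain ⟨D, hD, h'⟩ := h'
  exact ⟨C + D, add_nonneg hC hD, fun i => (h i).add abs_add_le (h' i)⟩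

theorem PairBound.zero :
    PairBound 𝒜 p m n r δ (fun _ => (0 : H)) fun _ => 0 := by
  refine ⟨0, le_rfl, fun i j _ => ?_⟩
  simp [Near]

theorem ScalarBound.zero : ScalarBound n r δ (fun _ => 0) fun _ => 0 :=
  ⟨0, le_rfl, fun i => by simp [Near]⟩

theorem PairBound.sum {κ : Type*} (s : Finset κ) {w w' : κ → I → H}
    (h : ∀ k ∈ s, PairBound 𝒜 p m n r δ (w k) (w' k)) :
    PairBound 𝒜 p m n r δ (fun i => ∑ k ∈ s, w k i) fun i => ∑ k ∈ s, w' k i := by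
  classical
  induction s using Finset.induction_on with
  | empty => simpa using PairBound.zero
  | insert a s ha ih =>
    simp only [Finset.sum_insert ha]
    exact (h a (Finset.mem_insert_self a s)).add
      (ih fun k hk => h k (Finset.mem_insert_of_mem hk))

theorem ScalarBound.sum {κ : Type*} (s : Finset κ) {f f' : κ → I → ℝ}
    (h : ∀ k ∈ s, ScalarBound n r δ (f k) (f' k)) :
    ScalarBound n r δ (fun i => ∑ k ∈ s, f k i) fun i => ∑ k ∈ s, f' k i := by
  classical
  induction s using Finset.induction_on with
  | empty => simpa using ScalarBound.zero
  | insert a s ha ih =>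
    simp only [Finset.sum_insert ha]
    exact (h a (Finset.mem_insert_self a s)).add
      (ih fun k hk => h k (Finset.mem_insert_of_mem hk))

theorem ScalarBound.mul (h : ScalarBound n r δ f f') (h' : ScalarBound n' r δ g g') :
    ScalarBound (n + n') r δ (fun i => f i * g i) fun i => f' i * g' i := by
  obtain ⟨C, hC, h⟩ := h
  obtain ⟨D, hD, h'⟩ := h'
  refine ⟨2 * 1 * C * D, by positivity, fun i => ?_⟩
  rw [pow_add]
  exact Near.bilin (fun x y : ℝ => x * y) zero_le_one (fun x y => by rw [abs_mul, one_mul])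
    (fun x => abs_nonneg x) (fun x => abs_nonneg x) abs_add_le (fun _ _ _ _ => by ring) (h i) (h' i)

theorem ScalarBound.const_one (hr : IsScale r δ) (c : ℝ) :
    ScalarBound 0 r δ (fun _ => c) fun _ => c := by
  refine ⟨|c|, abs_nonneg c, fun i => ?_⟩
  have := hr.dist_nonneg i
  simp only [Near, pow_zero, mul_one, sub_self, abs_zero]
  exact ⟨le_rfl, le_rfl, by positivity⟩

theorem PairBound.of_scalar (hr : IsScale r δ) (h : ScalarBound n r δ f f') :
    PairBound 𝒜 p m n r δ (fun i => algebraMap ℝ H (f i)) fun i => algebraMap ℝ H (f' i) := by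
  obtain ⟨C, hC, h⟩ := h
  refine ⟨C * p 1, by positivity, fun i j _ => ?_⟩
  have hpa : ∀ c : ℝ, p (algebraMap ℝ H c) = |c| * p 1 := fun c => by
    rw [Algebra.algebraMap_eq_smul_one, map_smul_eq_mul, Real.norm_eq_abs]
  have hp1 := apply_nonneg p (1 : H)
  by_cases hj : j = 0
  · subst hj
    rw [proj_of_mem (algebraMap_mem_zero _), proj_of_mem (algebraMap_mem_zero _)]
    obtain ⟨h1, h2, h3⟩ := h i
    refine ⟨?_, ?_, ?_⟩
    · rw [hpa, Nat.sub_zero]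
      nlinarith
    · rw [hpa, Nat.sub_zero]
      nlinarith
    · rw [← map_sub, hpa, Nat.sub_zero]
      nlinarith
  · rw [proj_of_mem_ne (algebraMap_mem_zero _) (Ne.symm hj),
      proj_of_mem_ne (algebraMap_mem_zero _) (Ne.symm hj)]
    have h1 := hr.nonneg i
    have h2 := hr.dist_nonneg i
    simp only [Near, map_zero, sub_self]
    exact ⟨by positivity, by positivity, by positivity⟩

theorem PairBound.proj (hr : IsScale r δ) (h : PairBound 𝒜 p m 0 r δ w w') (k : ℕ) :
    PairBound 𝒜 p m k r δ (fun i => GradedAlgebra.proj 𝒜 k (w i))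
      fun i => GradedAlgebra.proj 𝒜 k (w' i) := by
  obtain ⟨C, hC, h⟩ := h
  refine ⟨C, hC, fun i j hj => ?_⟩
  by_cases hjk : k = j
  · subst hjk
    rw [proj_of_mem (proj_mem _ _), proj_of_mem (proj_mem _ _)]
    simpa using h i k hj
  · rw [proj_proj_ne hjk, proj_proj_ne hjk]
    exact Near.zero (map_zero p) hC (pow_nonneg (hr.nonneg i) _) (hr.dist_nonneg i)

variable [Coalgebra ℝ H] {N : ℕ}

theorem PairBound.mul (hH : IsTruncatedHopf 𝒜 N) (hp : IsGoodNorm 𝒜 p) (hr : IsScale r δ)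
    (h : PairBound 𝒜 p m n r δ w w') (h' : PairBound 𝒜 p m n' r δ v v') :
    PairBound 𝒜 p m (n + n') r δ (fun i => w i * v i) fun i => w' i * v' i := by
  have := finite_of_isTruncatedHopf hH
  obtain ⟨κ, hκ, hmul⟩ := exists_bound_mul hp.definite
  obtain ⟨C, hC, h⟩ := h
  obtain ⟨D, hD, h'⟩ := h'
  refine ⟨∑ _a ∈ Finset.range (N + 1), 2 * κ * C * D, by positivity, fun i j hj => ?_⟩
  simp only [proj_mul hH]
  refine Near.sum (map_add_le_add p) (map_zero p) _ fun a _ => ?_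
  have hpow := pow_nonneg (hr.nonneg i) (n + n' - j)
  split_ifs with haj
  · refine (Near.bilin (fun x y : H => x * y) hκ hmul (apply_nonneg p) (apply_nonneg p)
      (map_add_le_add p) (fun _ _ _ _ => by ring) (h i a (by omega)) (h' i (j - a) (by omega))).mono
      (by positivity) le_rfl ?_ hpow (hr.dist_nonneg i)
    rw [← pow_add]
    exact hr.pow_le i (by omega)
  · exact Near.zero (map_zero p) (by positivity) hpow (hr.dist_nonneg i)

theorem PairBound.smul (hH : IsTruncatedHopf 𝒜 N) (hp : IsGoodNorm 𝒜 p) (hr : IsScale r δ)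
    (h : ScalarBound n r δ f f') (h' : PairBound 𝒜 p m n' r δ v v') :
    PairBound 𝒜 p m (n + n') r δ (fun i => f i • v i) fun i => f' i • v' i := by
  simp only [Algebra.smul_def]
  exact (PairBound.of_scalar hr h).mul hH hp hr h'

theorem PairBound.const_smul (hH : IsTruncatedHopf 𝒜 N) (hp : IsGoodNorm 𝒜 p) (hr : IsScale r δ)
    (c : ℝ) (h' : PairBound 𝒜 p m n r δ v v') :
    PairBound 𝒜 p m n r δ (fun i => c • v i) fun i => c • v' i := by
  have := PairBound.smul hH hp hr (ScalarBound.const_one hr c) h'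
  rwa [zero_add] at this

theorem PairBound.neg (hH : IsTruncatedHopf 𝒜 N) (hp : IsGoodNorm 𝒜 p) (hr : IsScale r δ)
    (h' : PairBound 𝒜 p m n r δ v v') :
    PairBound 𝒜 p m n r δ (fun i => - v i) fun i => - v' i := by
  simpa using h'.const_smul hH hp hr (-1)

theorem PairBound.sub (hH : IsTruncatedHopf 𝒜 N) (hp : IsGoodNorm 𝒜 p) (hr : IsScale r δ)
    (h : PairBound 𝒜 p m n r δ w w') (h' : PairBound 𝒜 p m n r δ v v') :
    PairBound 𝒜 p m n r δ (fun i => w i - v i) fun i => w' i - v' i := by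
  simp only [sub_eq_add_neg]
  exact h.add (h'.neg hH hp hr)

theorem ScalarBound.neg (hr : IsScale r δ) (h : ScalarBound n r δ f f') :
    ScalarBound n r δ (fun i => - f i) fun i => - f' i := by
  have := (ScalarBound.const_one hr (-1)).mul h
  rw [zero_add] at this
  simpa using this

theorem PairBound.prod (hH : IsTruncatedHopf 𝒜 N) (hp : IsGoodNorm 𝒜 p) (hr : IsScale r δ)
    {k : ℕ} {w w' : Fin k → I → H} (h : ∀ l, PairBound 𝒜 p m n r δ (w l) (w' l)) :
    PairBound 𝒜 p m (k * n) r δ (fun i => ∏ l, w l i) fun i => ∏ l, w' l i := by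
  induction k with
  | zero =>
    simp only [Finset.univ_eq_empty, Finset.prod_empty, zero_mul]
    simpa using PairBound.of_scalar (𝒜 := 𝒜) (p := p) (m := m) hr (ScalarBound.const_one hr 1)
  | succ k ih =>
    simp only [Fin.prod_univ_succ]
    have := (h 0).mul hH hp hr (ih fun l => h l.succ)
    rwa [show n + k * n = (k + 1) * n by ring] at this

theorem ScalarBound.counit (hH : IsTruncatedHopf 𝒜 N) (hp : IsGoodNorm 𝒜 p)
    (h : PairBound 𝒜 p (m + 1) n r δ w w') :
    ScalarBound n r δ (fun i => Coalgebra.counit (R := ℝ) (w i))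
      fun i => Coalgebra.counit (R := ℝ) (w' i) := by
  obtain ⟨C, hC, h⟩ := h
  have hp1 : 0 < p (1 : H) := lt_of_le_of_ne (apply_nonneg p _)
    fun h => hH.one_ne_zero (hp.definite _ h.symm)
  refine ⟨C / p 1, by positivity, fun i => ?_⟩
  obtain ⟨h1, h2, h3⟩ := h i 0 (Nat.succ_pos m)
  rw [← map_sub] at h3
  have key : ∀ x : H, |Coalgebra.counit (R := ℝ) x| = p (GradedAlgebra.proj 𝒜 0 x) / p 1 := by
    intro x
    rw [← algebraMap_counit hH, Algebra.algebraMap_eq_smul_one, map_smul_eq_mul,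
      Real.norm_eq_abs, mul_div_assoc, div_self hp1.ne', mul_one]
  refine ⟨?_, ?_, ?_⟩
  · beta_reduce
    rw [key, div_mul_eq_mul_div]
    exact div_le_div_of_nonneg_right h1 hp1.le
  · beta_reduce
    rw [key, div_mul_eq_mul_div]
    exact div_le_div_of_nonneg_right h2 hp1.le
  · beta_reduce
    rw [← map_sub, key, div_mul_eq_mul_div]
    exact div_le_div_of_nonneg_right h3 hp1.le

/-- Removing the scalar part raises the order from zero to one. -/
theorem PairBound.sub_counit (hH : IsTruncatedHopf 𝒜 N) (hr : IsScale r δ)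
    (h : PairBound 𝒜 p m 0 r δ w w') :
    PairBound 𝒜 p m 1 r δ (fun i => w i - algebraMap ℝ H (Coalgebra.counit (R := ℝ) (w i)))
      fun i => w' i - algebraMap ℝ H (Coalgebra.counit (R := ℝ) (w' i)) := by
  obtain ⟨C, hC, h⟩ := h
  refine ⟨C, hC, fun i j hj => ?_⟩
  have key : ∀ x : H, GradedAlgebra.proj 𝒜 j
      (x - algebraMap ℝ H (Coalgebra.counit (R := ℝ) x))
      = if j = 0 then 0 else GradedAlgebra.proj 𝒜 j x := by
    intro x
    rw [map_sub]
    split_ifs with h0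
    · subst h0
      rw [proj_of_mem (algebraMap_mem_zero _), algebraMap_counit hH, sub_self]
    · rw [proj_of_mem_ne (algebraMap_mem_zero _) (Ne.symm h0), sub_zero]
  rw [key, key]
  split_ifs with h0
  · exact Near.zero (map_zero p) hC (pow_nonneg (hr.nonneg i) _) (hr.dist_nonneg i)
  · have := h i j hj
    rw [show 1 - j = 0 by omega]
    simpa using this

end PairBound

section Transport

variable {H : Type*} [CommRing H] [Algebra ℝ H] {I : Type*}
  {𝒜 : ℕ → Submodule ℝ H} [GradedAlgebra 𝒜] {p : Seminorm ℝ H} {N n : ℕ}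
  {r δ : I → ℝ} {w w' v v' : I → H} {ξ ξ' : I → H →ₗ[ℝ] ℝ}

/-- The pair of families of functionals `ξ`, `ξ'` satisfies the bounds of a rough path at scale
`r`: the component of degree `k` is `O(r ^ k)`. -/
def FunctionalBound (𝒜 : ℕ → Submodule ℝ H) [GradedAlgebra 𝒜] (p : Seminorm ℝ H) (N : ℕ)
    (r δ : I → ℝ) (ξ ξ' : I → H →ₗ[ℝ] ℝ) : Prop :=
  ∃ C, 0 ≤ C ∧ ∀ i, ∀ k ≤ N, Near (dualNorm p) C (r i ^ k) (δ i)
    (ξ i ∘ₗ GradedAlgebra.proj 𝒜 k) (ξ' i ∘ₗ GradedAlgebra.proj 𝒜 k)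

theorem FunctionalBound.comp (h : FunctionalBound 𝒜 p N r δ ξ ξ') {I' : Type*} (g : I' → I) :
    FunctionalBound 𝒜 p N (fun i => r (g i)) (fun i => δ (g i)) (fun i => ξ (g i))
      fun i => ξ' (g i) := by
  obtain ⟨C, hC, h⟩ := h
  exact ⟨C, hC, fun i => h (g i)⟩

theorem FunctionalBound.mono_scale (hr : IsScale r δ) {r₁ : I → ℝ} (hle : ∀ i, r i ≤ r₁ i)
    (h : FunctionalBound 𝒜 p N r δ ξ ξ') : FunctionalBound 𝒜 p N r₁ δ ξ ξ' := by
  obtain ⟨C, hC, h⟩ := h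
  exact ⟨C, hC, fun i k hk => (h i k hk).mono hC le_rfl
    (pow_le_pow_left₀ (hr.nonneg i) (hle i) _)
    (pow_nonneg ((hr.nonneg i).trans (hle i)) _) (hr.dist_nonneg i)⟩

variable [Coalgebra ℝ H]

/-- The operators `L l` raise the order by one. -/
theorem PairBound.cocycle (hH : IsTruncatedHopf 𝒜 N) (hp : IsGoodNorm 𝒜 p) (hr : IsScale r δ)
    {d : ℕ} {L : Fin d → H →ₗ[ℝ] H} (hL : IsCocycleFamily 𝒜 N L) (l : Fin d) {m : ℕ}
    (h : PairBound 𝒜 p m n r δ w w') :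
    PairBound 𝒜 p (m + 1) (n + 1) r δ (fun i => L l (w i)) fun i => L l (w' i) := by
  have := finite_of_isTruncatedHopf hH
  obtain ⟨κ, hκ, hbd⟩ := exists_bound_linearMap hp.definite (L l)
  obtain ⟨C, hC, h⟩ := h
  refine ⟨κ * C, by positivity, fun i j hj => ?_⟩
  cases j with
  | zero =>
    rw [proj_zero_cocycle hH hL, proj_zero_cocycle hH hL]
    exact Near.zero (map_zero p) (by positivity) (pow_nonneg (hr.nonneg i) _) (hr.dist_nonneg i)
  | succ j =>
    obtain ⟨h1, h2, h3⟩ := h i j (by omega)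
    rw [proj_cocycle hH hL, proj_cocycle hH hL, Nat.add_sub_add_right]
    refine ⟨?_, ?_, ?_⟩
    · rw [mul_assoc]
      exact (hbd _).trans (mul_le_mul_of_nonneg_left h1 hκ)
    · rw [mul_assoc]
      exact (hbd _).trans (mul_le_mul_of_nonneg_left h2 hκ)
    · rw [mul_assoc, ← map_sub]
      exact (hbd _).trans (mul_le_mul_of_nonneg_left h3 hκ)

/-- The transposes `T` of `ξ` preserve orders: the part of `T` that lowers the degree by `k` is
`O(r ^ k)`. -/
theorem PairBound.convTranspose (hH : IsTruncatedHopf 𝒜 N) (hp : IsGoodNorm 𝒜 p)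
    (hr : IsScale r δ) (hξ : FunctionalBound 𝒜 p N r δ ξ ξ')
    (h : PairBound 𝒜 p (N + 1) n r δ w w') :
    PairBound 𝒜 p (N + 1) n r δ (fun i => convTranspose (ξ i) (w i))
      fun i => convTranspose (ξ' i) (w' i) := by
  have := finite_of_isTruncatedHopf hH
  obtain ⟨κ, hκ, hT⟩ := exists_bound_convTranspose hp.definite
  obtain ⟨C, hC, h⟩ := h
  obtain ⟨D, hD, hξ⟩ := hξ
  refine ⟨∑ _a ∈ Finset.range (N + 1), 2 * κ * D * C, by positivity, fun i j hj => ?_⟩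
  have key : ∀ (η : H →ₗ[ℝ] ℝ) (x : H),
      GradedAlgebra.proj 𝒜 j (RoughControl.convTranspose η x) = ∑ k ∈ Finset.range (N + 1),
        if j ≤ k then GradedAlgebra.proj 𝒜 j (RoughControl.convTranspose
          (η ∘ₗ GradedAlgebra.proj 𝒜 (k - j)) (GradedAlgebra.proj 𝒜 k x)) else 0 := by
    intro η x
    conv_lhs => rw [← sum_proj hH x, map_sum, map_sum]
    refine Finset.sum_congr rfl fun k _ => ?_
    split_ifs with hjk
    · exact proj_convTranspose hH η (proj_mem k x) hjk
    · exact proj_convTranspose_of_lt hH η (proj_mem k x) (by omega)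
  rw [key, key]
  refine Near.sum (map_add_le_add p) (map_zero p) _ fun k hk => ?_
  have hpow := pow_nonneg (hr.nonneg i) (n - j)
  rw [Finset.mem_range] at hk
  split_ifs with hjk
  · refine (Near.bilin (fun (η : H →ₗ[ℝ] ℝ) (x : H) =>
      GradedAlgebra.proj 𝒜 j (RoughControl.convTranspose η x)) hκ
      (fun η x => (proj_le hp j _).trans (hT η x)) (dualNorm_nonneg p) (apply_nonneg p)
      (map_add_le_add p) (fun η η' x x' => ?_) (hξ i (k - j) (by omega)) (h i k hk)).mono
      (by positivity) le_rfl ?_ hpow (hr.dist_nonneg i)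
    · rw [← map_sub, ← map_add]
      congr 1
      have hsub : RoughControl.convTranspose (η - η') x
          = RoughControl.convTranspose η x - RoughControl.convTranspose η' x := by
        simp [RoughControl.convTranspose, LinearMap.rTensor_sub]
      rw [hsub, map_sub]
      abel
    · rw [← pow_add]
      exact hr.pow_le i (by omega)
  · exact Near.zero (map_zero p) (by positivity) hpow (hr.dist_nonneg i)

/-- The evaluations of `ξ` on the component of degree `k`. -/
theorem ScalarBound.apply_proj (hH : IsTruncatedHopf 𝒜 N) (hp : IsGoodNorm 𝒜 p)
    (hξ : FunctionalBound 𝒜 p N r δ ξ ξ') {k : ℕ} (hk : k ≤ N)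
    (h : PairBound 𝒜 p (N + 1) n r δ w w') :
    ScalarBound (k + (n - k)) r δ (fun i => ξ i (GradedAlgebra.proj 𝒜 k (w i)))
      fun i => ξ' i (GradedAlgebra.proj 𝒜 k (w' i)) := by
  have := finite_of_isTruncatedHopf hH
  obtain ⟨C, hC, h⟩ := h
  obtain ⟨D, hD, hξ⟩ := hξ
  refine ⟨2 * 1 * D * C, by positivity, fun i => ?_⟩
  have h1 := Near.bilin (q₂ := fun c : ℝ => |c|) (fun (η : H →ₗ[ℝ] ℝ) (x : H) => η x) zero_le_one
    (fun η x => by rw [one_mul]; exact abs_le_dualNorm_mul hp.definite η x)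
    (dualNorm_nonneg p) (apply_nonneg p)
    abs_add_le (fun η η' x x' => by simp) (hξ i k hk) (h i k (by omega))
  rw [pow_add]
  simpa [LinearMap.comp_apply, proj_of_mem (proj_mem _ _)] using h1

/-- The transpose of a character fails to be multiplicative only by terms of order `N`. -/
theorem PairBound.convTranspose_mul_sub (hH : IsTruncatedHopf 𝒜 N) (hp : IsGoodNorm 𝒜 p)
    (hr : IsScale r δ) (hξ : FunctionalBound 𝒜 p N r δ ξ ξ')
    (hm : ∀ i m n, m + n ≤ N → ∀ x ∈ 𝒜 m, ∀ y ∈ 𝒜 n, ξ i (x * y) = ξ i x * ξ i y)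
    (hm' : ∀ i m n, m + n ≤ N → ∀ x ∈ 𝒜 m, ∀ y ∈ 𝒜 n, ξ' i (x * y) = ξ' i x * ξ' i y)
    (hw : PairBound 𝒜 p (N + 1) 0 r δ w w') (hv : PairBound 𝒜 p (N + 1) 0 r δ v v') :
    PairBound 𝒜 p (N + 1) N r δ
      (fun i => RoughControl.convTranspose (ξ i) (w i) * RoughControl.convTranspose (ξ i) (v i)
        - RoughControl.convTranspose (ξ i) (w i * v i))
      fun i => RoughControl.convTranspose (ξ' i) (w' i) * RoughControl.convTranspose (ξ' i) (v' i)
        - RoughControl.convTranspose (ξ' i) (w' i * v' i) := by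
  have key : ∀ (η : H →ₗ[ℝ] ℝ)
      (_ : ∀ m n, m + n ≤ N → ∀ x ∈ 𝒜 m, ∀ y ∈ 𝒜 n, η (x * y) = η x * η y) (x y : H),
      RoughControl.convTranspose η x * RoughControl.convTranspose η y
        - RoughControl.convTranspose η (x * y)
      = ∑ k ∈ Finset.range (N + 1), ∑ l ∈ Finset.range (N + 1), if k + l ≤ N then 0 else
        RoughControl.convTranspose η (GradedAlgebra.proj 𝒜 k x)
          * RoughControl.convTranspose η (GradedAlgebra.proj 𝒜 l y) := by
    intro η hη x y
    conv_lhs => rw [← sum_proj hH x, ← sum_proj hH y]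
    rw [map_sum, map_sum, Finset.sum_mul_sum, Finset.sum_mul_sum, map_sum,
      ← Finset.sum_sub_distrib]
    refine Finset.sum_congr rfl fun k _ => ?_
    rw [map_sum, ← Finset.sum_sub_distrib]
    refine Finset.sum_congr rfl fun l _ => ?_
    split_ifs with hkl
    · rw [convTranspose_mul hH hη hkl (proj_mem k x) (proj_mem l y), sub_self]
    · have h0 : GradedAlgebra.proj 𝒜 k x * GradedAlgebra.proj 𝒜 l y ∈ 𝒜 (k + l) :=
        SetLike.mul_mem_graded (proj_mem k x) (proj_mem l y)
      rw [hH.truncated _ (by omega)] at h0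
      rw [(Submodule.mem_bot ℝ).1 h0, map_zero, sub_zero]
  simp only [fun i => key (ξ i) (hm i), fun i => key (ξ' i) (hm' i)]
  refine PairBound.sum _ fun k _ => PairBound.sum _ fun l _ => ?_
  split_ifs with hkl
  · exact PairBound.zero
  · exact (((hw.proj hr k).convTranspose hH hp hr hξ).mul hH hp hr
      ((hv.proj hr l).convTranspose hH hp hr hξ)).mono hr (by omega)

theorem PairBound.convTranspose_prod_sub (hH : IsTruncatedHopf 𝒜 N) (hp : IsGoodNorm 𝒜 p)
    (hr : IsScale r δ) (hξ : FunctionalBound 𝒜 p N r δ ξ ξ')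
    (h1 : ∀ i, ξ i 1 = 1) (h1' : ∀ i, ξ' i 1 = 1)
    (hm : ∀ i m n, m + n ≤ N → ∀ x ∈ 𝒜 m, ∀ y ∈ 𝒜 n, ξ i (x * y) = ξ i x * ξ i y)
    (hm' : ∀ i m n, m + n ≤ N → ∀ x ∈ 𝒜 m, ∀ y ∈ 𝒜 n, ξ' i (x * y) = ξ' i x * ξ' i y)
    {k : ℕ} {w w' : Fin k → I → H} (h : ∀ l, PairBound 𝒜 p (N + 1) 0 r δ (w l) (w' l)) :
    PairBound 𝒜 p (N + 1) N r δ
      (fun i => ∏ l, RoughControl.convTranspose (ξ i) (w l i)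
        - RoughControl.convTranspose (ξ i) (∏ l, w l i))
      fun i => ∏ l, RoughControl.convTranspose (ξ' i) (w' l i)
        - RoughControl.convTranspose (ξ' i) (∏ l, w' l i) := by
  induction k with
  | zero =>
    have e : ∀ η : H →ₗ[ℝ] ℝ, η 1 = 1 → RoughControl.convTranspose η (1 : H) = 1 := fun η hη => by
      simpa using convTranspose_algebraMap hH hη 1
    simp only [Finset.univ_eq_empty, Finset.prod_empty, fun i => e _ (h1 i), fun i => e _ (h1' i),
      sub_self]
    exact PairBound.zero
  | succ k ih =>
    simp only [Fin.prod_univ_succ]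
    have hprod : PairBound 𝒜 p (N + 1) 0 r δ (fun i => ∏ l : Fin k, w l.succ i)
        fun i => ∏ l : Fin k, w' l.succ i := by
      simpa using PairBound.prod hH hp hr (n := 0) fun l : Fin k => h l.succ
    have a1 := ((h 0).convTranspose hH hp hr hξ).mul hH hp hr (ih fun l => h l.succ)
    rw [zero_add] at a1
    have a2 := PairBound.convTranspose_mul_sub hH hp hr hξ hm hm' (h 0) hprod
    have := a1.add a2
    simp only [mul_sub, sub_add_sub_cancel] at this
    exact this

theorem PairBound.prod_sub_prod (hH : IsTruncatedHopf 𝒜 N) (hp : IsGoodNorm 𝒜 p)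
    (hr : IsScale r δ) {m k : ℕ} {w w' v v' : Fin k → I → H}
    (hw : ∀ l, PairBound 𝒜 p m 0 r δ (w l) (w' l))
    (hv : ∀ l, PairBound 𝒜 p m 0 r δ (v l) (v' l))
    (h : ∀ l, PairBound 𝒜 p m n r δ (fun i => w l i - v l i) fun i => w' l i - v' l i) :
    PairBound 𝒜 p m n r δ (fun i => ∏ l, w l i - ∏ l, v l i)
      fun i => ∏ l, w' l i - ∏ l, v' l i := by
  induction k with
  | zero => simpa using PairBound.zero
  | succ k ih =>
    simp only [Fin.prod_univ_succ]
    have hprod : PairBound 𝒜 p m 0 r δ (fun i => ∏ l : Fin k, w l.succ i)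
        fun i => ∏ l : Fin k, w' l.succ i := by
      simpa using PairBound.prod hH hp hr (n := 0) fun l : Fin k => hw l.succ
    have a1 := (h 0).mul hH hp hr hprod
    have a2 := (hv 0).mul hH hp hr
      (ih (fun l => hw l.succ) (fun l => hv l.succ) fun l => h l.succ)
    rw [zero_add] at a2
    rw [add_zero] at a1
    have := a1.add a2
    simp only [mul_sub, sub_mul, sub_add_sub_cancel] at this
    exact this

end Transport

/-! ### Smooth images of controlled rough paths -/

section Nonlinear

variable {H : Type*} [CommRing H] [Algebra ℝ H] {I : Type*}
  {𝒜 : ℕ → Submodule ℝ H} [GradedAlgebra 𝒜] {p : Seminorm ℝ H} {N m n o e : ℕ}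
  {r δ : I → ℝ}

/-- The mean value inequality for curves in `H`, differentiable when tested against functionals. -/
theorem exists_mean_value_bound [Module.Finite ℝ H] (hp : ∀ x, p x = 0 → x = 0) :
    ∃ K, 0 ≤ K ∧ ∀ (x dx : ℝ → H) (B : ℝ),
      (∀ θ ∈ Set.Icc (0 : ℝ) 1, ∀ ℓ : H →ₗ[ℝ] ℝ,
        HasDerivAt (fun θ => ℓ (x θ)) (ℓ (dx θ)) θ) →
      (∀ θ ∈ Set.Icc (0 : ℝ) 1, p (dx θ) ≤ B) → p (x 1 - x 0) ≤ K * B := by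
  obtain ⟨n, ℓ, v, C, hC, h1, h2⟩ := exists_bounded_coordinates hp
  refine ⟨∑ k, C * p (v k), Finset.sum_nonneg fun k _ => by positivity, fun x dx B hx hB => ?_⟩
  have h3 : ∀ k, |ℓ k (x 1 - x 0)| ≤ C * B := by
    intro k
    have := norm_image_sub_le_of_norm_deriv_le_segment_01' (f := fun θ => ℓ k (x θ))
      (f' := fun θ => ℓ k (dx θ)) (C := C * B)
      (fun θ hθ => (hx θ hθ (ℓ k)).hasDerivWithinAt)
      (fun θ hθ => (h2 k _).trans (mul_le_mul_of_nonneg_left (hB θ ⟨hθ.1, hθ.2.le⟩) hC))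
    rwa [Real.norm_eq_abs, ← map_sub] at this
  calc p (x 1 - x 0) = p (∑ k, ℓ k (x 1 - x 0) • v k) := by rw [← h1]
    _ ≤ ∑ k, p (ℓ k (x 1 - x 0) • v k) := seminorm_sum_le p _ _
    _ ≤ ∑ k, C * p (v k) * B := by
        refine Finset.sum_le_sum fun k _ => ?_
        rw [map_smul_eq_mul, Real.norm_eq_abs]
        nlinarith [mul_le_mul_of_nonneg_right (h3 k) (apply_nonneg p (v k))]
    _ = _ := by rw [Finset.sum_mul]

variable [Coalgebra ℝ H]

/-- A bound for the derivatives of two families of curves, uniform on `[0, 1]`, is a bound for their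
increments. -/
theorem PairBound.of_hasDerivAt (hH : IsTruncatedHopf 𝒜 N) (hp : IsGoodNorm 𝒜 p)
    {g g' dg dg' : I → ℝ → H}
    (hg : ∀ i, ∀ θ ∈ Set.Icc (0 : ℝ) 1, ∀ ℓ : H →ₗ[ℝ] ℝ,
      HasDerivAt (fun θ => ℓ (g i θ)) (ℓ (dg i θ)) θ)
    (hg' : ∀ i, ∀ θ ∈ Set.Icc (0 : ℝ) 1, ∀ ℓ : H →ₗ[ℝ] ℝ,
      HasDerivAt (fun θ => ℓ (g' i θ)) (ℓ (dg' i θ)) θ)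
    (h : PairBound 𝒜 p m n (fun q : I × Set.Icc (0 : ℝ) 1 => r q.1) (fun q => δ q.1)
      (fun q => dg q.1 q.2) fun q => dg' q.1 q.2) :
    PairBound 𝒜 p m n r δ (fun i => g i 1 - g i 0) fun i => g' i 1 - g' i 0 := by
  have := finite_of_isTruncatedHopf hH
  obtain ⟨K, hK, hmv⟩ := exists_mean_value_bound hp.definite
  obtain ⟨C, hC, h⟩ := h
  refine ⟨K * C, mul_nonneg hK hC, fun i j hj => ?_⟩
  have h1 := hmv (fun θ => GradedAlgebra.proj 𝒜 j (g i θ))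
    (fun θ => GradedAlgebra.proj 𝒜 j (dg i θ)) (C * r i ^ (n - j))
    (fun θ hθ ℓ => hg i θ hθ (ℓ ∘ₗ GradedAlgebra.proj 𝒜 j))
    (fun θ hθ => (h (i, ⟨θ, hθ⟩) j hj).1)
  have h2 := hmv (fun θ => GradedAlgebra.proj 𝒜 j (g' i θ))
    (fun θ => GradedAlgebra.proj 𝒜 j (dg' i θ)) (C * r i ^ (n - j))
    (fun θ hθ ℓ => hg' i θ hθ (ℓ ∘ₗ GradedAlgebra.proj 𝒜 j))
    (fun θ hθ => (h (i, ⟨θ, hθ⟩) j hj).2.1)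
  have h3 := hmv (fun θ => GradedAlgebra.proj 𝒜 j (g i θ) - GradedAlgebra.proj 𝒜 j (g' i θ))
    (fun θ => GradedAlgebra.proj 𝒜 j (dg i θ) - GradedAlgebra.proj 𝒜 j (dg' i θ))
    (C * (δ i * r i ^ (n - j))) (fun θ hθ ℓ => by
      have := (hg i θ hθ (ℓ ∘ₗ GradedAlgebra.proj 𝒜 j)).sub
        (hg' i θ hθ (ℓ ∘ₗ GradedAlgebra.proj 𝒜 j))
      simp only [map_sub]
      exact this)
    (fun θ hθ => (h (i, ⟨θ, hθ⟩) j hj).2.2)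
  refine ⟨?_, ?_, ?_⟩
  · rw [map_sub, mul_assoc]
    exact h1
  · rw [map_sub, mul_assoc]
    exact h2
  · beta_reduce
    rw [map_sub (GradedAlgebra.proj 𝒜 j), map_sub (GradedAlgebra.proj 𝒜 j), mul_assoc,
      sub_sub_sub_comm]
    exact h3

variable {φ φ' : I → (Fin e → ℝ) → Fin e → ℝ} {b b' h h' : I → Fin e → ℝ}
  {w w' v v' : I → Fin e → H}

theorem PairBound.taylorTerm (hH : IsTruncatedHopf 𝒜 N) (hp : IsGoodNorm 𝒜 p) (hr : IsScale r δ)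
    (a : Fin e)
    (hD : ∀ ι : Fin n → Fin e, ScalarBound 0 r δ (fun i => partialDeriv (φ i) (b i) ι a)
      fun i => partialDeriv (φ' i) (b' i) ι a)
    (hw : ∀ c, PairBound 𝒜 p m o r δ (fun i => w i c) fun i => w' i c) :
    PairBound 𝒜 p m (n * o) r δ (fun i => taylorTerm n (φ i) (b i) (w i) a)
      fun i => taylorTerm n (φ' i) (b' i) (w' i) a := by
  refine PairBound.const_smul hH hp hr _ (PairBound.sum _ fun ι _ => ?_)
  have := PairBound.smul hH hp hr (hD ι) (PairBound.prod hH hp hr fun k => hw (ι k))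
  rwa [zero_add] at this

theorem PairBound.taylorDerivTerm (hH : IsTruncatedHopf 𝒜 N) (hp : IsGoodNorm 𝒜 p)
    (hr : IsScale r δ) (a : Fin e)
    (hD : ∀ ι : Fin (n + 1) → Fin e, ScalarBound 0 r δ (fun i => partialDeriv (φ i) (b i) ι a)
      fun i => partialDeriv (φ' i) (b' i) ι a)
    (hh : ∀ c, ScalarBound 1 r δ (fun i => h i c) fun i => h' i c)
    (hw : ∀ c, PairBound 𝒜 p m 1 r δ (fun i => w i c) fun i => w' i c) :
    PairBound 𝒜 p m (n + 1) r δ (fun i => taylorDerivTerm n (φ i) (b i) (h i) (w i) a)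
      fun i => taylorDerivTerm n (φ' i) (b' i) (h' i) (w' i) a := by
  refine PairBound.const_smul hH hp hr _
    (PairBound.sum _ fun ι _ => PairBound.sum _ fun c _ => ?_)
  have := PairBound.smul hH hp hr ((hh c).mul (hD (Fin.cons c ι)))
    (PairBound.prod hH hp hr fun k => hw (ι k))
  rwa [show 1 + 0 + n * 1 = n + 1 by ring] at this

theorem PairBound.smoothImage_of_bound (hH : IsTruncatedHopf 𝒜 N) (hp : IsGoodNorm 𝒜 p)
    (hr : IsScale r δ) (a : Fin e)
    (hD : ∀ n ≤ N, ∀ ι : Fin n → Fin e, ScalarBound 0 r δ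
      (fun i => partialDeriv (φ i) (base (w i)) ι a)
      fun i => partialDeriv (φ' i) (base (w' i)) ι a)
    (hw : ∀ c, PairBound 𝒜 p m 0 r δ (fun i => w i c - algebraMap ℝ H (base (w i) c))
      fun i => w' i c - algebraMap ℝ H (base (w' i) c)) :
    PairBound 𝒜 p m 0 r δ (fun i => smoothImage N (φ i) (w i) a)
      fun i => smoothImage N (φ' i) (w' i) a := by
  simp only [smoothImage_eq_sum_taylorTerm]
  refine PairBound.sum _ fun n hn => ?_
  exact PairBound.taylorTerm hH hp hr a
    (fun ι => hD n (Nat.lt_succ_iff.1 (Finset.mem_range.1 hn)) ι) hw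

theorem PairBound.taylorTerm_sub (hH : IsTruncatedHopf 𝒜 N) (hp : IsGoodNorm 𝒜 p)
    (hr : IsScale r δ) (a : Fin e)
    (hD : ∀ ι : Fin n → Fin e, ScalarBound 0 r δ (fun i => partialDeriv (φ i) (b i) ι a)
      fun i => partialDeriv (φ' i) (b' i) ι a)
    (hw : ∀ c, PairBound 𝒜 p m 0 r δ (fun i => w i c) fun i => w' i c)
    (hv : ∀ c, PairBound 𝒜 p m 0 r δ (fun i => v i c) fun i => v' i c)
    (hwv : ∀ c, PairBound 𝒜 p m o r δ (fun i => w i c - v i c) fun i => w' i c - v' i c) :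
    PairBound 𝒜 p m o r δ
      (fun i => RoughControl.taylorTerm n (φ i) (b i) (w i) a
        - RoughControl.taylorTerm n (φ i) (b i) (v i) a)
      fun i => RoughControl.taylorTerm n (φ' i) (b' i) (w' i) a
        - RoughControl.taylorTerm n (φ' i) (b' i) (v' i) a := by
  simp only [RoughControl.taylorTerm, ← smul_sub, ← Finset.sum_sub_distrib]
  refine PairBound.const_smul hH hp hr _ (PairBound.sum _ fun ι _ => ?_)
  have := PairBound.smul hH hp hr (hD ι) (PairBound.prod_sub_prod hH hp hr
    (fun k => hw (ι k)) (fun k => hv (ι k)) fun k => hwv (ι k))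
  rwa [zero_add] at this

variable {ξ ξ' : I → H →ₗ[ℝ] ℝ} {z z' ζ ζ' : I → Fin e → H}

/-- The family of transposes of characters is multiplicative up to order `N`, hence commutes with
Taylor polynomials up to order `N`. -/
theorem PairBound.taylorTerm_convTranspose_sub (hH : IsTruncatedHopf 𝒜 N) (hp : IsGoodNorm 𝒜 p)
    (hr : IsScale r δ) (hξ : FunctionalBound 𝒜 p N r δ ξ ξ')
    (h1 : ∀ i, ξ i 1 = 1) (h1' : ∀ i, ξ' i 1 = 1)
    (hm : ∀ i m n, m + n ≤ N → ∀ x ∈ 𝒜 m, ∀ y ∈ 𝒜 n, ξ i (x * y) = ξ i x * ξ i y)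
    (hm' : ∀ i m n, m + n ≤ N → ∀ x ∈ 𝒜 m, ∀ y ∈ 𝒜 n, ξ' i (x * y) = ξ' i x * ξ' i y)
    (a : Fin e)
    (hD : ∀ ι : Fin n → Fin e, ScalarBound 0 r δ (fun i => partialDeriv (φ i) (b i) ι a)
      fun i => partialDeriv (φ' i) (b' i) ι a)
    (hw : ∀ c, PairBound 𝒜 p (N + 1) 0 r δ (fun i => w i c) fun i => w' i c) :
    PairBound 𝒜 p (N + 1) N r δ
      (fun i => RoughControl.taylorTerm n (φ i) (b i)
          (fun c => RoughControl.convTranspose (ξ i) (w i c)) a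
        - RoughControl.convTranspose (ξ i) (RoughControl.taylorTerm n (φ i) (b i) (w i) a))
      fun i => RoughControl.taylorTerm n (φ' i) (b' i)
          (fun c => RoughControl.convTranspose (ξ' i) (w' i c)) a
        - RoughControl.convTranspose (ξ' i)
          (RoughControl.taylorTerm n (φ' i) (b' i) (w' i) a) := by
  simp only [RoughControl.taylorTerm, map_smul, map_sum, ← smul_sub, ← Finset.sum_sub_distrib]
  refine PairBound.const_smul hH hp hr _ (PairBound.sum _ fun ι _ => ?_)
  have := PairBound.smul hH hp hr (hD ι) (PairBound.convTranspose_prod_sub hH hp hr hξ h1 h1' hm hm'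
    fun k => hw (ι k))
  rwa [zero_add] at this

/-- The smooth image of a controlled rough path is controlled: with `b`, `β` the scalar parts of
`z`, `ζ`, the difference `φ(ζ) - T φ(z)` is split into the change of the base point of the Taylor
polynomial from `β` to `b`, the change of its argument from `ζ` to `T z`, and the defect of
multiplicativity of `T`. -/
theorem PairBound.smoothImage_sub (hN : 1 ≤ N) (hH : IsTruncatedHopf 𝒜 N) (hp : IsGoodNorm 𝒜 p)
    (hr : IsScale r δ) (hξ : FunctionalBound 𝒜 p N r δ ξ ξ')
    (h1 : ∀ i, ξ i 1 = 1) (h1' : ∀ i, ξ' i 1 = 1)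
    (hm : ∀ i m n, m + n ≤ N → ∀ x ∈ 𝒜 m, ∀ y ∈ 𝒜 n, ξ i (x * y) = ξ i x * ξ i y)
    (hm' : ∀ i m n, m + n ≤ N → ∀ x ∈ 𝒜 m, ∀ y ∈ 𝒜 n, ξ' i (x * y) = ξ' i x * ξ' i y)
    (hφ : ∀ i, ContDiff ℝ (N + 1 : ℕ) (φ i)) (hφ' : ∀ i, ContDiff ℝ (N + 1 : ℕ) (φ' i))
    (hz : ∀ c, PairBound 𝒜 p (N + 1) 0 r δ (fun i => z i c) fun i => z' i c)
    (hζ : ∀ c, PairBound 𝒜 p (N + 1) 0 r δ (fun i => ζ i c) fun i => ζ' i c)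
    (hR : ∀ c, PairBound 𝒜 p (N + 1) N r δ
      (fun i => ζ i c - RoughControl.convTranspose (ξ i) (z i c))
      fun i => ζ' i c - RoughControl.convTranspose (ξ' i) (z' i c))
    (hh : ∀ c, ScalarBound 1 r δ (fun i => base (ζ i) c - base (z i) c)
      fun i => base (ζ' i) c - base (z' i) c)
    (hD : ∀ n ≤ N, ∀ (ι : Fin n → Fin e) (a : Fin e),
      ScalarBound 0 (fun q : I × Set.Icc (0 : ℝ) 1 => r q.1) (fun q => δ q.1)
        (fun q => partialDeriv (φ q.1)
          (base (z q.1) + (q.2 : ℝ) • (base (ζ q.1) - base (z q.1))) ι a)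
        fun q => partialDeriv (φ' q.1)
          (base (z' q.1) + (q.2 : ℝ) • (base (ζ' q.1) - base (z' q.1))) ι a)
    (a : Fin e) :
    PairBound 𝒜 p (N + 1) N r δ
      (fun i => smoothImage N (φ i) (ζ i) a
        - RoughControl.convTranspose (ξ i) (smoothImage N (φ i) (z i) a))
      fun i => smoothImage N (φ' i) (ζ' i) a
        - RoughControl.convTranspose (ξ' i) (smoothImage N (φ' i) (z' i) a) := by
  obtain ⟨M, rfl⟩ : ∃ M, N = M + 1 := ⟨N - 1, by omega⟩
  -- the derivatives at the two base points
  have hD0 : ∀ n ≤ M + 1, ∀ (ι : Fin n → Fin e) (a : Fin e), ScalarBound 0 r δ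
      (fun i => partialDeriv (φ i) (base (z i)) ι a)
      fun i => partialDeriv (φ' i) (base (z' i)) ι a := by
    intro n hn ι a
    have := (hD n hn ι a).comp fun i : I => (i, ⟨0, by simp⟩)
    simpa using this
  have hD1 : ∀ n ≤ M + 1, ∀ (ι : Fin n → Fin e) (a : Fin e), ScalarBound 0 r δ
      (fun i => partialDeriv (φ i) (base (ζ i)) ι a)
      fun i => partialDeriv (φ' i) (base (ζ' i)) ι a := by
    intro n hn ι a
    have := (hD n hn ι a).comp fun i : I => (i, ⟨1, by simp⟩)
    simpa using this
  -- orders of the arguments of the Taylor polynomials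
  have hζβ : ∀ c, PairBound 𝒜 p (M + 1 + 1) 1 r δ
      (fun i => ζ i c - algebraMap ℝ H (base (ζ i) c))
      fun i => ζ' i c - algebraMap ℝ H (base (ζ' i) c) := fun c => (hζ c).sub_counit hH hr
  have hW : ∀ c, PairBound 𝒜 p (M + 1 + 1) 1 (fun q : I × Set.Icc (0 : ℝ) 1 => r q.1)
      (fun q => δ q.1)
      (fun q => ζ q.1 c - algebraMap ℝ H (base (z q.1) c
        + (q.2 : ℝ) * (base (ζ q.1) - base (z q.1)) c))
      fun q => ζ' q.1 c - algebraMap ℝ H (base (z' q.1) c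
        + (q.2 : ℝ) * (base (ζ' q.1) - base (z' q.1)) c) := by
    intro c
    have hr1 := hr.comp (Prod.fst : I × Set.Icc (0 : ℝ) 1 → I)
    have hθ : ScalarBound 0 (fun q : I × Set.Icc (0 : ℝ) 1 => r q.1) (fun q => δ q.1)
        (fun q => 1 - (q.2 : ℝ)) fun q => 1 - (q.2 : ℝ) := by
      refine ⟨1, zero_le_one, fun q => ?_⟩
      have h2 := q.2.2
      have h3 := hr1.dist_nonneg q
      simp only [Near, pow_zero, mul_one, sub_self, abs_zero, one_mul]
      have : |1 - (q.2 : ℝ)| ≤ 1 := by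
        rw [abs_le]
        constructor <;> linarith [h2.1, h2.2]
      exact ⟨this, this, h3⟩
    have h2 := hθ.mul ((hh c).comp (Prod.fst : I × Set.Icc (0 : ℝ) 1 → I))
    rw [zero_add] at h2
    have h3 := ((hζβ c).comp (Prod.fst : I × Set.Icc (0 : ℝ) 1 → I)).add
      (PairBound.of_scalar hr1 h2)
    have e : ∀ (x : H) (s t θ : ℝ), x - algebraMap ℝ H s + algebraMap ℝ H ((1 - θ) * (s - t))
        = x - algebraMap ℝ H (t + θ * (s - t)) := by
      intro x s t θ
      rw [sub_add, ← map_sub]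
      congr 2
      ring
    simp only [e] at h3
    exact h3
  have hζb : ∀ c, PairBound 𝒜 p (M + 1 + 1) 1 r δ
      (fun i => ζ i c - algebraMap ℝ H (base (z i) c))
      fun i => ζ' i c - algebraMap ℝ H (base (z' i) c) := by
    intro c
    have := (hW c).comp fun i : I => (i, ⟨0, by simp⟩)
    simpa using this
  have hzb : ∀ c, PairBound 𝒜 p (M + 1 + 1) 0 r δ
      (fun i => z i c - algebraMap ℝ H (base (z i) c))
      fun i => z' i c - algebraMap ℝ H (base (z' i) c) := fun c =>
    ((hz c).sub_counit hH hr).mono hr (Nat.zero_le _)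
  have hTzb : ∀ c, PairBound 𝒜 p (M + 1 + 1) 0 r δ
      (fun i => RoughControl.convTranspose (ξ i) (z i c - algebraMap ℝ H (base (z i) c)))
      fun i => RoughControl.convTranspose (ξ' i) (z' i c - algebraMap ℝ H (base (z' i) c)) :=
    fun c => (hzb c).convTranspose hH hp hr hξ
  have hTsub : ∀ (η : H →ₗ[ℝ] ℝ) (_ : η 1 = 1) (x : H) (s : ℝ),
      RoughControl.convTranspose η (x - algebraMap ℝ H s)
        = RoughControl.convTranspose η x - algebraMap ℝ H s := by
    intro η hη x s
    rw [map_sub, convTranspose_algebraMap hH hη]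
  -- change of base point in the terms of degree at most `N - 1`
  have S1 : PairBound 𝒜 p (M + 1 + 1) (M + 1) r δ _ _ :=
    PairBound.of_hasDerivAt (r := r) (δ := δ) hH hp
      (g := fun i θ => ∑ n ∈ Finset.range (M + 1), RoughControl.taylorTerm n (φ i)
        (base (z i) + θ • (base (ζ i) - base (z i)))
        (fun c => ζ i c - algebraMap ℝ H (base (z i) c + θ * (base (ζ i) - base (z i)) c)) a)
      (g' := fun i θ => ∑ n ∈ Finset.range (M + 1), RoughControl.taylorTerm n (φ' i)
        (base (z' i) + θ • (base (ζ' i) - base (z' i)))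
        (fun c => ζ' i c - algebraMap ℝ H (base (z' i) c + θ * (base (ζ' i) - base (z' i)) c)) a)
      (fun i θ _ ℓ => hasDerivAt_taylor _ _ _ a θ ℓ
        ((hφ i).of_le (by exact_mod_cast Nat.le_succ _)))
      (fun i θ _ ℓ => hasDerivAt_taylor _ _ _ a θ ℓ
        ((hφ' i).of_le (by exact_mod_cast Nat.le_succ _)))
      (PairBound.taylorDerivTerm hH hp (hr.comp Prod.fst) a (fun ι => hD (M + 1) le_rfl ι a)
        (fun c => (hh c).comp Prod.fst) hW)
  -- The change of base point in the terms of degree `N`: both terms are of order `N`, and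
  -- differentiating here would require the distance of the derivatives of order `N + 1`.
  have S2 := PairBound.taylorTerm hH hp hr a (fun ι => hD1 (M + 1) le_rfl ι a) hζβ
  have S3 := PairBound.taylorTerm hH hp hr a (fun ι => hD0 (M + 1) le_rfl ι a) hζb
  rw [mul_one] at S2 S3
  -- change of argument
  have S4 : PairBound 𝒜 p (M + 1 + 1) (M + 1) r δ _ _ :=
    PairBound.sum (Finset.range (M + 1 + 1)) fun n hn =>
      PairBound.taylorTerm_sub hH hp hr a
        (fun ι : Fin n → Fin e => hD0 n (by have := Finset.mem_range.1 hn; omega) ι a)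
        (fun c => (hζb c).mono hr (Nat.zero_le _)) hTzb (fun c => by
          have := hR c
          simpa only [fun i => hTsub _ (h1 i), fun i => hTsub _ (h1' i), sub_sub_sub_cancel_right]
            using this)
  -- defect of multiplicativity
  have S5 : PairBound 𝒜 p (M + 1 + 1) (M + 1) r δ _ _ :=
    PairBound.sum (Finset.range (M + 1 + 1)) fun n hn =>
      PairBound.taylorTerm_convTranspose_sub hH hp hr hξ h1 h1' hm hm' a
        (fun ι : Fin n → Fin e => hD0 n (by have := Finset.mem_range.1 hn; omega) ι a) hzb
  have key : ∀ (η : H →ₗ[ℝ] ℝ) (f : (Fin e → ℝ) → Fin e → ℝ) (x y : Fin e → H),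
      smoothImage (M + 1) f y a - RoughControl.convTranspose η (smoothImage (M + 1) f x a)
      = ((((∑ n ∈ Finset.range (M + 1), RoughControl.taylorTerm n f
            (base x + (1 : ℝ) • (base y - base x))
            (fun c => y c - algebraMap ℝ H (base x c + 1 * (base y - base x) c)) a)
          - ∑ n ∈ Finset.range (M + 1), RoughControl.taylorTerm n f
            (base x + (0 : ℝ) • (base y - base x))
            (fun c => y c - algebraMap ℝ H (base x c + 0 * (base y - base x) c)) a)
          + (RoughControl.taylorTerm (M + 1) f (base y)
              (fun c => y c - algebraMap ℝ H (base y c)) a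
            - RoughControl.taylorTerm (M + 1) f (base x)
              (fun c => y c - algebraMap ℝ H (base x c)) a))
          + ∑ n ∈ Finset.range (M + 1 + 1), (RoughControl.taylorTerm n f (base x)
              (fun c => y c - algebraMap ℝ H (base x c)) a
            - RoughControl.taylorTerm n f (base x) (fun c =>
                RoughControl.convTranspose η (x c - algebraMap ℝ H (base x c))) a))
        + ∑ n ∈ Finset.range (M + 1 + 1), (RoughControl.taylorTerm n f (base x) (fun c =>
                RoughControl.convTranspose η (x c - algebraMap ℝ H (base x c))) a
            - RoughControl.convTranspose η (RoughControl.taylorTerm n f (base x) (fun c =>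
                x c - algebraMap ℝ H (base x c)) a)) := by
    intro η f x y
    rw [smoothImage_eq_sum_taylorTerm, smoothImage_eq_sum_taylorTerm, map_sum]
    simp only [Finset.sum_sub_distrib, one_smul, zero_smul, add_zero, zero_mul, one_mul,
      Pi.sub_apply, add_sub_cancel]
    rw [Finset.sum_range_succ _ (M + 1), Finset.sum_range_succ _ (M + 1)]
    rw [Finset.sum_range_succ _ (M + 1), Finset.sum_range_succ _ (M + 1)]
    abel
  simp only [key]
  exact ((S1.add (S2.sub hH hp hr S3)).add S4).add S5

end Nonlinear

/-! ### Best constants are attained -/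

section BestConstants

/-- The infimum of the admissible constants is admissible, if there is one at all; otherwise the
infimum is the junk value zero. -/
theorem le_sInf_mul {κ : Type*} {f g : κ → ℝ} (hg : ∀ k, 0 ≤ g k)
    (hne : ∃ C, ∀ k, f k ≤ C * g k) (k : κ) :
    f k ≤ sInf {C : ℝ | 0 ≤ C ∧ ∀ k, f k ≤ C * g k} * g k := by
  obtain ⟨C, hC⟩ := hne
  have hmem : max C 0 ∈ {C : ℝ | 0 ≤ C ∧ ∀ k, f k ≤ C * g k} :=
    ⟨le_max_right _ _, fun k =>
      (hC k).trans (mul_le_mul_of_nonneg_right (le_max_left _ _) (hg k))⟩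
  rcases (hg k).eq_or_lt with h0 | h0
  · have := hC k
    rw [← h0, mul_zero] at this ⊢
    exact this
  · rw [← div_le_iff₀ h0]
    refine le_csInf ⟨_, hmem⟩ fun D hD => ?_
    rw [div_le_iff₀ h0]
    exact hD.2 k

variable {H : Type*} [CommRing H] [Algebra ℝ H] {𝒜 : ℕ → Submodule ℝ H} [GradedAlgebra 𝒜]
  {p : Seminorm ℝ H} {N : ℕ} {γ : ℝ} {ω : ℝ → ℝ → ℝ} {T T' : ℝ}

/-- The pairs of times and degrees over which the norms are defined. -/
def TimeDegree (N : ℕ) (T : ℝ) : Type :=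
  {q : ℕ × ℝ × ℝ // q.1 ≤ N ∧ 0 ≤ q.2.1 ∧ q.2.1 ≤ q.2.2 ∧ q.2.2 ≤ T}

theorem roughBound_roughNorm (hω : IsRightContControl ω T) (hT' : T' ≤ T)
    {X : ℝ → ℝ → H →ₗ[ℝ] ℝ} (h : ∃ C, RoughBound 𝒜 p N γ ω T' X C) :
    RoughBound 𝒜 p N γ ω T' X (roughNorm 𝒜 p N γ ω T' X) := by
  intro j hj s t hs hst ht
  obtain ⟨C, hC⟩ := h
  have key := le_sInf_mul (κ := TimeDegree N T')
    (f := fun q => dualNorm p (X q.1.2.1 q.1.2.2 ∘ₗ GradedAlgebra.proj 𝒜 q.1.1))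
    (g := fun q => ω q.1.2.1 q.1.2.2 ^ ((q.1.1 : ℝ) * γ))
    (fun q => Real.rpow_nonneg (hω.nonneg _ _ q.2.2.1 q.2.2.2.1 (q.2.2.2.2.trans hT')) _)
    ⟨C, fun q => hC _ q.2.1 _ _ q.2.2.1 q.2.2.2.1 q.2.2.2.2⟩ ⟨(j, s, t), hj, hs, hst, ht⟩
  refine key.trans_eq (congrArg (· * _) (congrArg sInf (Set.ext fun D => ?_)))
  exact and_congr_right fun _ => ⟨fun h j hj s t hs hst ht => h ⟨(j, s, t), hj, hs, hst, ht⟩,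
    fun h q => h _ q.2.1 _ _ q.2.2.1 q.2.2.2.1 q.2.2.2.2⟩

theorem remBound_remNorm (hω : IsRightContControl ω T) (hT' : T' ≤ T) {e : ℕ}
    {R : ℝ → ℝ → Fin e → H} (h : ∃ C, RemBound 𝒜 p N γ ω T' R C) :
    RemBound 𝒜 p N γ ω T' R (remNorm 𝒜 p N γ ω T' R) := by
  intro j hj s t hs hst ht
  obtain ⟨C, hC⟩ := h
  have key := le_sInf_mul (κ := TimeDegree N T')
    (f := fun q => vecNorm p (fun a => GradedAlgebra.proj 𝒜 q.1.1 (R q.1.2.1 q.1.2.2 a)))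
    (g := fun q => ω q.1.2.1 q.1.2.2 ^ (((N : ℝ) - (q.1.1 : ℝ)) * γ))
    (fun q => Real.rpow_nonneg (hω.nonneg _ _ q.2.2.1 q.2.2.2.1 (q.2.2.2.2.trans hT')) _)
    ⟨C, fun q => hC _ q.2.1 _ _ q.2.2.1 q.2.2.2.1 q.2.2.2.2⟩ ⟨(j, s, t), hj, hs, hst, ht⟩
  refine key.trans_eq (congrArg (· * _) (congrArg sInf (Set.ext fun D => ?_)))
  exact and_congr_right fun _ => ⟨fun h j hj s t hs hst ht => h ⟨(j, s, t), hj, hs, hst, ht⟩,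
    fun h q => h _ q.2.1 _ _ q.2.2.1 q.2.2.2.1 q.2.2.2.2⟩

theorem roughNorm_nonneg (X : ℝ → ℝ → H →ₗ[ℝ] ℝ) : 0 ≤ roughNorm 𝒜 p N γ ω T' X :=
  Real.sInf_nonneg fun _ h => h.1

theorem remNorm_nonneg {e : ℕ} (R : ℝ → ℝ → Fin e → H) : 0 ≤ remNorm 𝒜 p N γ ω T' R :=
  Real.sInf_nonneg fun _ h => h.1

theorem remNorm_le {e : ℕ} {R : ℝ → ℝ → Fin e → H} {C : ℝ} (hC : 0 ≤ C)
    (h : RemBound 𝒜 p N γ ω T' R C) : remNorm 𝒜 p N γ ω T' R ≤ C :=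
  csInf_le ⟨0, fun _ h => h.1⟩ ⟨hC, h⟩

theorem exists_roughBound_sub [Module.Finite ℝ H] (hp : ∀ x, p x = 0 → x = 0)
    {X X' : ℝ → ℝ → H →ₗ[ℝ] ℝ} (h : ∃ C, RoughBound 𝒜 p N γ ω T' X C)
    (h' : ∃ C, RoughBound 𝒜 p N γ ω T' X' C) : ∃ C, RoughBound 𝒜 p N γ ω T' (X - X') C := by
  obtain ⟨C, hC⟩ := h
  obtain ⟨D, hD⟩ := h'
  refine ⟨C + D, fun j hj s t hs hst ht => ?_⟩
  rw [add_mul, Pi.sub_apply, Pi.sub_apply, LinearMap.sub_comp]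
  exact (dualNorm_sub_le hp _ _).trans (add_le_add (hC j hj s t hs hst ht) (hD j hj s t hs hst ht))

theorem exists_remBound_sub (hω : IsRightContControl ω T) (hT' : T' ≤ T) {e : ℕ}
    {R R' : ℝ → ℝ → Fin e → H} (h : ∃ C, RemBound 𝒜 p N γ ω T' R C)
    (h' : ∃ C, RemBound 𝒜 p N γ ω T' R' C) : ∃ C, RemBound 𝒜 p N γ ω T' (R - R') C := by
  have hC := remBound_remNorm hω hT' h
  have hD := remBound_remNorm hω hT' h'
  refine ⟨remNorm 𝒜 p N γ ω T' R + remNorm 𝒜 p N γ ω T' R', fun j hj s t hs hst ht => ?_⟩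
  have hpos := Real.rpow_nonneg (hω.nonneg s t hs hst (ht.trans hT')) (((N : ℝ) - (j : ℝ)) * γ)
  refine vecNorm_le (mul_nonneg (add_nonneg (remNorm_nonneg _) (remNorm_nonneg _)) hpos)
    fun a => ?_
  rw [add_mul, Pi.sub_apply, Pi.sub_apply, Pi.sub_apply, map_sub]
  refine (map_sub_le_add p _ _).trans (add_le_add ?_ ?_)
  · exact (le_vecNorm p (fun a => GradedAlgebra.proj 𝒜 j (R s t a)) a).trans
      (hC j hj s t hs hst ht)
  · exact (le_vecNorm p (fun a => GradedAlgebra.proj 𝒜 j (R' s t a)) a).trans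
      (hD j hj s t hs hst ht)

end BestConstants

section DerivNorm

variable {e m n : ℕ} {K : Set (Fin e → ℝ)} {φ φ' : (Fin e → ℝ) → Fin e → ℝ}

theorem derivNorm_nonneg (m : ℕ) (K : Set (Fin e → ℝ)) (φ : (Fin e → ℝ) → Fin e → ℝ) :
    0 ≤ derivNorm m K φ :=
  Finset.sum_nonneg fun _ _ => Real.iSup_nonneg fun _ => norm_nonneg _

theorem norm_iteratedFDeriv_le_derivNorm (hK : Bornology.IsBounded K) (hφ : ContDiff ℝ (m : ℕ) φ)
    (hn : n ≤ m) {x : Fin e → ℝ} (hx : x ∈ K) :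
    ‖iteratedFDeriv ℝ n φ x‖ ≤ derivNorm m K φ := by
  have hcont : Continuous fun x => ‖iteratedFDeriv ℝ n φ x‖ :=
    (hφ.continuous_iteratedFDeriv (by exact_mod_cast hn)).norm
  have hbdd : BddAbove (Set.range fun z : K => ‖iteratedFDeriv ℝ n φ z‖) := by
    refine ((hK.isCompact_closure.image hcont).bddAbove).mono ?_
    rintro _ ⟨z, rfl⟩
    exact ⟨z, subset_closure z.2, rfl⟩
  refine (le_ciSup hbdd ⟨x, hx⟩).trans ?_
  exact Finset.single_le_sum (f := fun j => ⨆ z : K, ‖iteratedFDeriv ℝ j φ z‖)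
    (fun j _ => Real.iSup_nonneg fun _ => norm_nonneg _) (Finset.mem_range.2 (by omega))

theorem abs_apply_single_le (D : ContinuousMultilinearMap ℝ (fun _ : Fin n => Fin e → ℝ)
    (Fin e → ℝ)) (ι : Fin n → Fin e) (a : Fin e) :
    |D (fun k => Pi.single (ι k) 1) a| ≤ ‖D‖ := by
  have h1 : |D (fun k => Pi.single (ι k) 1) a| ≤ ‖D (fun k => Pi.single (ι k) (1 : ℝ))‖ :=
    norm_le_pi_norm (D fun k => Pi.single (ι k) (1 : ℝ)) a
  refine h1.trans ((D.le_opNorm _).trans ?_)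
  have : ∏ k, ‖(Pi.single (ι k) (1 : ℝ) : Fin e → ℝ)‖ ≤ 1 :=
    Finset.prod_le_one (fun _ _ => norm_nonneg _) fun k _ => by
      rw [Pi.norm_single, norm_one]
  exact mul_le_of_le_one_right (norm_nonneg _) this

theorem abs_partialDeriv_le (hK : Bornology.IsBounded K) (hφ : ContDiff ℝ (m : ℕ) φ)
    (hn : n ≤ m) {x : Fin e → ℝ} (hx : x ∈ K) (ι : Fin n → Fin e) (a : Fin e) :
    |partialDeriv φ x ι a| ≤ derivNorm m K φ :=
  (abs_apply_single_le _ ι a).trans (norm_iteratedFDeriv_le_derivNorm hK hφ hn hx)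

/-- The partial derivatives of `φ` at `x` and of `φ'` at `x'` are compared through those of `φ`
at `x'`. -/
theorem abs_partialDeriv_sub_le (hK : Bornology.IsBounded K) (hconv : Convex ℝ K)
    (hφ : ContDiff ℝ (m + 1 : ℕ) φ) (hφ' : ContDiff ℝ (m + 1 : ℕ) φ') (hn : n ≤ m)
    {x x' : Fin e → ℝ} (hx : x ∈ K) (hx' : x' ∈ K) (ι : Fin n → Fin e) (a : Fin e) :
    |partialDeriv φ x ι a - partialDeriv φ' x' ι a|
      ≤ derivNorm (m + 1) K φ * ‖x - x'‖ + derivNorm m K (φ - φ') := by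
  have hφm : ContDiff ℝ (m : ℕ) φ := hφ.of_le (by exact_mod_cast Nat.le_succ _)
  have hφm' : ContDiff ℝ (m : ℕ) φ' := hφ'.of_le (by exact_mod_cast Nat.le_succ _)
  have hdiff : Differentiable ℝ (iteratedFDeriv ℝ n φ) :=
    hφ.differentiable_iteratedFDeriv (by exact_mod_cast Nat.lt_succ_of_le hn)
  have h1 : ‖iteratedFDeriv ℝ n φ x - iteratedFDeriv ℝ n φ x'‖
      ≤ derivNorm (m + 1) K φ * ‖x - x'‖ := by
    refine hconv.norm_image_sub_le_of_norm_fderiv_le (fun y _ => hdiff y) (fun y hy => ?_) hx' hx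
    rw [norm_fderiv_iteratedFDeriv]
    exact norm_iteratedFDeriv_le_derivNorm hK hφ (by omega) hy
  have h2 : ‖iteratedFDeriv ℝ n φ x' - iteratedFDeriv ℝ n φ' x'‖ ≤ derivNorm m K (φ - φ') := by
    have e1 : iteratedFDeriv ℝ n (φ - φ') x'
        = iteratedFDeriv ℝ n φ x' - iteratedFDeriv ℝ n φ' x' :=
      iteratedFDeriv_sub_apply
        ((hφm.of_le (by exact_mod_cast hn)).contDiffAt)
        ((hφm'.of_le (by exact_mod_cast hn)).contDiffAt)
    rw [← e1]
    exact norm_iteratedFDeriv_le_derivNorm hK (hφm.sub hφm') hn hx'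
  have h3 : partialDeriv φ x ι a - partialDeriv φ' x' ι a
      = ((iteratedFDeriv ℝ n φ x - iteratedFDeriv ℝ n φ x')
          + (iteratedFDeriv ℝ n φ x' - iteratedFDeriv ℝ n φ' x'))
        (fun k => Pi.single (ι k) 1) a := by
    simp [partialDeriv]
  rw [h3]
  exact (abs_apply_single_le _ ι a).trans ((norm_add_le _ _).trans (add_le_add h1 h2))

end DerivNorm

section Control

variable {ω : ℝ → ℝ → ℝ} {T : ℝ}

theorem IsRightContControl.mono (hω : IsRightContControl ω T) {s s' t t' : ℝ} (hs : 0 ≤ s')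
    (h1 : s' ≤ s) (h2 : s ≤ t) (h3 : t ≤ t') (ht : t' ≤ T) : ω s t ≤ ω s' t' := by
  have a1 := hω.superadd s' s t' hs h1 (h2.trans h3) ht
  have a2 := hω.superadd s t t' (hs.trans h1) h2 h3 ht
  have a3 := hω.nonneg s' s hs h1 ((h2.trans h3).trans ht)
  have a4 := hω.nonneg t t' ((hs.trans h1).trans h2) h3 ht
  linarith

/-- Right continuity at `0` gives short intervals on which the control is small. -/
theorem IsRightContControl.exists_le (hω : IsRightContControl ω T) (hT : 0 < T) {ε : ℝ}
    (hε : 0 < ε) : ∃ T₀, 0 < T₀ ∧ T₀ ≤ T ∧ ω 0 T₀ ≤ ε := by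
  have h := hω.rightCont 0 0 le_rfl le_rfl hT
  rw [hω.diag 0 le_rfl hT.le] at h
  have h1 : ∀ᶠ t in 𝓝[>] (0 : ℝ), ω 0 t < ε := h.eventually (gt_mem_nhds hε)
  have h2 : ∀ᶠ t in 𝓝[>] (0 : ℝ), t ∈ Set.Ioc 0 T := Ioc_mem_nhdsGT hT
  obtain ⟨t, ht1, ht2⟩ := (h1.and h2).exists
  exact ⟨t, ht2.1, ht2.2, ht1.le⟩

theorem rpow_mul_eq_pow {x : ℝ} (hx : 0 ≤ x) (γ : ℝ) (k : ℕ) :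
    x ^ ((k : ℝ) * γ) = (x ^ γ) ^ k := by
  rw [mul_comm, Real.rpow_mul hx, Real.rpow_natCast]

end Control

/-! ### Pairs of solutions -/

section Solutions

variable {H : Type*} [CommRing H] [Algebra ℝ H] [Coalgebra ℝ H]

/-- The standing assumptions, on an initial interval `[0, T₁]` on which the control is at
most one. -/
structure Setting (𝒜 : ℕ → Submodule ℝ H) [GradedAlgebra 𝒜] (p : Seminorm ℝ H) (N : ℕ) (γ : ℝ)
    (ω : ℝ → ℝ → ℝ) {d : ℕ} (L : Fin d → H →ₗ[ℝ] H) (T T₁ : ℝ) : Prop where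
  hopf : IsTruncatedHopf 𝒜 N
  norm : IsGoodNorm 𝒜 p
  cocycle : IsCocycleFamily 𝒜 N L
  control : IsRightContControl ω T
  le : T₁ ≤ T
  small : ω 0 T₁ ≤ 1
  gamma_pos : 0 < γ
  one_le : 1 ≤ N
  one_lt : 1 < ((N + 1 : ℕ) : ℝ) * γ

/-- Two solutions on a common interval `[0, T'] ⊆ [0, T₁]`, with the bounds by `M` of the theorem;
the norm of the second solution is not restricted. -/
structure SolutionPair (𝒜 : ℕ → Submodule ℝ H) [GradedAlgebra 𝒜] (p : Seminorm ℝ H) (N : ℕ)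
    (γ : ℝ) (ω : ℝ → ℝ → ℝ) {d : ℕ} (L : Fin d → H →ₗ[ℝ] H) (e : ℕ) (T₁ M : ℝ) where
  /-- the right end point of the interval -/
  T' : ℝ
  /-- the first driving rough path -/
  X : ℝ → ℝ → H →ₗ[ℝ] ℝ
  /-- the second driving rough path -/
  X' : ℝ → ℝ → H →ₗ[ℝ] ℝ
  /-- the vector fields of the first equation -/
  φ : Fin d → (Fin e → ℝ) → Fin e → ℝ
  /-- the vector fields of the second equation -/
  φ' : Fin d → (Fin e → ℝ) → Fin e → ℝ
  /-- the first solution -/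
  Z : ℝ → Fin e → H
  /-- the second solution -/
  Z' : ℝ → Fin e → H
  nonneg : 0 ≤ T'
  le : T' ≤ T₁
  rough : IsRoughPath 𝒜 p N γ ω T' X
  rough' : IsRoughPath 𝒜 p N γ ω T' X'
  rough_le : roughNorm 𝒜 p N γ ω T' X ≤ M
  rough_le' : roughNorm 𝒜 p N γ ω T' X' ≤ M
  smooth : ∀ i, ContDiff ℝ (N + 1 : ℕ) (φ i)
  smooth' : ∀ i, ContDiff ℝ (N + 1 : ℕ) (φ' i)
  sol : IsSolution 𝒜 p N γ ω T' L X φ Z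
  sol' : IsSolution 𝒜 p N γ ω T' L X' φ' Z'
  controlled_le : controlledNorm 𝒜 p N γ ω T' X Z ≤ M
  deriv_le : ∀ i, derivNorm (N + 1) (pathHull T' Z Z') (φ i) ≤ M
  deriv_le' : ∀ i, derivNorm (N + 1) (pathHull T' Z Z') (φ' i) ≤ M

variable {𝒜 : ℕ → Submodule ℝ H} [GradedAlgebra 𝒜] {p : Seminorm ℝ H} {N : ℕ}
    {γ : ℝ} {ω : ℝ → ℝ → ℝ} {d : ℕ} {L : Fin d → H →ₗ[ℝ] H} {e : ℕ} {T T₁ M M' : ℝ}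

/-- The distance of the initial points and of the vector fields. -/
def SolutionPair.initialDist (c : SolutionPair 𝒜 p N γ ω L e T₁ M) : ℝ :=
  ‖base (c.Z 0) - base (c.Z' 0)‖ + ∑ i, derivNorm N (pathHull c.T' c.Z c.Z') (c.φ i - c.φ' i)

/-- The distance of all data, including the solutions themselves. -/
def SolutionPair.dist (c : SolutionPair 𝒜 p N γ ω L e T₁ M) : ℝ :=
  formalDist 𝒜 p N γ ω c.T' c.X c.X' c.Z c.Z' + c.initialDist
    + roughNorm 𝒜 p N γ ω c.T' (c.X - c.X')

theorem SolutionPair.initialDist_nonneg (c : SolutionPair 𝒜 p N γ ω L e T₁ M) :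
    0 ≤ c.initialDist :=
  add_nonneg (norm_nonneg _) (Finset.sum_nonneg fun _ _ => derivNorm_nonneg _ _ _)

theorem SolutionPair.formalDist_nonneg (c : SolutionPair 𝒜 p N γ ω L e T₁ M) :
    0 ≤ formalDist 𝒜 p N γ ω c.T' c.X c.X' c.Z c.Z' :=
  add_nonneg (vecNorm_nonneg _ _) (remNorm_nonneg _)

theorem SolutionPair.roughNorm_le_dist (c : SolutionPair 𝒜 p N γ ω L e T₁ M) :
    roughNorm 𝒜 p N γ ω c.T' (c.X - c.X') ≤ c.dist := by
  have h1 := c.initialDist_nonneg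
  have h2 := c.formalDist_nonneg
  rw [SolutionPair.dist]
  linarith

theorem SolutionPair.initialDist_le_dist (c : SolutionPair 𝒜 p N γ ω L e T₁ M) :
    c.initialDist ≤ c.dist := by
  have h1 := roughNorm_nonneg (𝒜 := 𝒜) (p := p) (N := N) (γ := γ) (ω := ω) (T' := c.T')
    (c.X - c.X')
  have h2 := c.formalDist_nonneg
  rw [SolutionPair.dist]
  linarith

theorem SolutionPair.formalDist_le_dist (c : SolutionPair 𝒜 p N γ ω L e T₁ M) :
    formalDist 𝒜 p N γ ω c.T' c.X c.X' c.Z c.Z' ≤ c.dist := by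
  have h1 := roughNorm_nonneg (𝒜 := 𝒜) (p := p) (N := N) (γ := γ) (ω := ω) (T' := c.T')
    (c.X - c.X')
  have h2 := c.initialDist_nonneg
  rw [SolutionPair.dist]
  linarith

theorem SolutionPair.dist_nonneg (c : SolutionPair 𝒜 p N γ ω L e T₁ M) : 0 ≤ c.dist :=
  c.initialDist_nonneg.trans c.initialDist_le_dist

theorem SolutionPair.derivNorm_sub_le (c : SolutionPair 𝒜 p N γ ω L e T₁ M) (i : Fin d) :
    derivNorm N (pathHull c.T' c.Z c.Z') (c.φ i - c.φ' i) ≤ c.initialDist := by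
  have h1 := Finset.single_le_sum (f := fun i => derivNorm N (pathHull c.T' c.Z c.Z')
    (c.φ i - c.φ' i)) (fun _ _ => derivNorm_nonneg _ _ _) (Finset.mem_univ i)
  have h2 := norm_nonneg (base (c.Z 0) - base (c.Z' 0))
  rw [SolutionPair.initialDist]
  linarith

variable (𝒜 p N γ ω L e T₁ M M') in
/-- A pair of solutions, the second one of norm at most `M'`, with two times `s ≤ t`. All bounds
are uniform over this index type. -/
structure Segment where
  /-- the pair of solutions -/
  pair : SolutionPair 𝒜 p N γ ω L e T₁ M
  /-- the left end point -/
  s : ℝ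
  /-- the right end point -/
  t : ℝ
  controlled_le' : controlledNorm 𝒜 p N γ ω pair.T' pair.X' pair.Z' ≤ M'
  hs : 0 ≤ s
  hst : s ≤ t
  ht : t ≤ pair.T'

namespace Segment

/-- The scale `ω(s, t) ^ γ` of a segment. -/
def scale (q : Segment 𝒜 p N γ ω L e T₁ M M') : ℝ := ω q.s q.t ^ γ

/-- The distance of the data of a segment. -/
def dist (q : Segment 𝒜 p N γ ω L e T₁ M M') : ℝ := q.pair.dist

/-- The segment from `0` to the left end point. -/
def toLeft (q : Segment 𝒜 p N γ ω L e T₁ M M') : Segment 𝒜 p N γ ω L e T₁ M M' :=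
  ⟨q.pair, 0, q.s, q.controlled_le', le_rfl, q.hs, q.hst.trans q.ht⟩

/-- The segment from `0` to the right end point. -/
def toRight (q : Segment 𝒜 p N γ ω L e T₁ M M') : Segment 𝒜 p N γ ω L e T₁ M M' :=
  ⟨q.pair, 0, q.t, q.controlled_le', le_rfl, q.hs.trans q.hst, q.ht⟩

variable (S : Setting 𝒜 p N γ ω L T T₁)

include S

theorem control_nonneg (q : Segment 𝒜 p N γ ω L e T₁ M M') : 0 ≤ ω q.s q.t :=
  S.control.nonneg _ _ q.hs q.hst (q.ht.trans (q.pair.le.trans S.le))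

theorem isScale : IsScale (scale (𝒜 := 𝒜) (p := p) (N := N) (γ := γ) (ω := ω) (L := L) (e := e)
    (T₁ := T₁) (M := M) (M' := M')) dist := by
  refine ⟨fun q => Real.rpow_nonneg (q.control_nonneg S) _, fun q => ?_,
    fun q => q.pair.dist_nonneg⟩
  refine Real.rpow_le_one (q.control_nonneg S) (le_trans ?_ S.small) S.gamma_pos.le
  exact S.control.mono le_rfl q.hs q.hst (q.ht.trans q.pair.le) S.le

theorem functionalBound : FunctionalBound 𝒜 p N
    (scale (𝒜 := 𝒜) (p := p) (N := N) (γ := γ) (ω := ω) (L := L) (e := e)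
    (T₁ := T₁) (M := M) (M' := M')) dist (fun q => q.pair.X q.s q.t)
    fun q => q.pair.X' q.s q.t := by
  have := finite_of_isTruncatedHopf S.hopf
  refine ⟨max M 1, le_trans zero_le_one (le_max_right _ _), fun q k hk => ?_⟩
  have hT : q.pair.T' ≤ T := q.pair.le.trans S.le
  have hpow : (0 : ℝ) ≤ q.scale ^ k := pow_nonneg ((isScale S).nonneg q) k
  have h1 := roughBound_roughNorm S.control hT q.pair.rough.bound k hk q.s q.t q.hs q.hst q.ht
  have h2 := roughBound_roughNorm S.control hT q.pair.rough'.bound k hk q.s q.t q.hs q.hst q.ht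
  have h3 := roughBound_roughNorm S.control hT
    (exists_roughBound_sub S.norm.definite q.pair.rough.bound q.pair.rough'.bound)
    k hk q.s q.t q.hs q.hst q.ht
  rw [rpow_mul_eq_pow (q.control_nonneg S)] at h1 h2 h3
  refine ⟨h1.trans ?_, h2.trans ?_, ?_⟩
  · exact mul_le_mul_of_nonneg_right (q.pair.rough_le.trans (le_max_left _ _)) hpow
  · exact mul_le_mul_of_nonneg_right (q.pair.rough_le'.trans (le_max_left _ _)) hpow
  · rw [← LinearMap.sub_comp]
    refine h3.trans ((mul_le_mul_of_nonneg_right q.pair.roughNorm_le_dist hpow).trans ?_)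
    exact le_mul_of_one_le_left (mul_nonneg q.pair.dist_nonneg hpow) (le_max_right _ _)

theorem remainder_bound (a : Fin e) : PairBound 𝒜 p (N + 1) N
    (scale (𝒜 := 𝒜) (p := p) (N := N) (γ := γ) (ω := ω) (L := L) (e := e)
    (T₁ := T₁) (M := M) (M' := M')) dist
    (fun q => remainder q.pair.X q.pair.Z q.s q.t a)
    fun q => remainder q.pair.X' q.pair.Z' q.s q.t a := by
  refine ⟨max (max M M') 1, le_trans zero_le_one (le_max_right _ _), fun q j hj => ?_⟩
  have hT : q.pair.T' ≤ T := q.pair.le.trans S.le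
  have hj' : j ≤ N := Nat.lt_succ_iff.1 hj
  have hpow : (0 : ℝ) ≤ q.scale ^ (N - j) := pow_nonneg ((isScale S).nonneg q) _
  have h1 := remBound_remNorm S.control hT q.pair.sol.controlled j hj' q.s q.t q.hs q.hst q.ht
  have h2 := remBound_remNorm S.control hT q.pair.sol'.controlled j hj' q.s q.t q.hs q.hst q.ht
  have h3 := remBound_remNorm S.control hT (exists_remBound_sub S.control hT
    q.pair.sol.controlled q.pair.sol'.controlled) j hj' q.s q.t q.hs q.hst q.ht
  rw [← Nat.cast_sub hj', rpow_mul_eq_pow (q.control_nonneg S)] at h1 h2 h3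
  have b1 : remNorm 𝒜 p N γ ω q.pair.T' (remainder q.pair.X q.pair.Z) ≤ max (max M M') 1 :=
    le_trans (le_add_of_nonneg_left (vecNorm_nonneg _ _)) (q.pair.controlled_le.trans
      ((le_max_left _ _).trans (le_max_left _ _)))
  have b2 : remNorm 𝒜 p N γ ω q.pair.T' (remainder q.pair.X' q.pair.Z') ≤ max (max M M') 1 :=
    le_trans (le_add_of_nonneg_left (vecNorm_nonneg _ _)) (q.controlled_le'.trans
      ((le_max_right _ _).trans (le_max_left _ _)))
  have b3 : remNorm 𝒜 p N γ ω q.pair.T'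
      (remainder q.pair.X q.pair.Z - remainder q.pair.X' q.pair.Z') ≤ q.dist :=
    le_trans (le_add_of_nonneg_left (vecNorm_nonneg _ _)) q.pair.formalDist_le_dist
  refine ⟨?_, ?_, ?_⟩
  · exact (le_vecNorm p (fun a => GradedAlgebra.proj 𝒜 j (remainder q.pair.X q.pair.Z q.s q.t a))
      a).trans (h1.trans (mul_le_mul_of_nonneg_right b1 hpow))
  · exact (le_vecNorm p (fun a => GradedAlgebra.proj 𝒜 j
      (remainder q.pair.X' q.pair.Z' q.s q.t a)) a).trans
      (h2.trans (mul_le_mul_of_nonneg_right b2 hpow))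
  · rw [← map_sub]
    refine (le_vecNorm p (fun a => GradedAlgebra.proj 𝒜 j
      ((remainder q.pair.X q.pair.Z - remainder q.pair.X' q.pair.Z') q.s q.t a)) a).trans
      (h3.trans ((mul_le_mul_of_nonneg_right b3 hpow).trans ?_))
    exact le_mul_of_one_le_left (mul_nonneg q.pair.dist_nonneg hpow) (le_max_right _ _)

theorem initial_bound (a : Fin e) : PairBound 𝒜 p (N + 1) 0
    (scale (𝒜 := 𝒜) (p := p) (N := N) (γ := γ) (ω := ω) (L := L) (e := e)
    (T₁ := T₁) (M := M) (M' := M')) dist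
    (fun q => q.pair.Z 0 a) fun q => q.pair.Z' 0 a := by
  refine ⟨max (max M M') 1, le_trans zero_le_one (le_max_right _ _), fun q j _ => ?_⟩
  have b1 : vecNorm p (q.pair.Z 0) ≤ max (max M M') 1 :=
    le_trans (le_add_of_nonneg_right (remNorm_nonneg _)) (q.pair.controlled_le.trans
      ((le_max_left _ _).trans (le_max_left _ _)))
  have b2 : vecNorm p (q.pair.Z' 0) ≤ max (max M M') 1 :=
    le_trans (le_add_of_nonneg_right (remNorm_nonneg _)) (q.controlled_le'.trans
      ((le_max_right _ _).trans (le_max_left _ _)))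
  have b3 : vecNorm p (q.pair.Z 0 - q.pair.Z' 0) ≤ q.dist :=
    le_trans (le_add_of_nonneg_right (remNorm_nonneg _)) q.pair.formalDist_le_dist
  rw [Nat.zero_sub, pow_zero]
  refine ⟨?_, ?_, ?_⟩
  · rw [mul_one]
    exact (proj_le S.norm j _).trans ((le_vecNorm p _ a).trans b1)
  · rw [mul_one]
    exact (proj_le S.norm j _).trans ((le_vecNorm p _ a).trans b2)
  · rw [← map_sub, mul_one]
    refine (proj_le S.norm j _).trans ((le_vecNorm p (q.pair.Z 0 - q.pair.Z' 0) a).trans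
      (b3.trans ?_))
    exact le_mul_of_one_le_left q.pair.dist_nonneg (le_max_right _ _)

/-- The values of the solutions are bounded, and close to each other. -/
theorem value_bound (a : Fin e) : PairBound 𝒜 p (N + 1) 0
    (scale (𝒜 := 𝒜) (p := p) (N := N) (γ := γ) (ω := ω) (L := L) (e := e)
    (T₁ := T₁) (M := M) (M' := M')) dist
    (fun q => q.pair.Z q.t a) fun q => q.pair.Z' q.t a := by
  have h1 := PairBound.convTranspose S.hopf S.norm ((isScale S).comp toRight)
    ((functionalBound S).comp toRight)
    ((initial_bound (e := e) (M := M) (M' := M') S a).comp toRight)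
  have h2 := ((remainder_bound (e := e) (M := M) (M' := M') S a).comp toRight).mono
    ((isScale S).comp toRight) (Nat.zero_le N)
  have h3 := (h1.add h2).order_zero_congr scale
  have key : ∀ (X : ℝ → ℝ → H →ₗ[ℝ] ℝ) (Z : ℝ → Fin e → H) (t : ℝ),
      convTranspose (X 0 t) (Z 0 a) + remainder X Z 0 t a = Z t a := fun X Z t => by
    simp [remainder]
  have e1 : ∀ q : Segment 𝒜 p N γ ω L e T₁ M M',
      convTranspose (q.toRight.pair.X q.toRight.s q.toRight.t) (q.toRight.pair.Z 0 a)
        + remainder q.toRight.pair.X q.toRight.pair.Z q.toRight.s q.toRight.t a = q.pair.Z q.t a :=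
    fun q => key _ _ _
  have e2 : ∀ q : Segment 𝒜 p N γ ω L e T₁ M M',
      convTranspose (q.toRight.pair.X' q.toRight.s q.toRight.t) (q.toRight.pair.Z' 0 a)
        + remainder q.toRight.pair.X' q.toRight.pair.Z' q.toRight.s q.toRight.t a
        = q.pair.Z' q.t a := fun q => key _ _ _
  simp only [e1, e2] at h3
  exact h3

theorem value_bound_left (a : Fin e) : PairBound 𝒜 p (N + 1) 0
    (scale (𝒜 := 𝒜) (p := p) (N := N) (γ := γ) (ω := ω) (L := L) (e := e)
    (T₁ := T₁) (M := M) (M' := M')) dist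
    (fun q => q.pair.Z q.s a) fun q => q.pair.Z' q.s a :=
  ((value_bound (e := e) (M := M) (M' := M') S a).comp toLeft).order_zero_congr scale

/-- The increments of the underlying paths are of order one. -/
theorem increment_bound (a : Fin e) : ScalarBound 1
    (scale (𝒜 := 𝒜) (p := p) (N := N) (γ := γ) (ω := ω) (L := L) (e := e)
    (T₁ := T₁) (M := M) (M' := M')) dist
    (fun q => base (q.pair.Z q.t) a - base (q.pair.Z q.s) a)
    fun q => base (q.pair.Z' q.t) a - base (q.pair.Z' q.s) a := by
  have h1 : ScalarBound 1 (scale (𝒜 := 𝒜) (p := p) (N := N) (γ := γ) (ω := ω) (L := L) (e := e)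
      (T₁ := T₁) (M := M) (M' := M')) dist _ _ :=
    ScalarBound.sum (Finset.range N) fun k hk =>
    (ScalarBound.apply_proj (k := k + 1) S.hopf S.norm (functionalBound S)
      (by have := Finset.mem_range.1 hk; omega) (value_bound_left S a)).mono (isScale S)
      (show 1 ≤ k + 1 + (0 - (k + 1)) by omega)
  have h2 := (ScalarBound.counit S.hopf S.norm
    (remainder_bound (e := e) (M := M) (M' := M') S a)).mono (isScale S) S.one_le
  have key : ∀ (X : ℝ → ℝ → H →ₗ[ℝ] ℝ) (Z : ℝ → Fin e → H) (s t : ℝ), X s t 1 = 1 →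
      (∑ k ∈ Finset.range N, X s t (GradedAlgebra.proj 𝒜 (k + 1) (Z s a)))
        + Coalgebra.counit (R := ℝ) (remainder X Z s t a) = base (Z t) a - base (Z s) a := by
    intro X Z s t hX
    have e1 : X s t (Z s a) = (∑ k ∈ Finset.range N, X s t (GradedAlgebra.proj 𝒜 (k + 1) (Z s a)))
        + base (Z s) a := by
      conv_lhs => rw [← sum_proj S.hopf (Z s a), map_sum, Finset.sum_range_succ',
        ← algebraMap_counit S.hopf, Algebra.algebraMap_eq_smul_one, map_smul, hX, smul_eq_mul,
        mul_one]
      rfl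
    rw [remainder, map_sub, counit_convTranspose, e1, base, base]
    ring
  have h3 := h1.add h2
  simp only [fun q : Segment 𝒜 p N γ ω L e T₁ M M' => key q.pair.X q.pair.Z q.s q.t
    (q.pair.rough.map_one _ _ q.hs q.hst q.ht), fun q : Segment 𝒜 p N γ ω L e T₁ M M' =>
    key q.pair.X' q.pair.Z' q.s q.t (q.pair.rough'.map_one _ _ q.hs q.hst q.ht)] at h3
  exact h3

theorem base_bound (a : Fin e) : ScalarBound 0
    (scale (𝒜 := 𝒜) (p := p) (N := N) (γ := γ) (ω := ω) (L := L) (e := e)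
    (T₁ := T₁) (M := M) (M' := M')) dist
    (fun q => base (q.pair.Z q.t) a) fun q => base (q.pair.Z' q.t) a :=
  ScalarBound.counit S.hopf S.norm (value_bound S a)

end Segment

/-- The hull of the two paths is bounded. The bound depends on the pair, and serves only to make the
suprema in `derivNorm` finite. -/
theorem SolutionPair.isBounded_pathHull (S : Setting 𝒜 p N γ ω L T T₁)
    (c : SolutionPair 𝒜 p N γ ω L e T₁ M) : Bornology.IsBounded (pathHull c.T' c.Z c.Z') := by
  rw [pathHull, isBounded_convexHull]
  choose C hC hbd using fun a => Segment.base_bound (e := e) (M := M)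
    (M' := controlledNorm 𝒜 p N γ ω c.T' c.X' c.Z') S a
  have hb : ∀ t ∈ Set.Icc 0 c.T', ‖base (c.Z t)‖ ≤ ∑ a, C a ∧ ‖base (c.Z' t)‖ ≤ ∑ a, C a := by
    intro t ht
    have h0 : 0 ≤ ∑ a, C a := Finset.sum_nonneg fun a _ => hC a
    have hCa : ∀ a, C a ≤ ∑ a, C a := fun a =>
      Finset.single_le_sum (fun a _ => hC a) (Finset.mem_univ a)
    have h := fun a => hbd a ⟨c, 0, t, le_rfl, le_rfl, ht.1, ht.2⟩
    constructor
    · refine (pi_norm_le_iff_of_nonneg h0).2 fun a => ?_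
      have := (h a).1
      rw [pow_zero, mul_one] at this
      exact this.trans (hCa a)
    · refine (pi_norm_le_iff_of_nonneg h0).2 fun a => ?_
      have := (h a).2.1
      rw [pow_zero, mul_one] at this
      exact this.trans (hCa a)
  refine (isBounded_iff_forall_norm_le).2 ⟨∑ a, C a, ?_⟩
  rintro _ (⟨t, ht, rfl⟩ | ⟨t, ht, rfl⟩)
  · exact (hb t ht).1
  · exact (hb t ht).2

theorem SolutionPair.mem_pathHull (c : SolutionPair 𝒜 p N γ ω L e T₁ M) {t : ℝ} (h0 : 0 ≤ t)
    (ht : t ≤ c.T') : base (c.Z t) ∈ pathHull c.T' c.Z c.Z' ∧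
      base (c.Z' t) ∈ pathHull c.T' c.Z c.Z' :=
  ⟨subset_convexHull ℝ _ (Or.inl ⟨t, ⟨h0, ht⟩, rfl⟩),
    subset_convexHull ℝ _ (Or.inr ⟨t, ⟨h0, ht⟩, rfl⟩)⟩

/-- The derivatives of the vector fields at close points of the hull are bounded and close to each
other. -/
theorem SolutionPair.near_partialDeriv (S : Setting 𝒜 p N γ ω L T T₁)
    (c : SolutionPair 𝒜 p N γ ω L e T₁ M) (i : Fin d) {n : ℕ} (hn : n ≤ N)
    {x x' : Fin e → ℝ} (hx : x ∈ pathHull c.T' c.Z c.Z') (hx' : x' ∈ pathHull c.T' c.Z c.Z')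
    {B δ : ℝ} (hB : 0 ≤ B) (hxx : ‖x - x'‖ ≤ B * δ) (hδ : c.initialDist ≤ δ)
    (ι : Fin n → Fin e) (a : Fin e) :
    Near (fun c : ℝ => |c|) (max M 0 * (B + 1) + 1) 1 δ
      (partialDeriv (c.φ i) x ι a) (partialDeriv (c.φ' i) x' ι a) := by
  have hK := c.isBounded_pathHull S
  have h1 := (abs_partialDeriv_le hK (c.smooth i) (by omega) hx ι a).trans (c.deriv_le i)
  have h2 := (abs_partialDeriv_le hK (c.smooth' i) (by omega) hx' ι a).trans (c.deriv_le' i)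
  have h3 := abs_partialDeriv_sub_le hK (convex_convexHull ℝ _) (c.smooth i) (c.smooth' i) hn
    hx hx' ι a
  have hM : M ≤ max M 0 := le_max_left _ _
  have hM0 : 0 ≤ max M 0 := le_max_right _ _
  have hδ0 : 0 ≤ δ := c.initialDist_nonneg.trans hδ
  have h4 := c.derivNorm_sub_le i
  have h5 : 0 ≤ max M 0 * B := mul_nonneg hM0 hB
  refine ⟨?_, ?_, ?_⟩
  · beta_reduce
    linarith
  · beta_reduce
    linarith
  · beta_reduce
    have h6 : derivNorm (N + 1) (pathHull c.T' c.Z c.Z') (c.φ i) * ‖x - x'‖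
        ≤ max M 0 * (B * δ) :=
      mul_le_mul ((c.deriv_le i).trans hM) hxx (norm_nonneg _) hM0
    nlinarith [mul_nonneg hM0 hδ0]

namespace Segment

variable (S : Setting 𝒜 p N γ ω L T T₁)

include S

/-- The derivatives of the vector fields on the line segments joining the end points of the two
paths; these segments lie in the convex hull. -/
theorem partialDeriv_bound (i : Fin d) {n : ℕ} (hn : n ≤ N) (ι : Fin n → Fin e) (a : Fin e) :
    ScalarBound 0 (fun x : Segment 𝒜 p N γ ω L e T₁ M M' × Set.Icc (0 : ℝ) 1 => scale x.1)
      (fun x => dist x.1)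
      (fun x => partialDeriv (x.1.pair.φ i) (base (x.1.pair.Z x.1.s)
        + (x.2 : ℝ) • (base (x.1.pair.Z x.1.t) - base (x.1.pair.Z x.1.s))) ι a)
      fun x => partialDeriv (x.1.pair.φ' i) (base (x.1.pair.Z' x.1.s)
        + (x.2 : ℝ) • (base (x.1.pair.Z' x.1.t) - base (x.1.pair.Z' x.1.s))) ι a := by
  choose C hC hbd using fun a => base_bound (e := e) (M := M) (M' := M') S a
  set B := ∑ a, C a with hBdef
  have hB : 0 ≤ B := Finset.sum_nonneg fun a _ => hC a
  have hbase : ∀ q : Segment 𝒜 p N γ ω L e T₁ M M',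
      ‖base (q.pair.Z q.t) - base (q.pair.Z' q.t)‖ ≤ B * q.dist := by
    intro q
    refine (pi_norm_le_iff_of_nonneg (mul_nonneg hB q.pair.dist_nonneg)).2 fun a => ?_
    have h := (hbd a q).2.2
    rw [pow_zero, mul_one] at h
    refine h.trans (mul_le_mul_of_nonneg_right ?_ q.pair.dist_nonneg)
    exact Finset.single_le_sum (fun a _ => hC a) (Finset.mem_univ a)
  refine ⟨max M 0 * (B + 1) + 1, by positivity, fun x => ?_⟩
  obtain ⟨q, θ, hθ⟩ := x
  rw [pow_zero]
  have hs := q.pair.mem_pathHull q.hs (q.hst.trans q.ht)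
  have ht := q.pair.mem_pathHull (q.hs.trans q.hst) q.ht
  have hconv : Convex ℝ (pathHull q.pair.T' q.pair.Z q.pair.Z') := convex_convexHull ℝ _
  refine q.pair.near_partialDeriv S i hn (hconv.add_smul_sub_mem hs.1 ht.1 hθ)
    (hconv.add_smul_sub_mem hs.2 ht.2 hθ) hB ?_ q.pair.initialDist_le_dist ι a
  have e1 : base (q.pair.Z q.s) + θ • (base (q.pair.Z q.t) - base (q.pair.Z q.s))
      - (base (q.pair.Z' q.s) + θ • (base (q.pair.Z' q.t) - base (q.pair.Z' q.s)))
      = (1 - θ) • (base (q.pair.Z q.s) - base (q.pair.Z' q.s))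
        + θ • (base (q.pair.Z q.t) - base (q.pair.Z' q.t)) := by
    ext a
    simp only [Pi.add_apply, Pi.sub_apply, Pi.smul_apply, smul_eq_mul]
    ring
  have h1 : ‖base (q.pair.Z q.s) - base (q.pair.Z' q.s)‖ ≤ B * q.dist := hbase q.toLeft
  have h2 := hbase q
  change ‖base (q.pair.Z q.s) + θ • (base (q.pair.Z q.t) - base (q.pair.Z q.s))
      - (base (q.pair.Z' q.s) + θ • (base (q.pair.Z' q.t) - base (q.pair.Z' q.s)))‖ ≤ B * q.dist
  rw [e1]
  refine (norm_add_le _ _).trans ?_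
  rw [norm_smul, norm_smul, Real.norm_eq_abs, Real.norm_eq_abs, abs_of_nonneg hθ.1,
    abs_of_nonneg (sub_nonneg.2 hθ.2)]
  nlinarith [mul_le_mul_of_nonneg_left h1 (sub_nonneg.2 hθ.2), mul_le_mul_of_nonneg_left h2 hθ.1]

/-- The images of the solutions under the vector fields are controlled, with close
remainders. -/
theorem smoothImage_remainder_bound (i : Fin d) (a : Fin e) : PairBound 𝒜 p (N + 1) N
    (scale (𝒜 := 𝒜) (p := p) (N := N) (γ := γ) (ω := ω) (L := L) (e := e)
    (T₁ := T₁) (M := M) (M' := M')) dist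
    (fun q => remainder q.pair.X (fun r => smoothImage N (q.pair.φ i) (q.pair.Z r)) q.s q.t a)
    fun q => remainder q.pair.X' (fun r => smoothImage N (q.pair.φ' i) (q.pair.Z' r))
      q.s q.t a :=
  PairBound.smoothImage_sub S.one_le S.hopf S.norm (isScale S) (functionalBound S)
    (fun q => q.pair.rough.map_one _ _ q.hs q.hst q.ht)
    (fun q => q.pair.rough'.map_one _ _ q.hs q.hst q.ht)
    (fun q => q.pair.rough.map_mul _ _ q.hs q.hst q.ht)
    (fun q => q.pair.rough'.map_mul _ _ q.hs q.hst q.ht)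
    (fun q => q.pair.smooth i) (fun q => q.pair.smooth' i)
    (value_bound_left S) (value_bound S) (remainder_bound S) (increment_bound S)
    (fun _ hn ι a => partialDeriv_bound S i hn ι a) a

theorem smoothImage_bound (i : Fin d) (a : Fin e) : PairBound 𝒜 p (N + 1) 0
    (scale (𝒜 := 𝒜) (p := p) (N := N) (γ := γ) (ω := ω) (L := L) (e := e)
    (T₁ := T₁) (M := M) (M' := M')) dist
    (fun q => smoothImage N (q.pair.φ i) (q.pair.Z q.s) a)
    fun q => smoothImage N (q.pair.φ' i) (q.pair.Z' q.s) a := by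
  refine PairBound.smoothImage_of_bound S.hopf S.norm (isScale S) a (fun n hn ι => ?_) fun c =>
    ((value_bound_left S c).sub_counit S.hopf (isScale S)).mono (isScale S) (Nat.zero_le 1)
  have := (partialDeriv_bound (e := e) (M := M) (M' := M') S i hn ι a).comp
    fun q : Segment 𝒜 p N γ ω L e T₁ M M' => (q, ⟨0, by simp⟩)
  simpa using this

/-- The top degree is lost in the integrand, since the operators `L i` vanish there. The remainder
without the top degree of the left value is of order `N` as well. -/
theorem truncated_remainder_bound (i : Fin d) (a : Fin e) : PairBound 𝒜 p (N + 1) N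
    (scale (𝒜 := 𝒜) (p := p) (N := N) (γ := γ) (ω := ω) (L := L) (e := e)
    (T₁ := T₁) (M := M) (M' := M')) dist
    (fun q => smoothImage N (q.pair.φ i) (q.pair.Z q.t) a
      - convTranspose (q.pair.X q.s q.t) (smoothImage N (q.pair.φ i) (q.pair.Z q.s) a
        - GradedAlgebra.proj 𝒜 N (smoothImage N (q.pair.φ i) (q.pair.Z q.s) a)))
    fun q => smoothImage N (q.pair.φ' i) (q.pair.Z' q.t) a
      - convTranspose (q.pair.X' q.s q.t) (smoothImage N (q.pair.φ' i) (q.pair.Z' q.s) a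
        - GradedAlgebra.proj 𝒜 N (smoothImage N (q.pair.φ' i) (q.pair.Z' q.s) a)) := by
  have h := (smoothImage_remainder_bound (M := M) (M' := M') S i a).add
    (((smoothImage_bound S i a).proj (isScale S) N).convTranspose S.hopf S.norm (isScale S)
      (functionalBound S))
  simp only [remainder] at h ⊢
  simp only [map_sub, ← sub_add]
  exact h

end Segment

end Solutions

/-! ### The remainders of solutions -/

section Remainders

variable {H : Type*} [CommRing H] [Algebra ℝ H] [Coalgebra ℝ H]
  {𝒜 : ℕ → Submodule ℝ H} [GradedAlgebra 𝒜] {p : Seminorm ℝ H} {N : ℕ}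
  {γ : ℝ} {ω : ℝ → ℝ → ℝ} {d : ℕ} {L : Fin d → H →ₗ[ℝ] H} {e : ℕ} {T T₁ M M' : ℝ}

variable (𝒜 p N γ ω L e T₁ M M') in
/-- A segment with an intermediate time. -/
structure CutSegment where
  /-- the whole segment -/
  whole : Segment 𝒜 p N γ ω L e T₁ M M'
  /-- the intermediate time -/
  u : ℝ
  hsu : whole.s ≤ u
  hut : u ≤ whole.t

namespace CutSegment

/-- The left part of a cut segment. -/
def left (x : CutSegment 𝒜 p N γ ω L e T₁ M M') : Segment 𝒜 p N γ ω L e T₁ M M' :=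
  ⟨x.whole.pair, x.whole.s, x.u, x.whole.controlled_le', x.whole.hs, x.hsu,
    x.hut.trans x.whole.ht⟩

/-- The right part of a cut segment. -/
def right (x : CutSegment 𝒜 p N γ ω L e T₁ M M') : Segment 𝒜 p N γ ω L e T₁ M M' :=
  ⟨x.whole.pair, x.u, x.whole.t, x.whole.controlled_le', x.whole.hs.trans x.hsu, x.hut,
    x.whole.ht⟩

variable (S : Setting 𝒜 p N γ ω L T T₁)

include S

theorem left_scale_le (x : CutSegment 𝒜 p N γ ω L e T₁ M M') : x.left.scale ≤ x.whole.scale :=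
  Real.rpow_le_rpow (x.left.control_nonneg S)
    (S.control.mono x.whole.hs le_rfl x.hsu x.hut (x.whole.ht.trans (x.whole.pair.le.trans S.le)))
    S.gamma_pos.le

theorem right_scale_le (x : CutSegment 𝒜 p N γ ω L e T₁ M M') : x.right.scale ≤ x.whole.scale :=
  Real.rpow_le_rpow (x.right.control_nonneg S)
    (S.control.mono x.whole.hs x.hsu x.hut le_rfl (x.whole.ht.trans (x.whole.pair.le.trans S.le)))
    S.gamma_pos.le

/-- The local approximations `⟨X_{st}, L_i Y_s⟩` of the rough integral are additive up to order
`N + 1`: by Chen's relation and the cocycle condition the defect is minus the pairing of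
`X_{ut}` with `L_i` of `Y_u - T_{su} (Y_s - π_N Y_s)`, where `Y = φ_i(Z)`. -/
theorem defect_bound (i : Fin d) (a : Fin e) : ScalarBound (N + 1)
    (fun x : CutSegment 𝒜 p N γ ω L e T₁ M M' => x.whole.scale) (fun x => x.whole.dist)
    (fun x => x.whole.pair.X x.whole.s x.whole.t
        (L i (smoothImage N (x.whole.pair.φ i) (x.whole.pair.Z x.whole.s) a))
      - x.whole.pair.X x.whole.s x.u
        (L i (smoothImage N (x.whole.pair.φ i) (x.whole.pair.Z x.whole.s) a))
      - x.whole.pair.X x.u x.whole.t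
        (L i (smoothImage N (x.whole.pair.φ i) (x.whole.pair.Z x.u) a)))
    fun x => x.whole.pair.X' x.whole.s x.whole.t
        (L i (smoothImage N (x.whole.pair.φ' i) (x.whole.pair.Z' x.whole.s) a))
      - x.whole.pair.X' x.whole.s x.u
        (L i (smoothImage N (x.whole.pair.φ' i) (x.whole.pair.Z' x.whole.s) a))
      - x.whole.pair.X' x.u x.whole.t
        (L i (smoothImage N (x.whole.pair.φ' i) (x.whole.pair.Z' x.u) a)) := by
  have hr : IsScale (fun x : CutSegment 𝒜 p N γ ω L e T₁ M M' => x.whole.scale)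
      (fun x => x.whole.dist) := (Segment.isScale S).comp _
  have hX := ((Segment.functionalBound (e := e) (M := M) (M' := M') S).comp
    (right (𝒜 := 𝒜))).mono_scale ((Segment.isScale S).comp right) (right_scale_le S)
  have hW := (((Segment.truncated_remainder_bound (M := M) (M' := M') S i a).comp
    (left (𝒜 := 𝒜))).mono_scale ((Segment.isScale S).comp left) (left_scale_le S))
  have hLW := PairBound.cocycle S.hopf S.norm hr S.cocycle i hW
  have hLW' := hLW.mono_degree (Nat.le_succ (N + 1))
  have hsum := (ScalarBound.sum (Finset.range (N + 1)) fun k hk =>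
    (ScalarBound.apply_proj (k := k) S.hopf S.norm hX
      (Nat.lt_succ_iff.1 (Finset.mem_range.1 hk)) hLW').mono hr
      (show N + 1 ≤ k + (N + 1 - k) by omega)).neg hr
  have key : ∀ (X : ℝ → ℝ → H →ₗ[ℝ] ℝ) (s u t : ℝ) (y v : H), X s t = conv (X s u) (X u t) →
      X u t 1 = 1 →
      -∑ k ∈ Finset.range (N + 1), X u t (GradedAlgebra.proj 𝒜 k
        (L i (v - convTranspose (X s u) (y - GradedAlgebra.proj 𝒜 N y))))
      = X s t (L i y) - X s u (L i y) - X u t (L i v) := by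
    intro X s u t y v hchen hone
    rw [← map_sum, sum_proj S.hopf, hchen, ← apply_convTranspose,
      convTranspose_cocycle_sub S.hopf S.cocycle, map_add, Algebra.algebraMap_eq_smul_one,
      map_smul, hone, smul_eq_mul, mul_one, map_sub (L i), map_sub (X u t)]
    ring
  have e1 : ∀ x : CutSegment 𝒜 p N γ ω L e T₁ M M', x.right.pair.X x.right.s x.right.t 1 = 1 :=
    fun x => x.right.pair.rough.map_one _ _ x.right.hs x.right.hst x.right.ht
  have e1' : ∀ x : CutSegment 𝒜 p N γ ω L e T₁ M M', x.right.pair.X' x.right.s x.right.t 1 = 1 :=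
    fun x => x.right.pair.rough'.map_one _ _ x.right.hs x.right.hst x.right.ht
  have e2 := fun x : CutSegment 𝒜 p N γ ω L e T₁ M M' =>
    key x.whole.pair.X x.whole.s x.u x.whole.t
      (smoothImage N (x.whole.pair.φ i) (x.whole.pair.Z x.whole.s) a)
      (smoothImage N (x.whole.pair.φ i) (x.whole.pair.Z x.u) a)
      (x.whole.pair.rough.chen _ _ _ x.whole.hs x.hsu x.hut x.whole.ht) (e1 x)
  have e3 := fun x : CutSegment 𝒜 p N γ ω L e T₁ M M' =>
    key x.whole.pair.X' x.whole.s x.u x.whole.t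
      (smoothImage N (x.whole.pair.φ' i) (x.whole.pair.Z' x.whole.s) a)
      (smoothImage N (x.whole.pair.φ' i) (x.whole.pair.Z' x.u) a)
      (x.whole.pair.rough'.chen _ _ _ x.whole.hs x.hsu x.hut x.whole.ht) (e1' x)
  obtain ⟨C, hC, h⟩ := hsum
  refine ⟨C, hC, fun x => ?_⟩
  have hx := h x
  dsimp only
  rw [← e2 x, ← e3 x]
  exact hx

end CutSegment

namespace Segment

variable (S : Setting 𝒜 p N γ ω L T T₁)

include S

/-- The rough integrals are approximated by their local approximations up to order `N + 1`, and
the errors for two solutions are close. -/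
theorem exists_integral_bound (i : Fin d) : ∃ C, 0 ≤ C ∧
    ∀ (q : Segment 𝒜 p N γ ω L e T₁ M M') (Js Jt Js' Jt' : Fin e → ℝ),
      IsRoughIntegral (L i) q.pair.X (fun r => smoothImage N (q.pair.φ i) (q.pair.Z r)) 0 q.s Js →
      IsRoughIntegral (L i) q.pair.X (fun r => smoothImage N (q.pair.φ i) (q.pair.Z r)) 0 q.t Jt →
      IsRoughIntegral (L i) q.pair.X' (fun r => smoothImage N (q.pair.φ' i) (q.pair.Z' r))
        0 q.s Js' →
      IsRoughIntegral (L i) q.pair.X' (fun r => smoothImage N (q.pair.φ' i) (q.pair.Z' r))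
        0 q.t Jt' →
      ∀ a, |(Jt a - Js a - q.pair.X q.s q.t
            (L i (smoothImage N (q.pair.φ i) (q.pair.Z q.s) a)))
          - (Jt' a - Js' a - q.pair.X' q.s q.t
            (L i (smoothImage N (q.pair.φ' i) (q.pair.Z' q.s) a)))|
        ≤ C * (q.dist * q.scale ^ (N + 1)) := by
  choose D hD hbd using fun a => CutSegment.defect_bound (M := M) (M' := M') S (e := e) i a
  set B := ∑ a, D a
  have hB : 0 ≤ B := Finset.sum_nonneg fun a _ => hD a
  refine ⟨sewingConst (((N + 1 : ℕ) : ℝ) * γ) * B,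
    mul_nonneg (sewingConst_nonneg S.one_lt) hB, fun q Js Jt Js' Jt' h1 h2 h3 h4 a => ?_⟩
  have hT : q.pair.T' ≤ T := q.pair.le.trans S.le
  have key := norm_limit_sub_le (Λ := B * q.dist) S.control hT
    (mul_nonneg hB q.pair.dist_nonneg) S.one_lt (fun s u t hs hsu hut ht => ?_) q.hs q.hst q.ht
    (h1.sub h3) (h2.sub h4)
  · rw [rpow_mul_eq_pow (q.control_nonneg S)] at key
    have h5 := (norm_le_pi_norm _ a).trans key
    rw [Real.norm_eq_abs] at h5
    refine le_trans (le_of_eq (congrArg abs ?_)) (h5.trans_eq ?_)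
    · simp only [Pi.sub_apply]
      ring
    · rw [Segment.scale]
      ring
  · let x : CutSegment 𝒜 p N γ ω L e T₁ M M' :=
      ⟨⟨q.pair, s, t, q.controlled_le', hs, hsu.trans hut, ht⟩, u, hsu, hut⟩
    have hω := x.whole.control_nonneg S
    have hω' : 0 ≤ ω s t := hω
    refine (pi_norm_le_iff_of_nonneg (mul_nonneg (mul_nonneg hB q.pair.dist_nonneg)
      (Real.rpow_nonneg hω' _))).2 fun b => ?_
    have h5 := (hbd b x).2.2
    rw [rpow_mul_eq_pow hω', mul_assoc]
    rw [Real.norm_eq_abs]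
    refine le_trans (le_of_eq (congrArg abs ?_)) (h5.trans (mul_le_mul_of_nonneg_right
      (Finset.single_le_sum (fun a _ => hD a) (Finset.mem_univ b))
      (mul_nonneg q.pair.dist_nonneg (pow_nonneg (Real.rpow_nonneg hω' _) _))))
    simp only [Pi.sub_apply, x]
    ring

/-- The remainders of two solutions are close with one order more than the norm requires. -/
theorem exists_remainder_sub_bound (a : Fin e) : ∃ C, 0 ≤ C ∧
    ∀ (q : Segment 𝒜 p N γ ω L e T₁ M M'), ∀ j ≤ N,
      p (GradedAlgebra.proj 𝒜 j (remainder q.pair.X q.pair.Z q.s q.t a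
        - remainder q.pair.X' q.pair.Z' q.s q.t a)) ≤ C * (q.dist * q.scale ^ (N + 1 - j)) := by
  have hrep : ∀ (X : ℝ → ℝ → H →ₗ[ℝ] ℝ) (φ : Fin d → (Fin e → ℝ) → Fin e → ℝ) (Z : ℝ → Fin e → H)
      (s t : ℝ) (Js Jt : Fin d → Fin e → ℝ), X s t 1 = 1 →
      (Z s a = algebraMap ℝ H (base (Z 0) a)
        + ∑ i, (L i (smoothImage N (φ i) (Z s) a) + algebraMap ℝ H (Js i a))) →
      (Z t a = algebraMap ℝ H (base (Z 0) a)
        + ∑ i, (L i (smoothImage N (φ i) (Z t) a) + algebraMap ℝ H (Jt i a))) →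
      remainder X Z s t a = (∑ i, L i (smoothImage N (φ i) (Z t) a
          - convTranspose (X s t) (smoothImage N (φ i) (Z s) a
            - GradedAlgebra.proj 𝒜 N (smoothImage N (φ i) (Z s) a))))
        + algebraMap ℝ H (∑ i, (Jt i a - Js i a - X s t (L i (smoothImage N (φ i) (Z s) a)))) := by
    intro X φ Z s t Js Jt hone hs ht
    rw [remainder, ht, hs]
    simp only [map_add, map_sum, convTranspose_algebraMap S.hopf hone,
      convTranspose_cocycle_sub S.hopf S.cocycle, map_sub (L _), map_sub (algebraMap ℝ H),
      Finset.sum_add_distrib, Finset.sum_sub_distrib]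
    abel
  choose D hD hint using fun i => exists_integral_bound (e := e) (M := M) (M' := M') S i
  have hW : PairBound 𝒜 p (N + 1 + 1) (N + 1) (scale (𝒜 := 𝒜) (p := p) (N := N) (γ := γ) (ω := ω)
      (L := L) (e := e) (T₁ := T₁) (M := M) (M' := M')) dist _ _ :=
    PairBound.sum Finset.univ fun i _ => PairBound.cocycle S.hopf S.norm (isScale S) S.cocycle i
      (truncated_remainder_bound (M := M) (M' := M') S i a)
  obtain ⟨C, hC, hW⟩ := hW
  have hp1 : 0 ≤ p (1 : H) := apply_nonneg p 1
  refine ⟨C + (∑ i, D i) * p 1, add_nonneg hC (mul_nonneg (Finset.sum_nonneg fun i _ => hD i) hp1),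
    fun q j hj => ?_⟩
  have hqs : 0 ≤ q.scale := (isScale S).nonneg q
  have hqd : 0 ≤ q.dist := q.pair.dist_nonneg
  obtain ⟨Js, hJs, hs⟩ := q.pair.sol.equation q.s q.hs (q.hst.trans q.ht)
  obtain ⟨Jt, hJt, ht⟩ := q.pair.sol.equation q.t (q.hs.trans q.hst) q.ht
  obtain ⟨Js', hJs', hs'⟩ := q.pair.sol'.equation q.s q.hs (q.hst.trans q.ht)
  obtain ⟨Jt', hJt', ht'⟩ := q.pair.sol'.equation q.t (q.hs.trans q.hst) q.ht
  rw [hrep q.pair.X q.pair.φ q.pair.Z q.s q.t Js Jt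
    (q.pair.rough.map_one _ _ q.hs q.hst q.ht) (hs a) (ht a),
    hrep q.pair.X' q.pair.φ' q.pair.Z' q.s q.t Js' Jt'
    (q.pair.rough'.map_one _ _ q.hs q.hst q.ht) (hs' a) (ht' a), add_sub_add_comm, map_add,
    ← map_sub (algebraMap ℝ H), ← Finset.sum_sub_distrib (G := ℝ)]
  refine (map_add_le_add p _ _).trans ?_
  rw [add_mul]
  refine add_le_add ?_ ?_
  · rw [map_sub (GradedAlgebra.proj 𝒜 j)]
    exact (hW q j (by omega)).2.2
  · by_cases h0 : j = 0
    · subst h0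
      rw [proj_of_mem (algebraMap_mem_zero _), Algebra.algebraMap_eq_smul_one, map_smul_eq_mul,
        Real.norm_eq_abs, mul_right_comm, Nat.sub_zero, Finset.sum_mul]
      refine mul_le_mul_of_nonneg_right ((Finset.abs_sum_le_sum_abs _ _).trans
        (Finset.sum_le_sum fun i _ => ?_)) hp1
      exact hint i q (Js i) (Jt i) (Js' i) (Jt' i) (hJs i) (hJt i) (hJs' i) (hJt' i) a
    · rw [proj_of_mem_ne (algebraMap_mem_zero _) (Ne.symm h0), map_zero]
      have : 0 ≤ ∑ i, D i := Finset.sum_nonneg fun i _ => hD i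
      positivity

end Segment

/-- The remainders of two solutions on `[0, T']` are close up to a factor that is small on short
intervals. -/
theorem exists_remNorm_sub_bound (S : Setting 𝒜 p N γ ω L T T₁) (e : ℕ) (M M' : ℝ) :
    ∃ C, 0 ≤ C ∧ ∀ c : SolutionPair 𝒜 p N γ ω L e T₁ M,
      controlledNorm 𝒜 p N γ ω c.T' c.X' c.Z' ≤ M' →
      remNorm 𝒜 p N γ ω c.T' (remainder c.X c.Z - remainder c.X' c.Z')
        ≤ C * (c.dist * ω 0 c.T' ^ γ) := by
  choose C hC hbd using fun a => Segment.exists_remainder_sub_bound (e := e) (M := M) (M' := M') S a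
  have hsum : 0 ≤ ∑ a, C a := Finset.sum_nonneg fun a _ => hC a
  refine ⟨∑ a, C a, hsum, fun c hc => ?_⟩
  have hT : c.T' ≤ T := c.le.trans S.le
  have hω0 : 0 ≤ ω 0 c.T' := S.control.nonneg _ _ le_rfl c.nonneg hT
  have hd := c.dist_nonneg
  refine remNorm_le (by positivity) fun j hj s t hs hst ht => ?_
  let q : Segment 𝒜 p N γ ω L e T₁ M M' := ⟨c, s, t, hc, hs, hst, ht⟩
  have hω : 0 ≤ ω s t := q.control_nonneg S
  have hq : 0 ≤ ω s t ^ γ := Real.rpow_nonneg hω _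
  have hle : ω s t ^ γ ≤ ω 0 c.T' ^ γ :=
    Real.rpow_le_rpow hω (S.control.mono le_rfl hs hst ht hT) S.gamma_pos.le
  rw [← Nat.cast_sub hj, rpow_mul_eq_pow hω]
  refine vecNorm_le (by positivity) fun a => ?_
  have h1 := hbd a q j hj
  have h2 : C a ≤ ∑ a, C a := Finset.single_le_sum (fun a _ => hC a) (Finset.mem_univ a)
  change p (GradedAlgebra.proj 𝒜 j (remainder c.X c.Z s t a - remainder c.X' c.Z' s t a))
    ≤ C a * (c.dist * (ω s t ^ γ) ^ (N + 1 - j)) at h1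
  refine h1.trans ((mul_le_mul_of_nonneg_right h2 (by positivity)).trans ?_)
  rw [mul_assoc, mul_assoc, show N + 1 - j = (N - j) + 1 by omega, pow_succ']
  gcongr

end Remainders

/-! ### The initial values -/

section Initial

variable {H : Type*} [CommRing H] [Algebra ℝ H] [Coalgebra ℝ H]
  {𝒜 : ℕ → Submodule ℝ H} [GradedAlgebra 𝒜] {p : Seminorm ℝ H} {N : ℕ}
  {γ : ℝ} {ω : ℝ → ℝ → ℝ} {d : ℕ} {L : Fin d → H →ₗ[ℝ] H} {T T₁ : ℝ}

/-- The value of a solution at time zero is determined by its scalar part: the equation yields the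
component of degree `m + 1` from those of degree at most `m`. This bound does not involve the norm
of the second solution. -/
theorem exists_initial_bound (S : Setting 𝒜 p N γ ω L T T₁) (e : ℕ) (M : ℝ) :
    ∃ C, 0 ≤ C ∧ ∀ c : SolutionPair 𝒜 p N γ ω L e T₁ M,
      vecNorm p (c.Z 0 - c.Z' 0) ≤ C * c.initialDist := by
  -- orders play no role at time zero: the calculus is used with scale one
  have hr : IsScale (fun _ : SolutionPair 𝒜 p N γ ω L e T₁ M => (1 : ℝ)) fun c => c.initialDist :=
    ⟨fun _ => zero_le_one, fun _ => le_rfl, fun c => c.initialDist_nonneg⟩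
  have hD : ∀ i, ∀ n ≤ N, ∀ (ι : Fin n → Fin e) (a : Fin e), ScalarBound 0
      (fun _ : SolutionPair 𝒜 p N γ ω L e T₁ M => (1 : ℝ)) (fun c => c.initialDist)
      (fun c => partialDeriv (c.φ i) (base (c.Z 0)) ι a)
      fun c => partialDeriv (c.φ' i) (base (c.Z' 0)) ι a := by
    intro i n hn ι a
    refine ⟨max M 0 * (1 + 1) + 1, by positivity, fun c => ?_⟩
    rw [pow_zero]
    have hm := c.mem_pathHull le_rfl c.nonneg
    refine c.near_partialDeriv S i hn hm.1 hm.2 zero_le_one ?_ le_rfl ι a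
    rw [one_mul]
    exact le_add_of_nonneg_right (Finset.sum_nonneg fun _ _ => derivNorm_nonneg _ _ _)
  have heq : ∀ (X : ℝ → ℝ → H →ₗ[ℝ] ℝ) (φ : Fin d → (Fin e → ℝ) → Fin e → ℝ) (Z : ℝ → Fin e → H)
      (T' : ℝ), 0 ≤ T' → IsSolution 𝒜 p N γ ω T' L X φ Z → ∀ (j : ℕ) (a : Fin e),
      GradedAlgebra.proj 𝒜 j (Z 0 a - algebraMap ℝ H (base (Z 0) a)) = if j = 0 then 0 else
        GradedAlgebra.proj 𝒜 j (∑ i, L i (smoothImage N (φ i) (Z 0) a)) := by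
    intro X φ Z T' hT' hsol j a
    split_ifs with hj
    · subst hj
      rw [map_sub, proj_of_mem (algebraMap_mem_zero _), base, algebraMap_counit S.hopf, sub_self]
    · obtain ⟨J, _, hJ⟩ := hsol.equation 0 le_rfl hT'
      conv_lhs => rw [hJ a]
      rw [add_sub_cancel_left, Finset.sum_add_distrib, map_add, ← map_sum (algebraMap ℝ H),
        proj_of_mem_ne (algebraMap_mem_zero _) (Ne.symm hj), add_zero]
  have hind : ∀ m, ∀ a, PairBound 𝒜 p m 0
      (fun _ : SolutionPair 𝒜 p N γ ω L e T₁ M => (1 : ℝ)) (fun c => c.initialDist)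
      (fun c => c.Z 0 a - algebraMap ℝ H (base (c.Z 0) a))
      fun c => c.Z' 0 a - algebraMap ℝ H (base (c.Z' 0) a) := by
    intro m
    induction m with
    | zero => exact fun a => ⟨0, le_rfl, fun _ j hj => absurd hj (Nat.not_lt_zero j)⟩
    | succ m ih =>
      intro a
      have h1 := (PairBound.sum Finset.univ fun i _ => PairBound.cocycle S.hopf S.norm hr S.cocycle
        i (PairBound.smoothImage_of_bound S.hopf S.norm hr a (fun n hn ι => hD i n hn ι a) ih)).mono
        hr (Nat.zero_le _)
      obtain ⟨C, hC, h1⟩ := h1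
      refine ⟨C, hC, fun c j hj => ?_⟩
      rw [heq c.X c.φ c.Z c.T' c.nonneg c.sol, heq c.X' c.φ' c.Z' c.T' c.nonneg c.sol']
      split_ifs with h0
      · exact Near.zero (map_zero p) hC (by positivity) c.initialDist_nonneg
      · exact h1 c j hj
  choose C hC hbd using hind (N + 1)
  have hp1 : 0 ≤ p (1 : H) := apply_nonneg p 1
  have hsum : 0 ≤ ∑ a, C a := Finset.sum_nonneg fun a _ => hC a
  refine ⟨((N + 1 : ℕ) : ℝ) * (∑ a, C a) + p 1, by positivity, fun c => ?_⟩
  have hδ := c.initialDist_nonneg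
  refine vecNorm_le (by positivity) fun a => ?_
  set w := c.Z 0 a - algebraMap ℝ H (base (c.Z 0) a)
  set w' := c.Z' 0 a - algebraMap ℝ H (base (c.Z' 0) a)
  have hdec : (c.Z 0 - c.Z' 0) a
      = (w - w') + algebraMap ℝ H ((base (c.Z 0) - base (c.Z' 0)) a) := by
    simp only [w, w', Pi.sub_apply, map_sub]
    abel
  have h1 : p (w - w') ≤ ((N + 1 : ℕ) : ℝ) * (∑ a, C a) * c.initialDist := by
    rw [← sum_proj S.hopf (w - w')]
    refine (seminorm_sum_le p _ _).trans ?_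
    have : ∀ j ∈ Finset.range (N + 1), p (GradedAlgebra.proj 𝒜 j (w - w'))
        ≤ (∑ a, C a) * c.initialDist := by
      intro j hj
      have h := (hbd a c j (Finset.mem_range.1 hj)).2.2
      rw [Nat.zero_sub, pow_zero, mul_one, ← map_sub] at h
      exact h.trans (mul_le_mul_of_nonneg_right
        (Finset.single_le_sum (fun a _ => hC a) (Finset.mem_univ a)) hδ)
    refine (Finset.sum_le_sum this).trans_eq ?_
    rw [Finset.sum_const, Finset.card_range, nsmul_eq_mul, mul_assoc]
  have h2 : p (algebraMap ℝ H ((base (c.Z 0) - base (c.Z' 0)) a)) ≤ p 1 * c.initialDist := by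
    rw [Algebra.algebraMap_eq_smul_one, map_smul_eq_mul, mul_comm]
    refine mul_le_mul_of_nonneg_left ((norm_le_pi_norm _ a).trans ?_) hp1
    exact le_add_of_nonneg_right (Finset.sum_nonneg fun _ _ => derivNorm_nonneg _ _ _)
  rw [hdec, add_mul]
  exact (map_add_le_add p _ _).trans (add_le_add h1 h2)

end Initial

end RoughControl

end

theorem theorem7p5
    {H : Type*} [CommRing H] [Algebra ℝ H] [Coalgebra ℝ H]
    (𝒜 : ℕ → Submodule ℝ H) [GradedAlgebra 𝒜]
    (γ : ℝ) (hγ0 : 0 < γ) (hγ1 : γ ≤ 1) (N : ℕ) (hN : N = ⌊1 / γ⌋₊)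
    (hH : RoughControl.IsTruncatedHopf 𝒜 N)
    (p : Seminorm ℝ H) (hp : RoughControl.IsGoodNorm 𝒜 p)
    (d e : ℕ) (L : Fin d → H →ₗ[ℝ] H) (hL : RoughControl.IsCocycleFamily 𝒜 N L)
    (T : ℝ) (hT : 0 < T) (ω : ℝ → ℝ → ℝ) (hω : RoughControl.IsRightContControl ω T)
    (M : ℝ) :
    ∃ (A : ℝ) (B : Fin d → ℝ) (E : ℝ), 0 ≤ A ∧ (∀ i, 0 ≤ B i) ∧ 0 ≤ E ∧
      ∀ M' : ℝ, ∃ T₀ : ℝ, 0 < T₀ ∧ T₀ ≤ T ∧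
        ∀ T' : ℝ, 0 ≤ T' → T' ≤ T₀ →
        ∀ X X' : ℝ → ℝ → H →ₗ[ℝ] ℝ,
          RoughControl.IsRoughPath 𝒜 p N γ ω T' X →
          RoughControl.IsRoughPath 𝒜 p N γ ω T' X' →
          RoughControl.roughNorm 𝒜 p N γ ω T' X ≤ M →
          RoughControl.roughNorm 𝒜 p N γ ω T' X' ≤ M →
        ∀ φ φ' : Fin d → (Fin e → ℝ) → Fin e → ℝ,
          (∀ i, ContDiff ℝ (N + 1 : ℕ) (φ i)) →
          (∀ i, ContDiff ℝ (N + 1 : ℕ) (φ' i)) →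
        ∀ Z Z' : ℝ → Fin e → H,
          RoughControl.IsSolution 𝒜 p N γ ω T' L X φ Z →
          RoughControl.IsSolution 𝒜 p N γ ω T' L X' φ' Z' →
          RoughControl.controlledNorm 𝒜 p N γ ω T' X Z ≤ M →
          RoughControl.controlledNorm 𝒜 p N γ ω T' X' Z' ≤ M' →
          (∀ i, RoughControl.derivNorm (N + 1) (RoughControl.pathHull T' Z Z') (φ i) ≤ M) →
          (∀ i, RoughControl.derivNorm (N + 1) (RoughControl.pathHull T' Z Z') (φ' i) ≤ M) →
          RoughControl.formalDist 𝒜 p N γ ω T' X X' Z Z'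
            ≤ A * ‖RoughControl.base (Z 0) - RoughControl.base (Z' 0)‖
              + ∑ i, B i *
                  RoughControl.derivNorm N (RoughControl.pathHull T' Z Z') (φ i - φ' i)
              + E * RoughControl.roughNorm 𝒜 p N γ ω T' (X - X') := by
  obtain ⟨T₁, hT₁0, hT₁, hω1⟩ := hω.exists_le hT zero_lt_one
  have hN1 : 1 ≤ N := by
    rw [hN]
    exact Nat.le_floor (by rw [Nat.cast_one]; exact (one_le_div hγ0).2 hγ1)
  have hNγ : 1 < ((N + 1 : ℕ) : ℝ) * γ := by
    have := Nat.lt_floor_add_one (1 / γ)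
    rw [← hN, div_lt_iff₀ hγ0] at this
    exact_mod_cast this
  have S : RoughControl.Setting 𝒜 p N γ ω L T T₁ :=
    ⟨hH, hp, hL, hω, hT₁, hω1, hγ0, hN1, hNγ⟩
  obtain ⟨C₀, hC₀, hinit⟩ := RoughControl.exists_initial_bound S e M
  refine ⟨2 * C₀ + 1, fun _ => 2 * C₀ + 1, 1, by positivity, fun _ => by positivity, zero_le_one,
    fun M' => ?_⟩
  obtain ⟨C, hC, hrem⟩ := RoughControl.exists_remNorm_sub_bound S e M M'
  -- on `[0, T₂]` the factor `C ω ^ γ` of the contraction is at most `1 / 2`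
  have hε : 0 < (1 / (2 * (C + 1))) ^ (1 / γ) := by positivity
  obtain ⟨T₂, hT₂0, hT₂, hω2⟩ := hω.exists_le hT hε
  refine ⟨min T₁ T₂, lt_min hT₁0 hT₂0, (min_le_left _ _).trans hT₁, ?_⟩
  intro T' hT'0 hT' X X' hX hX' hXM hXM' φ φ' hφ hφ' Z Z' hZ hZ' hZM hZM' hφM hφM'
  let c : RoughControl.SolutionPair 𝒜 p N γ ω L e T₁ M :=
    { T' := T', X := X, X' := X', φ := φ, φ' := φ', Z := Z, Z' := Z', nonneg := hT'0,
      le := hT'.trans (min_le_left _ _), rough := hX, rough' := hX', rough_le := hXM,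
      rough_le' := hXM', smooth := hφ, smooth' := hφ', sol := hZ, sol' := hZ',
      controlled_le := hZM, deriv_le := hφM, deriv_le' := hφM' }
  have h1 : RoughControl.vecNorm p (Z 0 - Z' 0) ≤ C₀ * c.initialDist := hinit c
  have h2 : RoughControl.remNorm 𝒜 p N γ ω T'
      (RoughControl.remainder X Z - RoughControl.remainder X' Z')
      ≤ C * (c.dist * ω 0 T' ^ γ) := hrem c hZM'
  have hT'2 : T' ≤ T₂ := hT'.trans (min_le_right _ _)
  have hω0 : 0 ≤ ω 0 T' := hω.nonneg _ _ le_rfl hT'0 (hT'2.trans hT₂)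
  have hsmall : ω 0 T' ^ γ ≤ 1 / (2 * (C + 1)) := by
    have h3 : ω 0 T' ≤ (1 / (2 * (C + 1))) ^ (1 / γ) :=
      (hω.mono le_rfl le_rfl hT'0 hT'2 hT₂).trans hω2
    refine (Real.rpow_le_rpow hω0 h3 hγ0.le).trans_eq ?_
    rw [← Real.rpow_mul (by positivity), one_div_mul_cancel hγ0.ne', Real.rpow_one]
  have hhalf : C * (c.dist * ω 0 T' ^ γ) ≤ c.dist / 2 := by
    have hd := c.dist_nonneg
    have h4 : C * ω 0 T' ^ γ ≤ 1 / 2 := by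
      refine (mul_le_mul_of_nonneg_left hsmall hC).trans ?_
      rw [mul_one_div, div_le_div_iff₀ (by positivity) (by norm_num)]
      linarith
    nlinarith
  have hdist : c.dist = (RoughControl.vecNorm p (Z 0 - Z' 0)
      + RoughControl.remNorm 𝒜 p N γ ω T'
        (RoughControl.remainder X Z - RoughControl.remainder X' Z')) + c.initialDist
      + RoughControl.roughNorm 𝒜 p N γ ω T' (X - X') := rfl
  have hini : c.initialDist = ‖RoughControl.base (Z 0) - RoughControl.base (Z' 0)‖
      + ∑ i, RoughControl.derivNorm N (RoughControl.pathHull T' Z Z') (φ i - φ' i) := rfl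
  rw [← Finset.mul_sum, RoughControl.formalDist]
  nlinarith
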